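/- **Setting.** Let $m\ge 1$, $I_m=\{(j,\alpha)\in\mathbb N^2 : j+\alpha\le m,\ j<m\}$, let $\mathcal M\subset\mathbb N\times\mathbb N$ be finite, $N=\#\mathcal M$, and let $a(x)$ and $c_{j,\alpha}(x)$ ($(j,\alpha)\in I_m$) be holomorphic near $0\in\mathbb C$. Put $$C(x;\lambda,\rho)=\lambda^m-\sum_{(j,\alpha)\in I_m}c_{j,\alpha}(x)\,\lambda^j\rho(\rho-1)\cdots(\rho-\alpha+1),$$ and let $G_2(t,x,\boldsymbol z)=\sum_{i+|\boldsymbol\nu|\ge 2}g_{i,\boldsymbol\nu}(x)t^i\boldsymbol z^{\boldsymbol\nu}$, $\boldsymbol z=\{z_{j,\alpha}\}_{(j,\alpha)\in\mathcal M}$, $\boldsymbol\nu\in\mathbb N^N$, be holomorphic near the origin of $\mathbb C_t\times\mathbb C_x\times\mathbb C^N_{\boldsymbol z}$. Consider $$C(x;t\partial_t,x\partial_x)u=a(x)t+G_2\bigl(t,x,\{(t\partial_t)^j\partial_x^\alpha u\}_{(j,\alpha)\in\mathcal M}\bigr).\qquad(*)$$ **Indices.** Let $\Lambda_0=\{(m,0)\}\cup\{(j,\alpha)\in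 I_m: c_{j,\alpha}(0)\ne0\}$, $\Lambda_1=\{(j,\alpha)\in I_m: c_{j,\alpha}(0)=0,\ c_{j,\alpha}\not\equiv0\}$, and let $\mathcal N_0$ be the convex hull of $\bigcup_{(j,\alpha)\in\Lambda_0}\{(x,y)\in\mathbb R^2: x\le j,\ y\le\alpha\}$. For $(j,\alpha)\in\Lambda_1$ let $p_{j,\alpha}\ge1$ be the order of the zero of $c_{j,\alpha}$ at $0$ and $d_{j,\alpha}=\min\{y\in\mathbb R:(j,\alpha-y)\in\mathcal N_0\}$, and put $$\sigma_0=\max\Bigl[1,\max_{(j,\alpha)\in\Lambda_1}\frac{p_{j,\alpha}+d_{j,\alpha}}{p_{j,\alpha}}\Bigr].$$ For $\mu\in\mathbb N$ let $J_\mu=\{(i,\boldsymbol\nu): i+|\boldsymbol\nu|\ge2,\ |\boldsymbol\nu|\ge1,\ (\partial_x^\mu g_{i,\boldsymbol\nu})(0)\ne0\}$, and for $|\boldsymbol\nu|\ge1$ let $m_{\boldsymbol\nu,\mu}=\max\{\,j+\max\{\alpha,\mu+\sigma_0(\alpha-\mu)\} : (j,\alpha)\in\mathcal M,\ \nu_{j,\alpha}>0\}$;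 put $$s_0=1+\max\Bigl[0,\ \sup_{\mu\ge0}\ \sup_{(i,\boldsymbol\nu)\in J_\mu}\frac{m_{\boldsymbol\nu,\mu}-m}{i+|\boldsymbol\nu|-1}\Bigr].$$ Let $M=\max\{\alpha:(j,\alpha)\in\mathcal M\}$ ($M=0$ if $\mathcal M=\emptyset$), let $L_{\mu,j,\alpha}\in\mathbb N\cup\{\infty\}$ be the least total degree in $(t,\boldsymbol z)$ of a monomial with nonzero coefficient in $(\partial_{z_{j,\alpha}}\partial_x^\mu G_2)(t,0,\boldsymbol z)$ ($\infty$ if there is none), and put, with $r/\infty=0$, $$s_1=1+\max\Bigl[0,\ \max_{0\le\mu\le M}\ \max_{(j,\alpha)\in\mathcal M,\ \alpha\ge\mu}\frac{j+\mu+\sigma_0(\alpha-\mu)-m}{L_{\mu,j,\alpha}}\Bigr].$$ For $s,\sigma\ge1$, a series $\sum u_{k,l}t^kx^l\in\mathbb C[[t,x]]$ belongs to $G\{t,x\}_{(s,\sigma)}$ if $\sum \frac{u_{k,l}}{k!^{\,s-1}\,l!^{\,\sigma-1}}t^kx^l$ converges near $(0,0)$. For $f(x)=\sum f_lx^l$,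 $f\gg0$ means that $f_l\ge0$ for all $l$. **Theorem.** Suppose $s_0=s_1$. If $\sigma_0=1$, suppose moreover that $s_0=1$; if $\sigma_0>1$, suppose moreover that $G_2$ really depends on $\boldsymbol z$, i.e. $g_{i,\boldsymbol\nu}\not\equiv0$ for some $(i,\boldsymbol\nu)$ with $|\boldsymbol\nu|\ge1$. Assume * c-1) $(\partial_x^m a)(0)>0$, $(\partial_x^\mu a)(0)>0$ for $0\le\mu\le M$, and $a(x)\gg0$; * c-2) $c_{j,\alpha}(0)\le0$ for all $(j,\alpha)\in I_m$; * c-3) $c_{j,\alpha}(x)-c_{j,\alpha}(0)\gg0$ for all $(j,\alpha)\in I_m$; * c-4) $g_{i,\boldsymbol\nu}(x)\gg0$ for all $(i,\boldsymbol\nu)$ with $i+|\boldsymbol\nu|\ge2$. Then $(*)$ has a unique formal solution $u(t,x)\in\mathbb C[[t,x]]$ with $u(0,x)\equiv0$, and for all $s,\sigma\ge1$, $u\in G\{t,x\}_{(s,\sigma)}$ if and only if $s\ge s_0$ and $\sigma\ge\sigma_0$. -/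

import Mathlib

open scoped PowerSeries ComplexOrder

noncomputable section

namespace TotChar

/-- The index set `I_m = {(j, α) ; j + α ≤ m, j < m}`. -/
def indexI (m : ℕ) : Finset (ℕ × ℕ) :=
  (Finset.range m ×ˢ Finset.range (m + 1)).filter fun p => p.1 + p.2 ≤ m

/-- `f` is a convergent power series in one variable (an element of `ℂ{x}`), i.e. the Taylor
series of a holomorphic germ at `0`. -/
def Convergent (f : ℂ⟦X⟧) : Prop :=
  ∃ r : ℝ, 0 < r ∧ Summable fun l : ℕ => ‖PowerSeries.coeff l f‖ * r ^ l

/-- `f(x) ≫ 0`: all coefficients are (real and) nonnegative. In the order on `ℂ` used here,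
`0 ≤ z` means that `z` is a nonnegative real number. -/
def SeriesNonneg (f : ℂ⟦X⟧) : Prop :=
  ∀ l : ℕ, 0 ≤ PowerSeries.coeff l f

/-- The data of an equation
`C(x; t∂_t, x∂_x) u = a(x) t + G₂(t, x, {(t∂_t)^j ∂_x^α u}_{(j,α) ∈ M})`, where
`C(x; λ, ρ) = λ^m - ∑_{(j,α) ∈ I_m} c_{j,α}(x) λ^j ρ(ρ-1)⋯(ρ-α+1)`.
Holomorphic germs are given by their (convergent) Taylor series:
`G₂(t, x, z) = ∑_{i+|ν| ≥ 2} g_{i,ν}(x) t^i z^ν`. -/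
structure Equation where
  /-- the order `m ≥ 1` of the principal part -/
  m : ℕ
  m_pos : 0 < m
  /-- the finite set of derivatives `(j, α)` that may occur in the nonlinear part -/
  M : Finset (ℕ × ℕ)
  a : ℂ⟦X⟧
  a_conv : Convergent a
  /-- the coefficients `c_{j,α}(x)`; only those with `(j, α) ∈ I_m` are ever used -/
  c : ℕ × ℕ → ℂ⟦X⟧
  c_conv : ∀ p ∈ indexI m, Convergent (c p)
  /-- the coefficients `g_{i,ν}(x)` of the nonlinear part -/
  g : ℕ → (M → ℕ) → ℂ⟦X⟧
  g_low : ∀ i ν, i + ∑ p, ν p < 2 → g i ν = 0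
  /-- `G₂` is holomorphic near the origin: its Taylor series converges in a polydisc. -/
  g_conv : ∃ r : ℝ, 0 < r ∧ Summable fun q : ℕ × (M → ℕ) × ℕ =>
    ‖PowerSeries.coeff q.2.2 (g q.1 q.2.1)‖ * r ^ (q.1 + (∑ p, q.2.1 p) + q.2.2)

/-! ### Formal series in `(t, x)`

`ℂ[[t,x]]` is realised as `ℂ[[x]][[t]]`; the coefficient of `t^k x^l` in `u` is
`coeff l (coeff k u)`. -/

/-- The Euler operator `t ∂_t` on `ℂ[[x]][[t]]`. -/
def tDt (u : ℂ⟦X⟧⟦X⟧) : ℂ⟦X⟧⟦X⟧ :=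
  PowerSeries.mk fun k => (k : ℂ) • PowerSeries.coeff k u

/-- The derivation `∂_x` on `ℂ[[x]][[t]]`. -/
def Dx (u : ℂ⟦X⟧⟦X⟧) : ℂ⟦X⟧⟦X⟧ :=
  PowerSeries.mk fun k => PowerSeries.derivative ℂ (PowerSeries.coeff k u)

/-- The Euler operator `x ∂_x` on `ℂ[[x]][[t]]`. -/
def xDx (u : ℂ⟦X⟧⟦X⟧) : ℂ⟦X⟧⟦X⟧ :=
  PowerSeries.C (PowerSeries.X : ℂ⟦X⟧) * Dx u

/-- The operator `[x∂_x]_α = (x∂_x)(x∂_x - 1)⋯(x∂_x - α + 1)`, with `[x∂_x]_0 = 1`. -/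
def fallingOp : ℕ → ℂ⟦X⟧⟦X⟧ → ℂ⟦X⟧⟦X⟧
  | 0, u => u
  | α + 1, u => xDx (fallingOp α u) - (α : ℂ) • fallingOp α u

/-- The formal Gevrey class `G{t,x}_{(s,σ)}` (for `s ≥ 1`, `σ ≥ 1`):
`∑ u_{k,l} / (k!^{s-1} l!^{σ-1}) t^k x^l` converges near the origin. -/
def IsGevrey (s σ : ℝ) (u : ℂ⟦X⟧⟦X⟧) : Prop :=
  ∃ r : ℝ, 0 < r ∧ Summable fun q : ℕ × ℕ =>
    ‖PowerSeries.coeff q.2 (PowerSeries.coeff q.1 u)‖ /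
      ((q.1.factorial : ℝ) ^ (s - 1) * (q.2.factorial : ℝ) ^ (σ - 1)) * r ^ (q.1 + q.2)

/-- The valuation of a formal series `∑ f_{i,ν} t^i z^ν`: the least `i + |ν|` with
`f_{i,ν} ≠ 0`, and `∞` for the zero series. -/
def val {ι : Type*} [Fintype ι] (f : ℕ → (ι → ℕ) → ℂ) : ℕ∞ :=
  ⨅ (i : ℕ) (ν : ι → ℕ) (_ : f i ν ≠ 0), ((i + ∑ p, ν p : ℕ) : ℕ∞)

namespace Equation

variable (E : Equation)

/-- The left-hand side `C(x; t∂_t, x∂_x) u`. -/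
def opC (u : ℂ⟦X⟧⟦X⟧) : ℂ⟦X⟧⟦X⟧ :=
  tDt^[E.m] u - ∑ p ∈ indexI E.m, PowerSeries.C (E.c p) * tDt^[p.1] (fallingOp p.2 u)

/-- The term `g_{i,ν}(x) t^i ∏_{(j,α) ∈ M} ((t∂_t)^j ∂_x^α u)^{ν_{j,α}}`. -/
def term (u : ℂ⟦X⟧⟦X⟧) (i : ℕ) (ν : E.M → ℕ) : ℂ⟦X⟧⟦X⟧ :=
  PowerSeries.C (E.g i ν) * PowerSeries.X ^ i *
    ∏ p : E.M, (tDt^[p.1.1] (Dx^[p.1.2] u)) ^ ν p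

/-- The series `G₂(t, x, {(t∂_t)^j ∂_x^α u})` for `u` with `u(0,x) = 0`: the coefficient of `t^k`
is the sum of the coefficients of `t^k` of all terms, only finitely many of which are nonzero
(`support_term_finite` below). -/
def nonlin (u : ℂ⟦X⟧⟦X⟧) : ℂ⟦X⟧⟦X⟧ :=
  PowerSeries.mk fun k => ∑ᶠ q : ℕ × (E.M → ℕ), PowerSeries.coeff k (E.term u q.1 q.2)

/-- `u` is a formal solution with `u(0,x) ≡ 0`. -/
def IsFormalSolution (u : ℂ⟦X⟧⟦X⟧) : Prop :=
  PowerSeries.coeff 0 u = 0 ∧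
    E.opC u = PowerSeries.C E.a * PowerSeries.X + E.nonlin u

/-! ### The Newton polygon and the irregularity -/

/-- `Λ₀ = {(m,0)} ∪ {(j,α) ∈ I_m ; c_{j,α}(0) ≠ 0}`. -/
def Lam0 : Set (ℕ × ℕ) :=
  {(E.m, 0)} ∪ {p | p ∈ indexI E.m ∧ PowerSeries.constantCoeff (E.c p) ≠ 0}

/-- `Λ₁ = {(j,α) ∈ I_m ; c_{j,α}(0) = 0, c_{j,α} ≢ 0}`. -/
def Lam1 : Set (ℕ × ℕ) :=
  {p | p ∈ indexI E.m ∧ PowerSeries.constantCoeff (E.c p) = 0 ∧ E.c p ≠ 0}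

/-- The Newton polygon at `x = 0`: the convex hull of the union of the quadrants
`{(x,y) ; x ≤ j, y ≤ α}`, `(j,α) ∈ Λ₀`. -/
def newton : Set (ℝ × ℝ) :=
  convexHull ℝ (⋃ p ∈ E.Lam0, {w : ℝ × ℝ | w.1 ≤ (p.1 : ℝ) ∧ w.2 ≤ (p.2 : ℝ)})

/-- `p_{j,α}`: the order of the zero of `c_{j,α}` at `x = 0` (for `c_{j,α} ≢ 0`). -/
def ordC (p : ℕ × ℕ) : ℕ := (E.c p).order.toNat

/-- `d_{j,α} = min {y ; (j, α - y) ∈ N₀}`; for `j ≤ m` the set is a closed half-line bounded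
below, so the infimum is a minimum. -/
def dist (p : ℕ × ℕ) : ℝ :=
  sInf {y : ℝ | ((p.1 : ℝ), (p.2 : ℝ) - y) ∈ E.newton}

/-- The irregularity `σ₀ = max [1, max_{(j,α) ∈ Λ₁} (p_{j,α} + d_{j,α}) / p_{j,α}]`
(a maximum of finitely many numbers). -/
def sigma0 : ℝ :=
  sSup (insert 1 ((fun p => ((E.ordC p : ℝ) + E.dist p) / (E.ordC p : ℝ)) '' E.Lam1))

/-! ### The indices `s₀` and `s₁` -/

/-- `J_μ = {(i,ν) ; i + |ν| ≥ 2, |ν| ≥ 1, (∂_x^μ g_{i,ν})(0) ≠ 0}`. -/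
def J (μ : ℕ) : Set (ℕ × (E.M → ℕ)) :=
  {q | 2 ≤ q.1 + ∑ p, q.2 p ∧ 1 ≤ ∑ p, q.2 p ∧
    PowerSeries.constantCoeff ((PowerSeries.derivative ℂ)^[μ] (E.g q.1 q.2)) ≠ 0}

/-- `m_{ν,μ} = max_{(j,α) ; ν_{j,α} > 0} (j + max {α, μ + σ₀ (α - μ)})`, for `|ν| ≥ 1`
(a maximum over a nonempty finite set). -/
def mIdx (ν : E.M → ℕ) (μ : ℕ) : ℝ :=
  sSup ((fun p : E.M => (p.1.1 : ℝ) +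
    max (p.1.2 : ℝ) ((μ : ℝ) + E.sigma0 * ((p.1.2 : ℝ) - (μ : ℝ)))) '' {p | 0 < ν p})

/-- `s₀ = 1 + max [0, sup_{μ ≥ 0} sup_{(i,ν) ∈ J_μ} (m_{ν,μ} - m) / (i + |ν| - 1)]`; the set is
bounded above, since `m_{ν,μ} ≤ max_{(j,α) ∈ M} (j + σ₀ α)` and the denominators are `≥ 1`. -/
def s0 : ℝ :=
  1 + sSup (insert 0 {r : ℝ | ∃ μ : ℕ, ∃ q ∈ E.J μ,
    r = (E.mIdx q.2 μ - (E.m : ℝ)) / ((q.1 : ℝ) + ((∑ p, q.2 p : ℕ) : ℝ) - 1)})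

/-- `L_{μ,j,α} = val ((∂_{z_{j,α}} ∂_x^μ G₂)(t, 0, z))`. The coefficient of `t^i z^ν` in that
series is `(ν_{j,α} + 1) (∂_x^μ g_{i,ν+e_{j,α}})(0)`. -/
def L (μ : ℕ) (p : E.M) : ℕ∞ :=
  val fun (i : ℕ) (ν : E.M → ℕ) => ((ν p : ℂ) + 1) *
    PowerSeries.constantCoeff ((PowerSeries.derivative ℂ)^[μ] (E.g i (ν + Pi.single p 1)))

/-- `M = max {α ; (j,α) ∈ M}`. -/
def maxAlpha : ℕ := E.M.sup Prod.snd

open Classical in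
/-- `s₁ = 1 + max [0, max_{0 ≤ μ ≤ maxAlpha} max_{(j,α) ∈ M, α ≥ μ}
(j + μ + σ₀ (α - μ) - m) / L_{μ,j,α}]`, where a quotient by `∞` is `0`
(a maximum of finitely many numbers). -/
def s1 : ℝ :=
  1 + sSup (insert 0 {r : ℝ | ∃ μ : ℕ, μ ≤ E.maxAlpha ∧ ∃ p : E.M, μ ≤ p.1.2 ∧
    r = if E.L μ p = ⊤ then 0 else
      ((p.1.1 : ℝ) + (μ : ℝ) + E.sigma0 * ((p.1.2 : ℝ) - (μ : ℝ)) - (E.m : ℝ)) /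
        ((E.L μ p).toNat : ℝ)})

/-- If `u(0,x) = 0`, then only finitely many terms contribute to each power of `t`. -/
theorem support_term_finite (u : ℂ⟦X⟧⟦X⟧) (hu : PowerSeries.coeff 0 u = 0) (k : ℕ) :
    (Function.support fun q : ℕ × (E.M → ℕ) =>
      PowerSeries.coeff k (E.term u q.1 q.2)).Finite := by
  have hD : ∀ v : ℂ⟦X⟧⟦X⟧, PowerSeries.coeff 0 v = 0 → PowerSeries.coeff 0 (Dx v) = 0 := by
    intro v hv
    rw [Dx, PowerSeries.coeff_mk, hv, map_zero]
  have hT : ∀ v : ℂ⟦X⟧⟦X⟧, PowerSeries.coeff 0 v = 0 → PowerSeries.coeff 0 (tDt v) = 0 := by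
    intro v hv
    rw [tDt, PowerSeries.coeff_mk, hv, smul_zero]
  have hDn : ∀ n, PowerSeries.coeff 0 (Dx^[n] u) = 0 := by
    intro n
    induction n with
    | zero => exact hu
    | succ n ih => rw [Function.iterate_succ_apply']; exact hD _ ih
  have hTn : ∀ j n, PowerSeries.coeff 0 (tDt^[j] (Dx^[n] u)) = 0 := by
    intro j n
    induction j with
    | zero => exact hDn n
    | succ j ih => rw [Function.iterate_succ_apply']; exact hT _ ih
  have hfin : ((Finset.range (k + 1) ×ˢ
      Fintype.piFinset fun _ : E.M => Finset.range (k + 1) : Finset (ℕ × (E.M → ℕ))) :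
        Set (ℕ × (E.M → ℕ))).Finite := Finset.finite_toSet _
  refine hfin.subset ?_
  rintro ⟨i, ν⟩ hq
  have hdvd : (PowerSeries.X : ℂ⟦X⟧⟦X⟧) ^ (i + ∑ p, ν p) ∣ E.term u i ν := by
    rw [term, pow_add, ← Finset.prod_pow_eq_pow_sum]
    refine mul_dvd_mul (Dvd.intro_left _ rfl) (Finset.prod_dvd_prod_of_dvd _ _ ?_)
    intro p _
    refine pow_dvd_pow_of_dvd (PowerSeries.X_dvd_iff.2 ?_) _
    rw [← PowerSeries.coeff_zero_eq_constantCoeff_apply]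
    exact hTn _ _
  have hle : i + ∑ p, ν p ≤ k := by
    by_contra hlt
    exact hq (PowerSeries.X_pow_dvd_iff.1 hdvd k (not_le.1 hlt))
  have hν : ∀ p, ν p ≤ ∑ p, ν p := fun p =>
    Finset.single_le_sum (f := ν) (fun _ _ => Nat.zero_le _) (Finset.mem_univ p)
  simp only [Finset.coe_product, Set.mem_prod, Finset.mem_coe, Finset.mem_range,
    Fintype.mem_piFinset]
  exact ⟨by omega, fun p => by have := hν p; omega⟩

end Equation

end TotChar

end

/-!
The equation determines the coefficients `u_{k,l}` recursively: `C(0; k, l) u_{k,l}` is a polynomial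
in the preceding coefficients, and under the sign conditions `C(0; k, l) ≥ k^m > 0` while that
polynomial has nonnegative coefficients. Hence there is exactly one formal solution, and `u ≫ 0`.

For `s ≥ s₀` and `σ ≥ σ₀` the coefficient of `t^(κ+1)` is majorized by
`A^κ (κ+1)!^(s₀-1) (κ+1)^(-B) ∑ R^l ((N)_l)^σ₀ / l! x^l`, where `(N)_l` is the rising factorial and
`N` grows linearly in `κ`. Such majorants are closed under products. A linear term with
`c_{j,α}(0) = 0` is absorbed for large `R`, because the `p_{j,α}` lost indices make up for the
excess over the Newton polygon, and a nonlinear term with `i + |ν| = r + 1` is absorbed for large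
`A`, because its `r` lost indices in `t` make up for its derivatives.

Conversely, all terms of the recursion are nonnegative, so every single one bounds `u_{k,l}` from
below. Iterating a term `(j, α) ∈ Λ₁` at a fixed `k ~ l^θ`, with `θ` the slope of a line that
separates `(j, α - y)` from the Newton polygon, yields `u_{k,l}` of size `l!^(y / p_{j,α})` for
every `y < d_{j,α}`, whence `σ ≥ σ₀`. From a point near the axis `k = 0` reached in this way, a
nonlinear term leads back down to small `l`; the growth in `k` accumulated on the way shows that
`s ≥ s₁`.
-/

namespace TotChar

open PowerSeries Filter
open scoped Pointwise Topology
open Finset.HasAntidiagonal (antidiagonal mem_antidiagonal)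

theorem existsUnique_forall_eq_of_wellFounded {α β : Type*} [Nonempty β] {r : α → α → Prop}
    (hr : WellFounded r) {Φ : α → (α → β) → β}
    (hΦ : ∀ a v w, (∀ b, r b a → v b = w b) → Φ a v = Φ a w) :
    ∃! v : α → β, ∀ a, v a = Φ a v := by
  classical
  inhabit β
  refine ⟨hr.fix fun a rec => Φ a fun b => if h : r b a then rec b h else default, fun a => ?_,
    fun w hw => funext fun a => ?_⟩
  · rw [hr.fix_eq]
    exact hΦ _ _ _ fun b hb => dif_pos hb
  · induction a using hr.induction with
    | _ a ih =>
      rw [hw, hr.fix_eq]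
      exact hΦ _ _ _ fun b hb => by rw [dif_pos hb, ih b hb]

/-! ### Coefficients of the operators -/

theorem coeff_tDt_iterate (j k : ℕ) (u : ℂ⟦X⟧⟦X⟧) :
    coeff k (tDt^[j] u) = (k : ℂ) ^ j • coeff k u := by
  induction j with
  | zero => simp
  | succ j ih => rw [Function.iterate_succ_apply', tDt, coeff_mk, ih, smul_smul, pow_succ']

theorem coeff_Dx_iterate (α k : ℕ) (u : ℂ⟦X⟧⟦X⟧) :
    coeff k (Dx^[α] u) = (derivative ℂ)^[α] (coeff k u) := by
  induction α with
  | zero => simp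
  | succ j ih => rw [Function.iterate_succ_apply', Function.iterate_succ_apply', Dx, coeff_mk, ih]

theorem coeff_derivative_iterate (f : ℂ⟦X⟧) (α l : ℕ) :
    coeff l ((derivative ℂ)^[α] f) = ((l + α).descFactorial α : ℂ) * coeff (l + α) f := by
  rw [coeff_iterate_derivative, Nat.add_descFactorial_eq_ascFactorial]

theorem coeff_tDt_Dx (j α k l : ℕ) (u : ℂ⟦X⟧⟦X⟧) :
    coeff l (coeff k (tDt^[j] (Dx^[α] u))) =
      (k : ℂ) ^ j * (((l + α).descFactorial α : ℂ) * coeff (l + α) (coeff k u)) := by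
  rw [coeff_tDt_iterate, coeff_Dx_iterate, coeff_smul, coeff_derivative_iterate, smul_eq_mul]

theorem coeff_zero_tDt_Dx {u : ℂ⟦X⟧⟦X⟧} (hu : coeff 0 u = 0) (j α : ℕ) :
    coeff 0 (tDt^[j] (Dx^[α] u)) = 0 := by
  ext l
  rw [coeff_tDt_Dx, hu]
  simp

theorem coeff_xDx (k l : ℕ) (u : ℂ⟦X⟧⟦X⟧) :
    coeff l (coeff k (xDx u)) = (l : ℂ) * coeff l (coeff k u) := by
  rw [xDx, coeff_C_mul, Dx, coeff_mk]
  cases l with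
  | zero => simp
  | succ l =>
    rw [coeff_succ_X_mul, coeff_derivative]
    push_cast
    ring

theorem coeff_fallingOp (α k l : ℕ) (u : ℂ⟦X⟧⟦X⟧) :
    coeff l (coeff k (fallingOp α u)) = (l.descFactorial α : ℂ) * coeff l (coeff k u) := by
  induction α with
  | zero => simp [fallingOp]
  | succ α ih =>
    rw [fallingOp, map_sub, map_sub, coeff_xDx, coeff_smul, coeff_smul, ih, Nat.descFactorial_succ,
      smul_eq_mul]
    rcases le_or_gt α l with h | h
    · push_cast [h]
      ring
    · rw [Nat.descFactorial_eq_zero_iff_lt.2 h]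
      simp

/-! ### Series with nonnegative coefficients -/

/-- The power series all of whose coefficients lie in a given subsemiring. -/
def coeffSubsemiring {R : Type*} [Semiring R] (S : Subsemiring R) : Subsemiring R⟦X⟧ where
  carrier := {f | ∀ n, coeff n f ∈ S}
  mul_mem' hf hg n := by
    rw [coeff_mul]
    exact sum_mem fun x _ => mul_mem (hf x.1) (hg x.2)
  one_mem' n := by
    rw [coeff_one]
    split_ifs
    exacts [one_mem S, zero_mem S]
  add_mem' hf hg n := by
    rw [map_add]
    exact add_mem (hf n) (hg n)
  zero_mem' n := by
    rw [map_zero]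
    exact zero_mem S

section coeffSubsemiring

variable {R : Type*} [Semiring R] {S : Subsemiring R}

theorem C_mem_coeffSubsemiring {a : R} (ha : a ∈ S) : C a ∈ coeffSubsemiring S := fun n => by
  rw [coeff_C]
  split_ifs
  exacts [ha, zero_mem S]

theorem X_mem_coeffSubsemiring : (X : R⟦X⟧) ∈ coeffSubsemiring S := fun n => by
  rw [coeff_X]
  split_ifs
  exacts [one_mem S, zero_mem S]

end coeffSubsemiring

/-- The double series `u(t, x)` with `u ≫ 0`. -/
noncomputable def nonnegSeries : Subsemiring ℂ⟦X⟧⟦X⟧ :=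
  coeffSubsemiring (coeffSubsemiring (Subsemiring.nonneg ℂ))

theorem mem_nonnegSeries {f : ℂ⟦X⟧⟦X⟧} :
    f ∈ nonnegSeries ↔ ∀ k l, 0 ≤ coeff l (coeff k f) :=
  Iff.rfl

section nonnegSeries

variable {f g : ℂ⟦X⟧⟦X⟧}

theorem tDt_Dx_mem_nonnegSeries (hf : f ∈ nonnegSeries) (j α : ℕ) :
    tDt^[j] (Dx^[α] f) ∈ nonnegSeries := mem_nonnegSeries.2 fun k l => by
  rw [coeff_tDt_Dx]
  exact mul_nonneg (pow_nonneg (Nat.cast_nonneg _) _)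
    (mul_nonneg (Nat.cast_nonneg _) (mem_nonnegSeries.1 hf _ _))

theorem coeff_mul_coeff_le (hf : f ∈ nonnegSeries) (hg : g ∈ nonnegSeries) (k₁ k₂ l₁ l₂ : ℕ) :
    coeff l₁ (coeff k₁ f) * coeff l₂ (coeff k₂ g) ≤
      coeff (l₁ + l₂) (coeff (k₁ + k₂) (f * g)) := by
  calc coeff l₁ (coeff k₁ f) * coeff l₂ (coeff k₂ g)
      ≤ coeff (l₁ + l₂) (coeff k₁ f * coeff k₂ g) := by
        rw [coeff_mul]
        exact Finset.single_le_sum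
          (f := fun x : ℕ × ℕ => coeff x.1 (coeff k₁ f) * coeff x.2 (coeff k₂ g))
          (fun x _ => mul_nonneg (hf _ _) (hg _ _)) (a := (l₁, l₂)) (by simp)
    _ ≤ coeff (l₁ + l₂) (coeff (k₁ + k₂) (f * g)) := by
        rw [coeff_mul (k₁ + k₂), map_sum]
        exact Finset.single_le_sum
          (f := fun x : ℕ × ℕ => coeff (l₁ + l₂) (coeff x.1 f * coeff x.2 g))
          (fun x _ => mul_mem (hf x.1) (hg x.2) _) (a := (k₁, k₂)) (by simp)

theorem coeff_one_pow_le (hf : f ∈ nonnegSeries) (n : ℕ) :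
    coeff 0 (coeff 1 f) ^ n ≤ coeff 0 (coeff n (f ^ n)) := by
  induction n with
  | zero => simp
  | succ n ih =>
    rw [pow_succ, pow_succ]
    exact (mul_le_mul_of_nonneg_right ih (hf 1 0)).trans
      (coeff_mul_coeff_le (pow_mem hf n) hf n 1 0 0)

theorem prod_coeff_one_pow_le {ι : Type*} (s : Finset ι) {f : ι → ℂ⟦X⟧⟦X⟧}
    (hf : ∀ i, f i ∈ nonnegSeries) (ν : ι → ℕ) :
    ∏ i ∈ s, coeff 0 (coeff 1 (f i)) ^ ν i ≤
      coeff 0 (coeff (∑ i ∈ s, ν i) (∏ i ∈ s, f i ^ ν i)) := by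
  classical
  induction s using Finset.induction_on with
  | empty => simp
  | insert a s ha ih =>
    rw [Finset.prod_insert ha, Finset.prod_insert ha, Finset.sum_insert ha]
    refine le_trans ?_ (coeff_mul_coeff_le (pow_mem (hf a) (ν a))
      (prod_mem fun i _ => pow_mem (hf i) (ν i)) (ν a) (∑ i ∈ s, ν i) 0 0)
    exact mul_le_mul (coeff_one_pow_le (hf a) _) ih
      (Finset.prod_nonneg fun i _ => pow_nonneg (hf i 1 0) _) (pow_mem (hf a) _ _ _)

end nonnegSeries

/-! ### The recursion for the coefficients -/

/-- The quotient of a series by the variable, the constant term being dropped. -/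
noncomputable def shift {R : Type*} [Semiring R] (v : R⟦X⟧) : R⟦X⟧ :=
  mk fun κ => coeff (κ + 1) v

theorem X_mul_shift {R : Type*} [Semiring R] {v : R⟦X⟧} (hv : coeff 0 v = 0) : X * shift v = v := by
  conv_rhs => rw [eq_X_mul_shift_add_const v, ← coeff_zero_eq_constantCoeff_apply, hv, map_zero,
    add_zero]
  rfl

/-- The series without constant term in `t` whose coefficient of `t^{k+1} x^l` is `v (k, l)`. -/
noncomputable def ofCoeffs (v : ℕ × ℕ → ℂ) : ℂ⟦X⟧⟦X⟧ :=
  X * mk fun k => mk fun l => v (k, l)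

theorem coeff_zero_ofCoeffs (v : ℕ × ℕ → ℂ) : coeff 0 (ofCoeffs v) = 0 :=
  coeff_zero_X_mul _

theorem coeff_succ_ofCoeffs (v : ℕ × ℕ → ℂ) (k l : ℕ) :
    coeff l (coeff (k + 1) (ofCoeffs v)) = v (k, l) := by
  rw [ofCoeffs, coeff_succ_X_mul, coeff_mk, coeff_mk]

theorem ofCoeffs_coeff_succ {u : ℂ⟦X⟧⟦X⟧} (hu : coeff 0 u = 0) :
    ofCoeffs (fun q => coeff q.2 (coeff (q.1 + 1) u)) = u := by
  ext k l
  cases k with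
  | zero => rw [coeff_zero_ofCoeffs, hu]
  | succ k => rw [coeff_succ_ofCoeffs]

namespace Equation

variable (E : Equation)

/-- The indicial polynomial `C(0; k, l)`. -/
noncomputable def indicial (k l : ℕ) : ℂ :=
  (k : ℂ) ^ E.m - ∑ p ∈ indexI E.m,
    constantCoeff (E.c p) * ((k : ℂ) ^ p.1 * (l.descFactorial p.2 : ℂ))

/-- The factor of `u_{k,l'}`, `l' < l`, in the equation for the coefficient of `t^k x^l`, moved to
the right-hand side. -/
noncomputable def lowerCoeff (k l l' : ℕ) : ℂ :=
  ∑ p ∈ indexI E.m, coeff (l - l') (E.c p) * ((k : ℂ) ^ p.1 * (l'.descFactorial p.2 : ℂ))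

theorem coeff_C_mul_tDt_fallingOp (f : ℂ⟦X⟧) (p : ℕ × ℕ) (u : ℂ⟦X⟧⟦X⟧) (k l : ℕ) :
    coeff l (coeff k (C f * tDt^[p.1] (fallingOp p.2 u))) =
      constantCoeff f * ((k : ℂ) ^ p.1 * (l.descFactorial p.2 : ℂ)) * coeff l (coeff k u) +
        ∑ l' ∈ Finset.range l, coeff (l - l') f * ((k : ℂ) ^ p.1 * (l'.descFactorial p.2 : ℂ)) *
          coeff l' (coeff k u) := by
  have coeff_factor : ∀ l', coeff l' (coeff k (tDt^[p.1] (fallingOp p.2 u))) =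
      (k : ℂ) ^ p.1 * ((l'.descFactorial p.2 : ℂ) * coeff l' (coeff k u)) := fun l' => by
    rw [coeff_tDt_iterate, coeff_smul, coeff_fallingOp, smul_eq_mul]
  rw [coeff_C_mul, mul_comm, coeff_mul, Finset.Nat.sum_antidiagonal_eq_sum_range_succ_mk,
    Finset.sum_range_succ, add_comm]
  simp only [coeff_factor, Nat.sub_self, coeff_zero_eq_constantCoeff_apply]
  congr 1
  · ring
  · exact Finset.sum_congr rfl fun l' _ => by ring

theorem coeff_opC (u : ℂ⟦X⟧⟦X⟧) (k l : ℕ) :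
    coeff l (coeff k (E.opC u)) = E.indicial k l * coeff l (coeff k u) -
      ∑ l' ∈ Finset.range l, E.lowerCoeff k l l' * coeff l' (coeff k u) := by
  rw [opC, map_sub, map_sub, map_sum, map_sum, coeff_tDt_iterate, coeff_smul, smul_eq_mul]
  simp_rw [coeff_C_mul_tDt_fallingOp]
  rw [Finset.sum_add_distrib, Finset.sum_comm, indicial]
  simp_rw [lowerCoeff, sub_mul, Finset.sum_mul]
  ring

/-- The product of the derivatives of `u` in a nonlinear term, each factor divided by `t`. -/
noncomputable def shiftProd (u : ℂ⟦X⟧⟦X⟧) (ν : E.M → ℕ) : ℂ⟦X⟧⟦X⟧ :=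
  ∏ p : E.M, shift (tDt^[p.1.1] (Dx^[p.1.2] u)) ^ ν p

variable {E}

theorem term_eq_X_pow_mul {u : ℂ⟦X⟧⟦X⟧} (hu : coeff 0 u = 0) (i : ℕ) (ν : E.M → ℕ) :
    E.term u i ν = X ^ (i + ∑ p, ν p) * (C (E.g i ν) * E.shiftProd u ν) := by
  have prod_eq : ∏ p : E.M, (tDt^[p.1.1] (Dx^[p.1.2] u)) ^ ν p =
      X ^ (∑ p, ν p) * E.shiftProd u ν := by
    rw [shiftProd, ← Finset.prod_pow_eq_pow_sum, ← Finset.prod_mul_distrib]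
    exact Finset.prod_congr rfl fun p _ => by
      rw [← mul_pow, X_mul_shift (coeff_zero_tDt_Dx hu _ _)]
  rw [term, prod_eq, pow_add]
  ring

theorem coeff_term {u : ℂ⟦X⟧⟦X⟧} (hu : coeff 0 u = 0) (i : ℕ) (ν : E.M → ℕ) (k : ℕ) :
    coeff k (E.term u i ν) = if i + ∑ p, ν p ≤ k then
      E.g i ν * coeff (k - (i + ∑ p, ν p)) (E.shiftProd u ν) else 0 := by
  rw [term_eq_X_pow_mul hu, coeff_X_pow_mul', coeff_C_mul]

theorem coeff_shiftProd_congr {u w : ℂ⟦X⟧⟦X⟧} {K : ℕ} (h : ∀ k ≤ K + 1, coeff k u = coeff k w)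
    (ν : E.M → ℕ) : coeff K (E.shiftProd u ν) = coeff K (E.shiftProd w ν) := by
  have eq_mod : Ideal.Quotient.mk (Ideal.span {(X : ℂ⟦X⟧⟦X⟧) ^ (K + 1)}) (E.shiftProd u ν) =
      Ideal.Quotient.mk _ (E.shiftProd w ν) := by
    rw [shiftProd, shiftProd, map_prod, map_prod]
    refine Finset.prod_congr rfl fun p _ => ?_
    rw [map_pow, map_pow]
    congr 1
    rw [Ideal.Quotient.eq, Ideal.mem_span_singleton, X_pow_dvd_iff]
    intro n hn
    rw [map_sub, sub_eq_zero, shift, shift, coeff_mk, coeff_mk]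
    ext l
    rw [coeff_tDt_Dx, coeff_tDt_Dx, h (n + 1) (by omega)]
  rw [Ideal.Quotient.eq, Ideal.mem_span_singleton, X_pow_dvd_iff] at eq_mod
  exact sub_eq_zero.1 (by rw [← map_sub]; exact eq_mod K (by omega))

theorem coeff_nonlin_congr {u w : ℂ⟦X⟧⟦X⟧} (hu : coeff 0 u = 0) (hw : coeff 0 w = 0) {k : ℕ}
    (h : ∀ k' < k, coeff k' u = coeff k' w) : coeff k (E.nonlin u) = coeff k (E.nonlin w) := by
  rw [nonlin, nonlin, coeff_mk, coeff_mk]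
  refine finsum_congr fun q => ?_
  rw [coeff_term hu, coeff_term hw]
  split_ifs with hk
  · by_cases h2 : q.1 + ∑ p, q.2 p < 2
    · rw [E.g_low _ _ h2, zero_mul, zero_mul]
    · rw [coeff_shiftProd_congr fun k' hk' => h k' (by omega)]
  · rfl

theorem coeff_zero_nonlin {u : ℂ⟦X⟧⟦X⟧} (hu : coeff 0 u = 0) : coeff 0 (E.nonlin u) = 0 := by
  rw [nonlin, coeff_mk]
  refine finsum_eq_zero_of_forall_eq_zero fun q => ?_
  rw [coeff_term hu]
  split_ifs with h
  · rw [E.g_low _ _ (by omega), zero_mul]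
  · rfl

variable (E) in
/-- The right-hand side of the equation. -/
noncomputable def rhs (u : ℂ⟦X⟧⟦X⟧) : ℂ⟦X⟧⟦X⟧ :=
  C E.a * X + E.nonlin u

theorem coeff_zero_rhs {u : ℂ⟦X⟧⟦X⟧} (hu : coeff 0 u = 0) : coeff 0 (E.rhs u) = 0 := by
  rw [rhs, map_add, coeff_zero_nonlin hu, mul_comm, coeff_zero_X_mul, add_zero]

theorem coeff_rhs_congr {u w : ℂ⟦X⟧⟦X⟧} (hu : coeff 0 u = 0) (hw : coeff 0 w = 0) {k : ℕ}
    (h : ∀ k' < k, coeff k' u = coeff k' w) : coeff k (E.rhs u) = coeff k (E.rhs w) := by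
  rw [rhs, rhs, map_add, map_add, coeff_nonlin_congr hu hw h]

theorem isFormalSolution_iff {u : ℂ⟦X⟧⟦X⟧} :
    E.IsFormalSolution u ↔ coeff 0 u = 0 ∧ ∀ k, 1 ≤ k → ∀ l,
      E.indicial k l * coeff l (coeff k u) =
        ∑ l' ∈ Finset.range l, E.lowerCoeff k l l' * coeff l' (coeff k u) +
          coeff l (coeff k (E.rhs u)) := by
  refine and_congr_right fun hu => ?_
  change E.opC u = E.rhs u ↔ _
  constructor
  · intro h k _ l
    rw [← h, coeff_opC]
    ring
  · intro h
    ext k l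
    rcases Nat.eq_zero_or_pos k with rfl | hk
    · rw [coeff_opC, coeff_zero_rhs hu, hu]
      simp
    · rw [coeff_opC, h k hk]
      ring

variable (E) in
/-- The value prescribed by the equation for the coefficient of `t^{k+1} x^l`, `q = (k, l)`. -/
noncomputable def nextCoeff (q : ℕ × ℕ) (v : ℕ × ℕ → ℂ) : ℂ :=
  (∑ l' ∈ Finset.range q.2, E.lowerCoeff (q.1 + 1) q.2 l' * v (q.1, l') +
    coeff q.2 (coeff (q.1 + 1) (E.rhs (ofCoeffs v)))) / E.indicial (q.1 + 1) q.2

theorem nextCoeff_congr {q : ℕ × ℕ} {v w : ℕ × ℕ → ℂ}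
    (h : ∀ q', Prod.Lex (· < ·) (· < ·) q' q → v q' = w q') :
    E.nextCoeff q v = E.nextCoeff q w := by
  have rhs_eq : coeff (q.1 + 1) (E.rhs (ofCoeffs v)) = coeff (q.1 + 1) (E.rhs (ofCoeffs w)) := by
    refine coeff_rhs_congr (coeff_zero_ofCoeffs v) (coeff_zero_ofCoeffs w) fun k hk => ?_
    ext l
    cases k with
    | zero => rw [coeff_zero_ofCoeffs, coeff_zero_ofCoeffs]
    | succ k => rw [coeff_succ_ofCoeffs, coeff_succ_ofCoeffs, h _ (.left _ _ (by omega))]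
  rw [nextCoeff, nextCoeff, rhs_eq]
  congr 2
  exact Finset.sum_congr rfl fun l' hl' => by rw [h _ (.right _ (Finset.mem_range.1 hl'))]

theorem isFormalSolution_ofCoeffs_iff (hE : ∀ k, 1 ≤ k → ∀ l, E.indicial k l ≠ 0)
    {v : ℕ × ℕ → ℂ} : E.IsFormalSolution (ofCoeffs v) ↔ ∀ q, v q = E.nextCoeff q v := by
  rw [isFormalSolution_iff, and_iff_right (coeff_zero_ofCoeffs v)]
  constructor
  · rintro h ⟨k, l⟩
    have := h (k + 1) (by omega) l
    simp only [coeff_succ_ofCoeffs] at this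
    rw [nextCoeff, eq_div_iff (hE _ (by omega) _), mul_comm, this]
  · intro h k hk l
    obtain ⟨k, rfl⟩ := Nat.exists_eq_succ_of_ne_zero (Nat.one_le_iff_ne_zero.1 hk)
    simp only [Nat.succ_eq_add_one, coeff_succ_ofCoeffs]
    rw [h (k, l), nextCoeff, mul_div_cancel₀ _ (hE _ (by omega) _)]

theorem existsUnique_isFormalSolution (hE : ∀ k, 1 ≤ k → ∀ l, E.indicial k l ≠ 0) :
    ∃! u : ℂ⟦X⟧⟦X⟧, E.IsFormalSolution u := by
  have wf : WellFounded (Prod.Lex (· < · : ℕ → ℕ → Prop) (· < · : ℕ → ℕ → Prop)) :=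
    wellFounded_lt.prod_lex wellFounded_lt
  obtain ⟨v, hv, hv_unique⟩ := existsUnique_forall_eq_of_wellFounded wf
    (Φ := E.nextCoeff) fun _ _ _ => nextCoeff_congr
  refine ⟨ofCoeffs v, (isFormalSolution_ofCoeffs_iff hE).2 hv, fun u hu => ?_⟩
  have hu_eq := ofCoeffs_coeff_succ hu.1
  exact hu_eq.symm.trans (congrArg ofCoeffs
    (hv_unique _ ((isFormalSolution_ofCoeffs_iff hE).1 (hu_eq.symm ▸ hu))))

/-! ### Positivity -/

variable (E) in
/-- The sign conditions on the coefficients of the equation: `a ≫ 0`, c-2), c-3) and c-4). -/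
structure SignCond : Prop where
  a_nonneg : SeriesNonneg E.a
  c_zero : ∀ p ∈ indexI E.m, constantCoeff (E.c p) ≤ 0
  c_nonneg : ∀ p ∈ indexI E.m, SeriesNonneg (E.c p - C (constantCoeff (E.c p)))
  g_nonneg : ∀ (i : ℕ) (ν : E.M → ℕ), 2 ≤ i + ∑ p, ν p → SeriesNonneg (E.g i ν)

variable (E) in
/-- The sum of the absolute values of the terms of `C(0; k, l)`; under the sign conditions it is
`C(0; k, l)` itself. -/
noncomputable def absIndicial (k l : ℕ) : ℝ :=
  (k : ℝ) ^ E.m + ∑ p ∈ indexI E.m,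
    ‖constantCoeff (E.c p)‖ * ((k : ℝ) ^ p.1 * (l.descFactorial p.2 : ℝ))

theorem pow_le_absIndicial (k l : ℕ) : (k : ℝ) ^ E.m ≤ E.absIndicial k l :=
  le_add_of_nonneg_right (Finset.sum_nonneg fun _ _ => by positivity)

theorem absIndicial_pos {k : ℕ} (hk : 1 ≤ k) (l : ℕ) : 0 < E.absIndicial k l :=
  lt_of_lt_of_le (by positivity) (pow_le_absIndicial k l)

namespace SignCond

variable (hE : E.SignCond)
include hE

theorem indicial_eq (k l : ℕ) : E.indicial k l = (E.absIndicial k l : ℂ) := by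
  rw [indicial, absIndicial]
  push_cast
  rw [sub_eq_add_neg, ← Finset.sum_neg_distrib]
  congr 1
  refine Finset.sum_congr rfl fun p hp => ?_
  rw [← norm_neg, Complex.norm_of_nonneg' (neg_nonneg.2 (hE.c_zero p hp))]
  ring

theorem indicial_ne_zero (k : ℕ) (hk : 1 ≤ k) (l : ℕ) : E.indicial k l ≠ 0 := by
  rw [hE.indicial_eq]
  exact_mod_cast (absIndicial_pos hk l).ne'

theorem coeff_c_nonneg {p : ℕ × ℕ} (hp : p ∈ indexI E.m) {n : ℕ} (hn : n ≠ 0) :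
    0 ≤ coeff n (E.c p) := by
  have := hE.c_nonneg p hp n
  rwa [map_sub, coeff_C, if_neg hn, sub_zero] at this

theorem lowerCoeff_nonneg {k l l' : ℕ} (hl : l' < l) : 0 ≤ E.lowerCoeff k l l' :=
  Finset.sum_nonneg fun _ hp => mul_nonneg (hE.coeff_c_nonneg hp (by omega))
    (mul_nonneg (pow_nonneg (Nat.cast_nonneg _) _) (Nat.cast_nonneg _))

theorem term_mem_nonnegSeries {u : ℂ⟦X⟧⟦X⟧} (hu : u ∈ nonnegSeries) (i : ℕ) (ν : E.M → ℕ) :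
    E.term u i ν ∈ nonnegSeries := by
  by_cases h2 : i + ∑ p, ν p < 2
  · rw [term, E.g_low i ν h2, map_zero, zero_mul, zero_mul]
    exact zero_mem _
  · exact mul_mem (mul_mem (C_mem_coeffSubsemiring (hE.g_nonneg i ν (by omega)))
      (pow_mem X_mem_coeffSubsemiring i))
      (prod_mem fun _ _ => pow_mem (tDt_Dx_mem_nonnegSeries hu _ _) _)

theorem nonlin_mem_nonnegSeries {u : ℂ⟦X⟧⟦X⟧} (hu0 : coeff 0 u = 0) (hu : u ∈ nonnegSeries) :
    E.nonlin u ∈ nonnegSeries := fun k => by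
  rw [nonlin, coeff_mk, finsum_eq_sum _ (E.support_term_finite u hu0 k)]
  exact sum_mem fun q _ => hE.term_mem_nonnegSeries hu _ _ k

theorem rhs_mem_nonnegSeries {u : ℂ⟦X⟧⟦X⟧} (hu0 : coeff 0 u = 0) (hu : u ∈ nonnegSeries) :
    E.rhs u ∈ nonnegSeries :=
  add_mem (mul_mem (C_mem_coeffSubsemiring hE.a_nonneg) X_mem_coeffSubsemiring)
    (hE.nonlin_mem_nonnegSeries hu0 hu)

theorem coeff_rhs_nonneg {u : ℂ⟦X⟧⟦X⟧} (hu0 : coeff 0 u = 0) {k : ℕ}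
    (hu : ∀ k' < k, ∀ l, 0 ≤ coeff l (coeff k' u)) (l : ℕ) : 0 ≤ coeff l (coeff k (E.rhs u)) := by
  set w : ℂ⟦X⟧⟦X⟧ := (trunc k u : ℂ⟦X⟧⟦X⟧)
  have coeff_w : ∀ k', coeff k' w = if k' < k then coeff k' u else 0 := fun k' => by
    rw [Polynomial.coeff_coe, coeff_trunc]
  have hw0 : coeff 0 w = 0 := by simp only [coeff_w, hu0, ite_self]
  have hw : w ∈ nonnegSeries := mem_nonnegSeries.2 fun k' l => by
    rw [coeff_w]
    split_ifs with hk'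
    exacts [hu k' hk' l, (map_zero _).ge]
  rw [coeff_rhs_congr hu0 hw0 fun k' hk' => by rw [coeff_w, if_pos hk']]
  exact hE.rhs_mem_nonnegSeries hw0 hw k l

theorem mem_nonnegSeries_of_isFormalSolution {u : ℂ⟦X⟧⟦X⟧} (hu : E.IsFormalSolution u) :
    u ∈ nonnegSeries := by
  have hrec := (isFormalSolution_iff.1 hu).2
  intro k
  induction k using Nat.strong_induction_on with
  | _ k ih =>
    intro l
    rcases Nat.eq_zero_or_pos k with rfl | hk
    · rw [hu.1, map_zero]
      exact zero_mem _
    · induction l using Nat.strong_induction_on with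
      | _ l ihl =>
        have coeff_eq := eq_div_of_mul_eq (hE.indicial_ne_zero k hk l)
          ((mul_comm _ _).trans (hrec k hk l))
        rw [coeff_eq, hE.indicial_eq]
        exact div_nonneg (add_nonneg (Finset.sum_nonneg fun l' hl' => mul_nonneg
          (hE.lowerCoeff_nonneg (Finset.mem_range.1 hl')) (ihl l' (Finset.mem_range.1 hl')))
          (hE.coeff_rhs_nonneg hu.1 ih l)) (by exact_mod_cast (absIndicial_pos hk l).le)

end SignCond

end Equation

/-! ### The Newton polygon -/

theorem isLowerSet_convexHull {V : Type*} [AddCommGroup V] [PartialOrder V] [IsOrderedAddMonoid V]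
    [Module ℝ V] {s : Set V} (hs : IsLowerSet s) : IsLowerSet (convexHull ℝ s) := by
  intro b a hab hb
  have translate_subset : (a - b) +ᵥ s ⊆ s := by
    rintro _ ⟨c, hc, rfl⟩
    exact hs (add_le_of_nonpos_left (sub_nonpos.2 hab)) hc
  refine convexHull_mono translate_subset ?_
  rw [convexHull_vadd]
  exact ⟨b, hb, sub_add_cancel a b⟩

theorem nonneg_of_forall_neg_mul_le {x c : ℝ} (h : ∀ s : ℝ, 0 ≤ s → -(s * x) ≤ c) : 0 ≤ x := by
  by_contra! hx
  have hc : 0 ≤ c := by simpa using h 0 le_rfl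
  have := h ((c + 1) / -x) (div_nonneg (by linarith) (by linarith))
  rw [div_neg, neg_mul, neg_neg, div_mul_cancel₀ _ hx.ne] at this
  linarith

theorem exists_nonneg_separating_of_isLowerSet {K : Set (ℝ × ℝ)} (hK : Convex ℝ K)
    (hlow : IsLowerSet K) (hne : K.Nonempty) {w : ℝ × ℝ} (hw : w ∉ K) :
    ∃ a b : ℝ, 0 ≤ a ∧ 0 ≤ b ∧ 0 < a + b ∧ ∀ v ∈ K, v.1 * a + v.2 * b ≤ w.1 * a + w.2 * b := by
  obtain ⟨f, hf⟩ := geometric_hahn_banach_open_point hK.interior isOpen_interior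
    fun h => hw (interior_subset h)
  set a := f (1, 0)
  set b := f (0, 1)
  have f_eq : ∀ v : ℝ × ℝ, f v = v.1 * a + v.2 * b := fun v => by
    rw [show v = v.1 • ((1 : ℝ), (0 : ℝ)) + v.2 • ((0 : ℝ), (1 : ℝ)) by ext <;> simp, map_add,
      map_smul, map_smul, smul_eq_mul, smul_eq_mul]
    simp [a, b]
  have lt_of_mem : ∀ v ∈ K, ∀ s t : ℝ, 0 < s → 0 < t →
      (v.1 - s) * a + (v.2 - t) * b < w.1 * a + w.2 * b := fun v hv s t hs ht => by
    rw [← f_eq w, ← f_eq (v.1 - s, v.2 - t)]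
    refine hf _ (interior_maximal (s := K) (t := Set.Iio v.1 ×ˢ Set.Iio v.2)
      (fun z hz => hlow (show z ≤ v from ⟨hz.1.le, hz.2.le⟩) hv) (isOpen_Iio.prod isOpen_Iio) ?_)
    simp [hs, ht]
  obtain ⟨v, hv⟩ := hne
  have ha : 0 ≤ a := nonneg_of_forall_neg_mul_le
    (c := w.1 * a + w.2 * b - ((v.1 - 1) * a + (v.2 - 1) * b)) fun s hs => by
      linarith [lt_of_mem v hv (s + 1) 1 (by linarith) one_pos]
  have hb : 0 ≤ b := nonneg_of_forall_neg_mul_le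
    (c := w.1 * a + w.2 * b - ((v.1 - 1) * a + (v.2 - 1) * b)) fun s hs => by
      linarith [lt_of_mem v hv 1 (s + 1) one_pos (by linarith)]
  have hab : 0 < a + b := (add_nonneg ha hb).lt_of_ne fun h0 => by
    have ha0 : a = 0 := by linarith
    have hb0 : b = 0 := by linarith
    simpa [ha0, hb0] using lt_of_mem v hv 1 1 one_pos one_pos
  refine ⟨a, b, ha, hb, hab, fun v hv => le_of_forall_pos_lt_add fun ε hε => ?_⟩
  have := lt_of_mem v hv (ε / (a + b)) (ε / (a + b)) (by positivity) (by positivity)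
  have : ε / (a + b) * a + ε / (a + b) * b = ε := by rw [← mul_add, div_mul_cancel₀ _ hab.ne']
  linarith

theorem mem_indexI {m : ℕ} {p : ℕ × ℕ} : p ∈ indexI m ↔ p.1 < m ∧ p.1 + p.2 ≤ m := by
  simp only [indexI, Finset.mem_filter, Finset.mem_product, Finset.mem_range]
  omega

namespace Equation

variable {E : Equation}

variable (E) in
theorem mk_m_zero_mem_Lam0 : (E.m, 0) ∈ E.Lam0 := Or.inl rfl

theorem add_le_of_mem_Lam0 {q : ℕ × ℕ} (hq : q ∈ E.Lam0) : q.1 + q.2 ≤ E.m := by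
  rcases hq with rfl | hq
  · simp
  · exact (mem_indexI.1 hq.1).2

variable (E) in
theorem convex_newton : Convex ℝ E.newton := convex_convexHull ℝ _

variable (E) in
theorem isLowerSet_newton : IsLowerSet E.newton :=
  isLowerSet_convexHull <| isLowerSet_iUnion₂ fun _ _ _ _ h hv =>
    ⟨h.1.trans hv.1, h.2.trans hv.2⟩

theorem mem_newton_of_le {q : ℕ × ℕ} (hq : q ∈ E.Lam0) {w : ℝ × ℝ} (h1 : w.1 ≤ q.1)
    (h2 : w.2 ≤ q.2) : w ∈ E.newton :=
  subset_convexHull _ _ (Set.mem_iUnion₂.2 ⟨q, hq, h1, h2⟩)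

theorem mul_add_mul_le_of_mem_newton {a b S : ℝ} (ha : 0 ≤ a) (hb : 0 ≤ b)
    (h : ∀ q ∈ E.Lam0, q.1 * a + q.2 * b ≤ S) {w : ℝ × ℝ} (hw : w ∈ E.newton) :
    w.1 * a + w.2 * b ≤ S := by
  have convex_halfspace : Convex ℝ {w : ℝ × ℝ | w.1 * a + w.2 * b ≤ S} :=
    convex_halfSpace_le (f := fun w : ℝ × ℝ => w.1 * a + w.2 * b)
      ⟨fun v w => by simp only [Prod.fst_add, Prod.snd_add]; ring,
        fun c w => by simp only [Prod.smul_fst, Prod.smul_snd, smul_eq_mul]; ring⟩ S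
  refine convexHull_min (Set.iUnion₂_subset fun q hq v hv => ?_) convex_halfspace hw
  exact le_trans (add_le_add (mul_le_mul_of_nonneg_right hv.1 ha)
    (mul_le_mul_of_nonneg_right hv.2 hb)) (h q hq)

theorem add_le_of_mem_newton {w : ℝ × ℝ} (hw : w ∈ E.newton) : w.1 + w.2 ≤ E.m := by
  simpa using mul_add_mul_le_of_mem_newton (a := 1) (b := 1) (S := E.m) zero_le_one zero_le_one
    (fun q hq => by rw [mul_one, mul_one]; exact_mod_cast add_le_of_mem_Lam0 hq) hw

variable (E) in
theorem bddBelow_setOf_mem_newton (p : ℕ × ℕ) :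
    BddBelow {y : ℝ | ((p.1 : ℝ), (p.2 : ℝ) - y) ∈ E.newton} :=
  ⟨p.1 + p.2 - E.m, fun _ hy => by linarith [add_le_of_mem_newton hy]⟩

theorem mk_mem_newton {p : ℕ × ℕ} (hp : p.1 ≤ E.m) :
    ((p.1 : ℝ), (p.2 : ℝ) - p.2) ∈ E.newton :=
  mem_newton_of_le E.mk_m_zero_mem_Lam0 (Nat.cast_le.2 hp) (by simp)

theorem mul_add_sub_dist_mul_le {p : ℕ × ℕ} (hp : p.1 ≤ E.m) {a b S : ℝ} (ha : 0 ≤ a)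
    (hb : 0 ≤ b) (h : ∀ q ∈ E.Lam0, q.1 * a + q.2 * b ≤ S) :
    p.1 * a + (p.2 - E.dist p) * b ≤ S := by
  have le_of_mem : ∀ z, ((p.1 : ℝ), (p.2 : ℝ) - z) ∈ E.newton → p.1 * a + (p.2 - z) * b ≤ S :=
    fun z hz => mul_add_mul_le_of_mem_newton ha hb h hz
  rcases hb.eq_or_lt with rfl | hb
  · simpa using le_of_mem p.2 (mk_mem_newton hp)
  · have : p.2 - (S - p.1 * a) / b ≤ E.dist p := by
      refine le_csInf ⟨p.2, mk_mem_newton hp⟩ fun z hz => ?_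
      rw [sub_le_comm, le_div_iff₀ hb]
      linarith [le_of_mem z hz]
    rw [sub_le_comm, le_div_iff₀ hb] at this
    linarith

theorem exists_supporting_slope {p : ℕ × ℕ} (hp : p ∈ indexI E.m) {y : ℝ} (hy0 : 0 < y)
    (hy : y < E.dist p) :
    ∃ θ : ℝ, 0 ≤ θ ∧ θ < 1 ∧ ∀ q ∈ E.Lam0, θ * q.1 + q.2 ≤ θ * p.1 + p.2 - y := by
  obtain ⟨hp1, hp2⟩ := mem_indexI.1 hp
  have hp1 : (p.1 : ℝ) < E.m := by exact_mod_cast hp1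
  have hp2 : (p.1 : ℝ) + p.2 ≤ E.m := by exact_mod_cast hp2
  obtain ⟨a, b, ha, hb, hab, hle⟩ := exists_nonneg_separating_of_isLowerSet E.convex_newton
    E.isLowerSet_newton ⟨_, mk_mem_newton (p := p) (Nat.cast_le.1 hp1.le)⟩
    (w := ((p.1 : ℝ), (p.2 : ℝ) - y))
    fun hmem => (csInf_le (E.bddBelow_setOf_mem_newton p) hmem).not_gt hy
  replace hle : ∀ q ∈ E.Lam0, q.1 * a + q.2 * b ≤ p.1 * a + (p.2 - y) * b :=
    fun q hq => hle (q.1, q.2) (mem_newton_of_le hq le_rfl le_rfl)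
  have htop := hle _ E.mk_m_zero_mem_Lam0
  rw [Nat.cast_zero, zero_mul, add_zero] at htop
  have hb : 0 < b := hb.lt_of_ne fun h0 => by
    rw [← h0, mul_zero, add_zero] at htop
    nlinarith
  refine ⟨a / b, by positivity, ?_, fun q hq => ?_⟩
  · rw [div_lt_one hb]
    by_contra! hba
    nlinarith
  · calc a / b * q.1 + q.2 = (q.1 * a + q.2 * b) / b := by field_simp
      _ ≤ (p.1 * a + (p.2 - y) * b) / b := div_le_div_of_nonneg_right (hle q hq) hb.le
      _ = a / b * p.1 + p.2 - y := by field_simp; ring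

/-! ### Bounds for the indicial polynomial -/

variable (E) in
/-- `1 + ∑ |c_{j,α}(0)|`, the constant in the upper bounds for the indicial polynomial. -/
noncomputable def indicialConst : ℝ := 1 + ∑ p ∈ indexI E.m, ‖constantCoeff (E.c p)‖

variable (E) in
theorem one_le_indicialConst : 1 ≤ E.indicialConst :=
  le_add_of_nonneg_right (Finset.sum_nonneg fun _ _ => norm_nonneg _)

theorem absIndicial_le_of_forall {k l : ℕ} {S : ℝ}
    (h : ∀ q ∈ E.Lam0, (k : ℝ) ^ q.1 * (l : ℝ) ^ q.2 ≤ S) :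
    E.absIndicial k l ≤ E.indicialConst * S := by
  rw [absIndicial, indicialConst, add_mul, one_mul, Finset.sum_mul]
  refine add_le_add (by simpa using h _ E.mk_m_zero_mem_Lam0) (Finset.sum_le_sum fun p hp => ?_)
  by_cases hc : constantCoeff (E.c p) = 0
  · simp [hc]
  · refine mul_le_mul_of_nonneg_left (le_trans ?_ (h p (Or.inr ⟨hp, hc⟩))) (norm_nonneg _)
    gcongr
    exact_mod_cast Nat.descFactorial_le_pow l p.2

theorem absIndicial_le_pow {k : ℕ} (hk : 1 ≤ k) (l : ℕ) :
    E.absIndicial k l ≤ E.indicialConst * ((k : ℝ) + l) ^ E.m := by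
  have hk : (1 : ℝ) ≤ k := by exact_mod_cast hk
  refine absIndicial_le_of_forall fun q hq => ?_
  calc (k : ℝ) ^ q.1 * (l : ℝ) ^ q.2 ≤ ((k : ℝ) + l) ^ q.1 * ((k : ℝ) + l) ^ q.2 := by
        gcongr <;> linarith
    _ = ((k : ℝ) + l) ^ (q.1 + q.2) := by rw [pow_add]
    _ ≤ _ := pow_le_pow_right₀ (by linarith) (add_le_of_mem_Lam0 hq)

theorem absIndicial_le_rpow {k l : ℕ} {c T θ e : ℝ} (hc : 1 ≤ c) (hT : 1 ≤ T)
    (he : ∀ q ∈ E.Lam0, θ * q.1 + q.2 ≤ e) (hk : (k : ℝ) ≤ c * T ^ θ) (hl : (l : ℝ) ≤ c * T) :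
    E.absIndicial k l ≤ E.indicialConst * (c ^ E.m * T ^ e) := by
  have hT0 : 0 < T := by linarith
  refine absIndicial_le_of_forall fun q hq => ?_
  calc (k : ℝ) ^ q.1 * (l : ℝ) ^ q.2 ≤ (c * T ^ θ) ^ q.1 * (c * T) ^ q.2 := by gcongr
    _ = c ^ (q.1 + q.2) * T ^ (θ * q.1 + q.2) := by
        rw [mul_pow, mul_pow, pow_add, Real.rpow_add hT0, Real.rpow_mul hT0.le, Real.rpow_natCast,
          Real.rpow_natCast]
        ring
    _ ≤ _ := mul_le_mul (pow_le_pow_right₀ hc (add_le_of_mem_Lam0 hq))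
        (Real.rpow_le_rpow_of_exponent_le hT (he q hq)) (by positivity) (by positivity)

end Equation

theorem pow_le_mul_descFactorial {l α : ℕ} (h : α ≤ l) :
    l ^ α ≤ (α + 1) ^ α * l.descFactorial α := by
  have hl : l ≤ (α + 1) * (l + 1 - α) := by
    obtain ⟨n, rfl⟩ := Nat.exists_eq_add_of_le h
    rw [show α + n + 1 - α = n + 1 by omega]
    nlinarith
  calc l ^ α ≤ ((α + 1) * (l + 1 - α)) ^ α := Nat.pow_le_pow_left hl α
    _ = (α + 1) ^ α * (l + 1 - α) ^ α := mul_pow ..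
    _ ≤ (α + 1) ^ α * l.descFactorial α :=
      Nat.mul_le_mul_left _ (Nat.pow_sub_le_descFactorial l α)

theorem pow_le_mul_descFactorial_add_one (l α : ℕ) :
    l ^ α ≤ (α + 1) ^ α * (l.descFactorial α + 1) := by
  rcases lt_or_ge l α with h | h
  · exact (Nat.pow_le_pow_left (by omega) α).trans (Nat.le_mul_of_pos_right _ (by omega))
  · exact (pow_le_mul_descFactorial h).trans (Nat.mul_le_mul_left _ (Nat.le_succ _))

namespace Equation

variable {E : Equation}

theorem pow_mul_pow_le_absIndicial {q : ℕ × ℕ} (hq : q ∈ indexI E.m)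
    (hc : constantCoeff (E.c q) ≠ 0) {k : ℕ} (hk : 1 ≤ k) (l : ℕ) :
    (k : ℝ) ^ q.1 * (l : ℝ) ^ q.2 ≤
      ((q.2 : ℝ) + 1) ^ q.2 * (‖constantCoeff (E.c q)‖⁻¹ + 1) * E.absIndicial k l := by
  have descFactorial_le : (k : ℝ) ^ q.1 * (l.descFactorial q.2 : ℝ) ≤
      ‖constantCoeff (E.c q)‖⁻¹ * E.absIndicial k l := by
    rw [le_inv_mul_iff₀ (norm_pos_iff.2 hc)]
    exact (Finset.single_le_sum (f := fun p : ℕ × ℕ => ‖constantCoeff (E.c p)‖ *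
      ((k : ℝ) ^ p.1 * (l.descFactorial p.2 : ℝ))) (fun _ _ => by positivity) hq).trans
        (le_add_of_nonneg_left (by positivity))
  have pow_le : (k : ℝ) ^ q.1 ≤ E.absIndicial k l :=
    (pow_le_pow_right₀ (by exact_mod_cast hk) (mem_indexI.1 hq).1.le).trans
      (pow_le_absIndicial k l)
  calc (k : ℝ) ^ q.1 * (l : ℝ) ^ q.2
      ≤ (k : ℝ) ^ q.1 * (((q.2 : ℝ) + 1) ^ q.2 * ((l.descFactorial q.2 : ℝ) + 1)) := by
        gcongr
        exact_mod_cast pow_le_mul_descFactorial_add_one l q.2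
    _ = ((q.2 : ℝ) + 1) ^ q.2 *
          ((k : ℝ) ^ q.1 * (l.descFactorial q.2 : ℝ) + (k : ℝ) ^ q.1) := by ring
    _ ≤ ((q.2 : ℝ) + 1) ^ q.2 * (‖constantCoeff (E.c q)‖⁻¹ * E.absIndicial k l +
          E.absIndicial k l) := by gcongr
    _ = _ := by ring

variable (E) in
theorem exists_pow_mul_pow_le_absIndicial : ∃ C : ℝ, 1 ≤ C ∧ ∀ q ∈ E.Lam0, ∀ k l : ℕ, 1 ≤ k →
    (k : ℝ) ^ q.1 * (l : ℝ) ^ q.2 ≤ C * E.absIndicial k l := by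
  set D : ℕ × ℕ → ℝ := fun p => ((p.2 : ℝ) + 1) ^ p.2 * (‖constantCoeff (E.c p)‖⁻¹ + 1)
  have hD : ∀ p, 0 ≤ D p := fun p => by positivity
  have hsum : 0 ≤ ∑ p ∈ indexI E.m, D p := Finset.sum_nonneg fun p _ => hD p
  refine ⟨1 + ∑ p ∈ indexI E.m, D p, by linarith, fun q hq k l hk => ?_⟩
  have hA := absIndicial_pos (E := E) hk l
  rcases hq with rfl | ⟨hq, hc⟩
  · simpa using (pow_le_absIndicial k l).trans
      (le_mul_of_one_le_left hA.le (le_add_of_nonneg_right hsum))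
  · refine (pow_mul_pow_le_absIndicial hq hc hk l).trans (mul_le_mul_of_nonneg_right ?_ hA.le)
    have : D q ≤ ∑ p ∈ indexI E.m, D p := Finset.single_le_sum (fun p _ => hD p) hq
    linarith

variable (E) in
theorem exists_pow_mul_rpow_le_absIndicial : ∃ C : ℝ, 1 ≤ C ∧ ∀ p : ℕ × ℕ, p.1 ≤ E.m →
    ∀ k l : ℕ, 1 ≤ k → 1 ≤ l →
      (k : ℝ) ^ p.1 * (l : ℝ) ^ ((p.2 : ℝ) - E.dist p) ≤ C * E.absIndicial k l := by
  obtain ⟨C, hC, h⟩ := E.exists_pow_mul_pow_le_absIndicial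
  refine ⟨C, hC, fun p hp k l hk hl => ?_⟩
  have hk' : (1 : ℝ) ≤ k := by exact_mod_cast hk
  have hl' : (1 : ℝ) ≤ l := by exact_mod_cast hl
  have hl0 : (0 : ℝ) < l := by linarith
  have hS : 0 < C * E.absIndicial k l := mul_pos (by linarith) (absIndicial_pos hk l)
  -- In logarithmic coordinates: a bound for a linear form on `Λ₀` persists on `N₀`.
  have log_le := mul_add_sub_dist_mul_le hp (Real.log_nonneg hk') (Real.log_nonneg hl')
    (S := Real.log (C * E.absIndicial k l)) fun q hq => by
      rw [← Real.log_pow, ← Real.log_pow, ← Real.log_mul (by positivity) (by positivity)]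
      exact Real.log_le_log (by positivity) (h q hq k l hk)
  rw [← Real.log_pow, ← Real.log_rpow hl0, ← Real.log_mul (by positivity) (by positivity)]
    at log_le
  exact (Real.log_le_log_iff (by positivity) hS).1 log_le

/-! ### The irregularity -/

variable (E) in
theorem finite_Lam1 : E.Lam1.Finite := (indexI E.m).finite_toSet.subset fun _ hp => hp.1

variable (E) in
theorem bddAbove_sigma0 : BddAbove
    (insert 1 ((fun p => ((E.ordC p : ℝ) + E.dist p) / (E.ordC p : ℝ)) '' E.Lam1)) :=
  ((E.finite_Lam1.image _).insert 1).bddAbove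

variable (E) in
theorem one_le_sigma0 : 1 ≤ E.sigma0 := le_csSup E.bddAbove_sigma0 (Set.mem_insert _ _)

theorem coeff_ordC_ne_zero {p : ℕ × ℕ} (hp : p ∈ E.Lam1) : coeff (E.ordC p) (E.c p) ≠ 0 :=
  coeff_order hp.2.2

theorem coeff_eq_zero_of_lt_ordC {p : ℕ × ℕ} {n : ℕ} (h : n < E.ordC p) : coeff n (E.c p) = 0 :=
  coeff_of_lt_order n ((Nat.cast_lt.2 h).trans_le (ENat.natCast_toNat_le_self _))

theorem one_le_ordC {p : ℕ × ℕ} (hp : p ∈ E.Lam1) : 1 ≤ E.ordC p := by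
  rw [Nat.one_le_iff_ne_zero]
  intro h0
  have := coeff_ordC_ne_zero hp
  rw [h0, coeff_zero_eq_constantCoeff_apply] at this
  exact this hp.2.1

theorem dist_le {p : ℕ × ℕ} (hp : p ∈ E.Lam1) : E.dist p ≤ E.ordC p * (E.sigma0 - 1) := by
  have hpos : (0 : ℝ) < E.ordC p := by exact_mod_cast one_le_ordC hp
  have := le_csSup E.bddAbove_sigma0 (Set.mem_insert_of_mem _ ⟨p, hp, rfl⟩)
  simp only [div_le_iff₀ hpos] at this
  change _ ≤ E.sigma0 * _ at this
  linarith

end Equation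

/-! ### Weights and majorants in `x` -/

/-- The weight `((N)_l)^σ / l!`, with `(N)_l` the rising factorial. The product of two weighted
series with indices `N₁` and `N₂` has index `N₁ + N₂`, without further constants. -/
noncomputable def xWeight (σ : ℝ) (N l : ℕ) : ℝ := (N.ascFactorial l : ℝ) ^ σ / l.factorial

theorem sum_rpow_le_rpow_sum {ι : Type*} (s : Finset ι) {f : ι → ℝ} (hf : ∀ i ∈ s, 0 ≤ f i)
    {σ : ℝ} (hσ : 1 ≤ σ) : ∑ i ∈ s, f i ^ σ ≤ (∑ i ∈ s, f i) ^ σ := by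
  classical
  induction s using Finset.induction_on with
  | empty => simp [Real.zero_rpow (by linarith : σ ≠ 0)]
  | insert a s ha ih =>
    have hf' : ∀ i ∈ s, 0 ≤ f i := fun i hi => hf i (Finset.mem_insert_of_mem hi)
    rw [Finset.sum_insert ha, Finset.sum_insert ha]
    exact (add_le_add_right (ih hf') _).trans (Real.add_rpow_le_rpow_add
      (hf a (Finset.mem_insert_self a s)) (Finset.sum_nonneg hf') hσ)

theorem sum_choose_mul_ascFactorial (N₁ N₂ l : ℕ) :
    ∑ x ∈ antidiagonal l, l.choose x.1 * (N₁.ascFactorial x.1 * N₂.ascFactorial x.2) =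
      (N₁ + N₂).ascFactorial l := by
  induction l with
  | zero => simp
  | succ l ih =>
    have pascal := Finset.sum_antidiagonal_choose_succ_mul
      (fun i j => N₁.ascFactorial i * N₂.ascFactorial j) l
    simp only [Nat.cast_id] at pascal
    rw [pascal, ← Finset.sum_add_distrib, Nat.ascFactorial_succ, ← ih, Finset.mul_sum]
    refine Finset.sum_congr rfl fun x hx => ?_
    rw [← mem_antidiagonal.1 hx, Nat.choose_symm_add, Nat.ascFactorial_succ,
      Nat.ascFactorial_succ]
    ring

theorem factorial_mul_add_descFactorial (l h : ℕ) :
    l.factorial * (l + h).descFactorial h = (l + h).factorial := by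
  rw [Nat.add_descFactorial_eq_ascFactorial, Nat.factorial_mul_ascFactorial]

theorem ascFactorial_le_add_pow {N : ℕ} (hN : 1 ≤ N) (n : ℕ) : N.ascFactorial n ≤ (N + n) ^ n := by
  obtain ⟨N, rfl⟩ := Nat.exists_eq_add_of_le' hN
  exact (Nat.ascFactorial_le_pow_add N n).trans (Nat.pow_le_pow_left (by omega) n)

theorem descFactorial_mul_ascFactorial_le {N : ℕ} (hN : 1 ≤ N) (l μ : ℕ) :
    l.descFactorial μ * N.ascFactorial l ≤ (N + μ) ^ μ * (N + μ).ascFactorial l := by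
  have descFactorial_le : l.descFactorial μ ≤ (N + l).ascFactorial μ :=
    calc l.descFactorial μ ≤ l ^ μ := Nat.descFactorial_le_pow l μ
      _ ≤ (N + l) ^ μ := Nat.pow_le_pow_left (by omega) μ
      _ ≤ (N + l).ascFactorial μ := Nat.pow_succ_le_ascFactorial _ _
  calc l.descFactorial μ * N.ascFactorial l
      ≤ (N + l).ascFactorial μ * N.ascFactorial l := Nat.mul_le_mul_right _ descFactorial_le
    _ = N.ascFactorial μ * (N + μ).ascFactorial l := by
        rw [mul_comm, Nat.ascFactorial_mul_ascFactorial, Nat.ascFactorial_mul_ascFactorial,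
          add_comm]
    _ ≤ (N + μ) ^ μ * (N + μ).ascFactorial l :=
        Nat.mul_le_mul_right _ (ascFactorial_le_add_pow hN μ)

section Weights

variable {σ : ℝ}

theorem xWeight_nonneg (σ : ℝ) (N l : ℕ) : 0 ≤ xWeight σ N l := by
  rw [xWeight]
  positivity

variable (hσ : 1 ≤ σ)
include hσ

theorem xWeight_mono_left {N N' : ℕ} (h : N ≤ N') (l : ℕ) : xWeight σ N l ≤ xWeight σ N' l := by
  rw [xWeight, xWeight]
  gcongr

theorem sum_xWeight_mul_xWeight_le (N₁ N₂ l : ℕ) :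
    ∑ x ∈ antidiagonal l, xWeight σ N₁ x.1 * xWeight σ N₂ x.2 ≤ xWeight σ (N₁ + N₂) l := by
  have term_le : ∀ x ∈ antidiagonal l, xWeight σ N₁ x.1 * xWeight σ N₂ x.2 * l.factorial ≤
      ((l.choose x.1 * (N₁.ascFactorial x.1 * N₂.ascFactorial x.2) : ℕ) : ℝ) ^ σ := by
    intro x hx
    have hx : x.1 + x.2 = l := mem_antidiagonal.1 hx
    have factorial_eq : (l.factorial : ℝ) = l.choose x.1 * (x.1.factorial * x.2.factorial) := by
      rw [← hx, ← mul_assoc, Nat.choose_symm_add]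
      exact_mod_cast (Nat.add_choose_mul_factorial_mul_factorial x.1 x.2).symm
    have choose_le : (l.choose x.1 : ℝ) ≤ (l.choose x.1 : ℝ) ^ σ :=
      Real.self_le_rpow_of_one_le (by exact_mod_cast Nat.choose_pos (by omega)) hσ
    push_cast
    rw [Real.mul_rpow (by positivity) (by positivity),
      Real.mul_rpow (by positivity) (by positivity), factorial_eq, xWeight, xWeight]
    calc _ = (l.choose x.1 : ℝ) *
          ((N₁.ascFactorial x.1 : ℝ) ^ σ * (N₂.ascFactorial x.2 : ℝ) ^ σ) := by field_simp
      _ ≤ _ := by gcongr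
  rw [xWeight, le_div_iff₀ (by positivity), Finset.sum_mul, ← sum_choose_mul_ascFactorial,
    Nat.cast_sum]
  exact (Finset.sum_le_sum term_le).trans (sum_rpow_le_rpow_sum _ (fun _ _ => by positivity) hσ)

theorem xWeight_mul_descFactorial_le {N : ℕ} (hN : 1 ≤ N) (l h : ℕ) :
    xWeight σ N l * ((l + h).descFactorial h : ℝ) ^ (σ - 1) ≤ xWeight σ N (l + h) := by
  have hd : (0 : ℝ) < (l + h).descFactorial h := by
    exact_mod_cast Nat.descFactorial_pos.2 (by omega)
  have descFactorial_le : ((l + h).descFactorial h : ℝ) ≤ (N + l).ascFactorial h := by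
    rw [Nat.add_descFactorial_eq_ascFactorial]
    exact_mod_cast Nat.ascFactorial_le h (by omega)
  rw [xWeight, xWeight, ← Nat.ascFactorial_mul_ascFactorial, ← factorial_mul_add_descFactorial,
    Nat.cast_mul, Nat.cast_mul, Real.mul_rpow (by positivity) (by positivity),
    Real.rpow_sub_one hd.ne', div_mul_div_comm]
  gcongr

theorem xWeight_mono_right {N : ℕ} (hN : 1 ≤ N) {l l' : ℕ} (h : l ≤ l') :
    xWeight σ N l ≤ xWeight σ N l' := by
  obtain ⟨n, rfl⟩ := Nat.exists_eq_add_of_le h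
  refine (le_mul_of_one_le_right (xWeight_nonneg _ _ _) (Real.one_le_rpow ?_ (by linarith))).trans
    (xWeight_mul_descFactorial_le hσ hN l n)
  exact_mod_cast Nat.descFactorial_pos.2 (by omega : n ≤ l + n)

theorem one_le_xWeight {N : ℕ} (hN : 1 ≤ N) (l : ℕ) : 1 ≤ xWeight σ N l := by
  simpa [xWeight] using xWeight_mono_right hσ hN (Nat.zero_le l)

theorem descFactorial_mul_xWeight_le {N : ℕ} (hN : 1 ≤ N) (l μ : ℕ) :
    (l.descFactorial μ : ℝ) * xWeight σ N l ≤ ((N : ℝ) + μ) ^ μ * xWeight σ (N + μ) l := by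
  obtain ⟨n, rfl⟩ := Nat.exists_eq_add_of_le' hN
  have pos : ∀ n : ℕ, (0 : ℝ) < (n + 1).ascFactorial l := fun n => by
    exact_mod_cast Nat.ascFactorial_pos n l
  have rpow_eq : ∀ {z : ℝ}, 0 < z → z ^ σ = z * z ^ (σ - 1) := fun {z} hz => by
    rw [← Real.rpow_one_add' hz.le (by linarith), add_sub_cancel]
  have rpow_le : ((n + 1).ascFactorial l : ℝ) ^ (σ - 1) ≤
      ((n + 1 + μ).ascFactorial l : ℝ) ^ (σ - 1) :=
    Real.rpow_le_rpow (pos n).le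
      (by exact_mod_cast Nat.ascFactorial_le l (by omega : n + 1 ≤ n + 1 + μ)) (by linarith)
  have le := descFactorial_mul_ascFactorial_le hN l μ
  rify at le
  rw [xWeight, xWeight, mul_div_assoc', mul_div_assoc', rpow_eq (pos n),
    rpow_eq (by rw [Nat.add_right_comm]; exact pos _), ← mul_assoc, ← mul_assoc]
  push_cast
  gcongr

omit hσ in
theorem add_descFactorial_mul_xWeight_add (N l μ δ : ℕ) :
    ((l + (μ + δ)).descFactorial (μ + δ) : ℝ) * xWeight σ N (l + (μ + δ)) =
      (N.ascFactorial δ : ℝ) ^ σ * (((l + μ).descFactorial μ : ℝ) * xWeight σ (N + δ) (l + μ)) := by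
  have descFactorial_ne_zero : ∀ n : ℕ, ((l + n).descFactorial n : ℝ) ≠ 0 := fun n => by
    exact_mod_cast (Nat.descFactorial_pos.2 (by omega : n ≤ l + n)).ne'
  have := descFactorial_ne_zero μ
  have := descFactorial_ne_zero (μ + δ)
  rw [xWeight, xWeight, ← factorial_mul_add_descFactorial, ← factorial_mul_add_descFactorial,
    show l + (μ + δ) = δ + (l + μ) by ring, ← Nat.ascFactorial_mul_ascFactorial N δ, Nat.cast_mul,
    Nat.cast_mul, Nat.cast_mul, Real.mul_rpow (by positivity) (by positivity)]
  rw [show l + (μ + δ) = δ + (l + μ) by ring] at this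
  field_simp

-- The exponent of `N` is the origin of `max {α, μ + σ₀ (α - μ)}` in the definition of `s₀`:
-- `x^μ ∂_x^α` maps the coefficient of `x^(l+α)` to that of `x^(l+μ)`.
theorem add_descFactorial_mul_xWeight_le {N : ℕ} (hN : 1 ≤ N) (l μ α : ℕ) :
    ((l + α).descFactorial α : ℝ) * xWeight σ N (l + α) ≤
      ((N : ℝ) + α) ^ (max (α : ℝ) (μ + σ * ((α : ℝ) - μ))) * xWeight σ (N + α) (l + μ) := by
  have hbase : (1 : ℝ) ≤ (N : ℝ) + α := by exact_mod_cast (by omega : 1 ≤ N + α)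
  rcases le_total α μ with h | h
  · refine (descFactorial_mul_xWeight_le hσ hN _ α).trans (mul_le_mul ?_
      (xWeight_mono_right hσ (by omega) (by omega)) (xWeight_nonneg _ _ _) (by positivity))
    rw [← Real.rpow_natCast]
    exact Real.rpow_le_rpow_of_exponent_le hbase (le_max_left _ _)
  · obtain ⟨δ, rfl⟩ := Nat.exists_eq_add_of_le h
    set b : ℝ := (N : ℝ) + ((μ + δ : ℕ) : ℝ) with hb
    have ascFactorial_le : (N.ascFactorial δ : ℝ) ^ σ ≤ b ^ (σ * δ) := by
      rw [mul_comm, Real.rpow_mul (by positivity), Real.rpow_natCast]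
      refine Real.rpow_le_rpow (by positivity) ?_ (by linarith)
      rw [hb]
      exact_mod_cast (ascFactorial_le_add_pow hN δ).trans (Nat.pow_le_pow_left (by omega) δ)
    have descFactorial_le : ((l + μ).descFactorial μ : ℝ) * xWeight σ (N + δ) (l + μ) ≤
        b ^ (μ : ℝ) * xWeight σ (N + (μ + δ)) (l + μ) := by
      have := descFactorial_mul_xWeight_le hσ (by omega : 1 ≤ N + δ) (l + μ) μ
      rwa [show ((N + δ : ℕ) : ℝ) + μ = b by rw [hb]; push_cast; ring,
        show N + δ + μ = N + (μ + δ) by ring, ← Real.rpow_natCast] at this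
    rw [add_descFactorial_mul_xWeight_add]
    calc _ ≤ b ^ (σ * δ) * (b ^ (μ : ℝ) * xWeight σ (N + (μ + δ)) (l + μ)) :=
          mul_le_mul ascFactorial_le descFactorial_le
            (mul_nonneg (by positivity) (xWeight_nonneg _ _ _)) (by positivity)
      _ = b ^ (μ + σ * (((μ + δ : ℕ) : ℝ) - μ)) * xWeight σ (N + (μ + δ)) (l + μ) := by
          rw [← mul_assoc, ← Real.rpow_add (by linarith)]
          push_cast
          ring_nf
      _ ≤ _ := mul_le_mul_of_nonneg_right
          (Real.rpow_le_rpow_of_exponent_le hbase (le_max_right _ _)) (xWeight_nonneg _ _ _)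

end Weights

/-- `f` is majorized by `b ∑ R^l ((N)_l)^σ / l! x^l`. -/
def Majorized (σ R : ℝ) (N : ℕ) (b : ℝ) (f : ℂ⟦X⟧) : Prop :=
  ∀ l, ‖coeff l f‖ ≤ b * (R ^ l * xWeight σ N l)

namespace Majorized

variable {σ R : ℝ} (hR : 0 < R) {N : ℕ} {b : ℝ} {f : ℂ⟦X⟧}
include hR

theorem mono_const {b' : ℝ} (h : Majorized σ R N b f) (hb : b ≤ b') : Majorized σ R N b' f :=
  fun l => (h l).trans (mul_le_mul_of_nonneg_right hb
    (mul_nonneg (by positivity) (xWeight_nonneg _ _ _)))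

theorem zero (hb : 0 ≤ b) : Majorized σ R N b 0 := fun l => by
  rw [map_zero, norm_zero]
  exact mul_nonneg hb (mul_nonneg (by positivity) (xWeight_nonneg _ _ _))

variable (hσ : 1 ≤ σ)
include hσ

theorem mono_index {N' : ℕ} (hN : N ≤ N') (hb : 0 ≤ b) (h : Majorized σ R N b f) :
    Majorized σ R N' b f := fun l => by
  have := xWeight_mono_left hσ hN l
  exact (h l).trans (by gcongr)

theorem mul {N₁ N₂ : ℕ} {b₁ b₂ : ℝ} (hb₁ : 0 ≤ b₁) (hb₂ : 0 ≤ b₂) {g : ℂ⟦X⟧}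
    (hf : Majorized σ R N₁ b₁ f) (hg : Majorized σ R N₂ b₂ g) :
    Majorized σ R (N₁ + N₂) (b₁ * b₂) (f * g) := fun l => by
  rw [coeff_mul]
  calc ‖∑ x ∈ antidiagonal l, coeff x.1 f * coeff x.2 g‖
      ≤ ∑ x ∈ antidiagonal l, b₁ * b₂ * R ^ l * (xWeight σ N₁ x.1 * xWeight σ N₂ x.2) := by
        refine (norm_sum_le _ _).trans (Finset.sum_le_sum fun x hx => ?_)
        rw [norm_mul]
        refine (mul_le_mul (hf _) (hg _) (norm_nonneg _) (mul_nonneg hb₁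
          (mul_nonneg (by positivity) (xWeight_nonneg _ _ _)))).trans (le_of_eq ?_)
        rw [← mem_antidiagonal.1 hx, pow_add]
        ring
    _ ≤ b₁ * b₂ * R ^ l * xWeight σ (N₁ + N₂) l := by
        rw [← Finset.mul_sum]
        exact mul_le_mul_of_nonneg_left (sum_xWeight_mul_xWeight_le hσ N₁ N₂ l) (by positivity)
    _ = _ := by ring

theorem X_pow_mul_derivative (hN : 1 ≤ N) (hb : 0 ≤ b) (h : Majorized σ R N b f) (μ α : ℕ) :
    Majorized σ R (N + α)
      (b * R ^ α * ((N : ℝ) + α) ^ (max (α : ℝ) (μ + σ * ((α : ℝ) - μ))) * (R ^ μ)⁻¹)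
      (X ^ μ * (derivative ℂ)^[α] f) := fun l => by
  rw [coeff_X_pow_mul']
  split_ifs with hl
  · obtain ⟨n, rfl⟩ := Nat.exists_eq_add_of_le' hl
    rw [Nat.add_sub_cancel, coeff_derivative_iterate, norm_mul, Complex.norm_natCast]
    calc ((n + α).descFactorial α : ℝ) * ‖coeff (n + α) f‖
        ≤ ((n + α).descFactorial α : ℝ) * (b * (R ^ (n + α) * xWeight σ N (n + α))) := by
          gcongr
          exact h _
      _ = b * R ^ (n + α) * (((n + α).descFactorial α : ℝ) * xWeight σ N (n + α)) := by ring
      _ ≤ b * R ^ (n + α) * (((N : ℝ) + α) ^ (max (α : ℝ) (μ + σ * ((α : ℝ) - μ))) *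
            xWeight σ (N + α) (n + μ)) :=
          mul_le_mul_of_nonneg_left (add_descFactorial_mul_xWeight_le hσ hN n μ α) (by positivity)
      _ = _ := by
          rw [pow_add, pow_add]
          field_simp
  · rw [norm_zero]
    exact mul_nonneg (by positivity) (mul_nonneg (by positivity) (xWeight_nonneg _ _ _))

end Majorized

theorem Convergent.exists_eventually_majorized {f : ℂ⟦X⟧} (hf : Convergent f) {σ : ℝ}
    (hσ : 1 ≤ σ) : ∃ C : ℝ, 0 ≤ C ∧ ∀ᶠ R in atTop, Majorized σ R 1 C f := by
  obtain ⟨ρ, hρ, hs⟩ := hf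
  refine ⟨∑' l : ℕ, ‖coeff l f‖ * ρ ^ l, tsum_nonneg fun _ => by positivity, ?_⟩
  filter_upwards [eventually_ge_atTop ρ⁻¹] with R hR l
  have hR0 : 0 < R := (inv_pos.2 hρ).trans_le hR
  rw [inv_le_iff_one_le_mul₀' hρ] at hR
  calc ‖coeff l f‖ ≤ ‖coeff l f‖ * ((ρ * R) ^ l * xWeight σ 1 l) :=
        le_mul_of_one_le_right (norm_nonneg _)
          (one_le_mul_of_one_le_of_one_le (one_le_pow₀ hR) (one_le_xWeight hσ le_rfl l))
    _ = ‖coeff l f‖ * ρ ^ l * (R ^ l * xWeight σ 1 l) := by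
        rw [mul_pow]
        ring
    _ ≤ _ := mul_le_mul_of_nonneg_right (hs.le_tsum l fun _ _ => by positivity)
        (mul_nonneg (by positivity) (xWeight_nonneg _ _ _))

/-! ### The linear part -/

theorem Convergent.eventually_sum_le {f : ℂ⟦X⟧} (hf : Convergent f) {ε : ℝ} (hε : 0 < ε) :
    ∀ᶠ R : ℝ in atTop, ∀ n : ℕ,
      ∑ h ∈ Finset.range n, ‖coeff (h + 1) f‖ * (R ^ (h + 1))⁻¹ ≤ ε := by
  obtain ⟨ρ, hρ, hs⟩ := hf
  set S := ∑' h : ℕ, ‖coeff (h + 1) f‖ * ρ ^ (h + 1)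
  filter_upwards [eventually_ge_atTop ρ⁻¹, eventually_ge_atTop (S / (ε * ρ))] with R hR hRS n
  have hR0 : 0 < R := (inv_pos.2 hρ).trans_le hR
  rw [inv_le_iff_one_le_mul₀ hρ] at hR
  have inv_le : ∀ h : ℕ, (R ^ (h + 1))⁻¹ ≤ ρ ^ (h + 1) * (R * ρ)⁻¹ := fun h => by
    rw [← div_eq_mul_inv, le_div_iff₀ (by positivity), inv_mul_le_iff₀ (by positivity), ← mul_pow]
    exact le_self_pow₀ hR (by omega)
  calc ∑ h ∈ Finset.range n, ‖coeff (h + 1) f‖ * (R ^ (h + 1))⁻¹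
      ≤ ∑ h ∈ Finset.range n, ‖coeff (h + 1) f‖ * ρ ^ (h + 1) * (R * ρ)⁻¹ :=
        Finset.sum_le_sum fun h _ => by
          rw [mul_assoc]
          exact mul_le_mul_of_nonneg_left (inv_le h) (norm_nonneg _)
    _ ≤ S * (R * ρ)⁻¹ := by
        rw [← Finset.sum_mul]
        exact mul_le_mul_of_nonneg_right (((summable_nat_add_iff 1).2 hs).sum_le_tsum _
          fun _ _ => by positivity) (by positivity)
    _ ≤ ε := by
        rw [← div_eq_mul_inv, div_le_iff₀ (by positivity)]
        rw [div_le_iff₀ (by positivity)] at hRS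
        linarith

theorem descFactorial_mono_right {l P h : ℕ} (hP : P ≤ h) (hl : h ≤ l) :
    l.descFactorial P ≤ l.descFactorial h := by
  rw [← Nat.descFactorial_mul_descFactorial hP]
  exact Nat.le_mul_of_pos_left _ (Nat.descFactorial_pos.2 (by omega))

namespace Equation

variable {E : Equation}

theorem exists_pow_mul_descFactorial_mul_xWeight_le_of_mem_Lam0 {p : ℕ × ℕ} (hp : p ∈ E.Lam0) :
    ∃ K : ℝ, ∀ k N l h : ℕ, 1 ≤ k → 1 ≤ N →
      (k : ℝ) ^ p.1 * l.descFactorial p.2 * xWeight E.sigma0 N l ≤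
        K * (E.absIndicial k (l + h) * xWeight E.sigma0 N (l + h)) := by
  obtain ⟨C, hC, hle⟩ := E.exists_pow_mul_pow_le_absIndicial
  refine ⟨C, fun k N l h hk hN => ?_⟩
  have descFactorial_le : (l.descFactorial p.2 : ℝ) ≤ ((l + h : ℕ) : ℝ) ^ p.2 := by
    exact_mod_cast (Nat.descFactorial_le_pow l p.2).trans (Nat.pow_le_pow_left (by omega) _)
  rw [← mul_assoc]
  refine mul_le_mul (le_trans ?_ (hle p hp k (l + h) hk))
    (xWeight_mono_right E.one_le_sigma0 hN (by omega)) (xWeight_nonneg _ _ _)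
    (mul_nonneg (by linarith) (absIndicial_pos hk _).le)
  gcongr

theorem exists_pow_mul_descFactorial_le_of_mem_Lam1 {p : ℕ × ℕ} (hp : p ∈ E.Lam1) :
    ∃ C : ℝ, 0 < C ∧ ∀ k l n : ℕ, 1 ≤ k → 1 ≤ n → l ≤ n →
      (k : ℝ) ^ p.1 * l.descFactorial p.2 ≤
        C * E.absIndicial k n * ((n : ℝ) ^ E.ordC p) ^ (E.sigma0 - 1) := by
  obtain ⟨C, hC, hle⟩ := E.exists_pow_mul_rpow_le_absIndicial
  refine ⟨C, by linarith, fun k l n hk hn hln => ?_⟩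
  have hn1 : (1 : ℝ) ≤ n := by exact_mod_cast hn
  have hn0 : (0 : ℝ) < n := by linarith
  calc (k : ℝ) ^ p.1 * l.descFactorial p.2
      ≤ (k : ℝ) ^ p.1 * (n : ℝ) ^ p.2 := by
        gcongr
        exact_mod_cast (Nat.descFactorial_le_pow l p.2).trans (Nat.pow_le_pow_left hln _)
    _ = (k : ℝ) ^ p.1 * (n : ℝ) ^ ((p.2 : ℝ) - E.dist p) * (n : ℝ) ^ E.dist p := by
        rw [mul_assoc, ← Real.rpow_add hn0, sub_add_cancel, Real.rpow_natCast]
    _ ≤ C * E.absIndicial k n * ((n : ℝ) ^ E.ordC p) ^ (E.sigma0 - 1) := by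
        rw [← Real.rpow_natCast _ (E.ordC p), ← Real.rpow_mul hn0.le]
        exact mul_le_mul (hle p (mem_indexI.1 hp.1).1.le k n hk hn)
          (Real.rpow_le_rpow_of_exponent_le hn1 (dist_le hp)) (by positivity)
          (mul_nonneg (by linarith) (absIndicial_pos hk n).le)

-- A shift by at least `p_{j,α}` gains the factor `l^{p_{j,α} (σ₀ - 1)}` in the weight, which
-- compensates the excess `l^{d_{j,α}}` over the indicial polynomial.
theorem exists_pow_mul_descFactorial_mul_xWeight_le_of_mem_Lam1 {p : ℕ × ℕ} (hp : p ∈ E.Lam1) :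
    ∃ K : ℝ, ∀ k N l h : ℕ, 1 ≤ k → 1 ≤ N → E.ordC p ≤ h →
      (k : ℝ) ^ p.1 * l.descFactorial p.2 * xWeight E.sigma0 N l ≤
        K * (E.absIndicial k (l + h) * xWeight E.sigma0 N (l + h)) := by
  obtain ⟨C, hC, derivative_le⟩ := exists_pow_mul_descFactorial_le_of_mem_Lam1 hp
  have hσ := E.one_le_sigma0
  set P := E.ordC p
  set K : ℝ := ((P : ℝ) + 1) ^ P
  refine ⟨C * K ^ (E.sigma0 - 1), fun k N l h hk hN hP => ?_⟩
  have hA := absIndicial_pos (E := E) hk (l + h)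
  have hP1 : 1 ≤ P := one_le_ordC hp
  have pow_le : (((l + h : ℕ) : ℝ) ^ P) ^ (E.sigma0 - 1) ≤
      K ^ (E.sigma0 - 1) * ((l + h).descFactorial h : ℝ) ^ (E.sigma0 - 1) := by
    rw [← Real.mul_rpow (by positivity) (by positivity)]
    refine Real.rpow_le_rpow (by positivity) ?_ (by linarith)
    simp only [K]
    exact_mod_cast (pow_le_mul_descFactorial (by omega : P ≤ l + h)).trans
      (Nat.mul_le_mul_left _ (descFactorial_mono_right hP (by omega)))
  calc (k : ℝ) ^ p.1 * l.descFactorial p.2 * xWeight E.sigma0 N l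
      ≤ C * E.absIndicial k (l + h) *
          (K ^ (E.sigma0 - 1) * ((l + h).descFactorial h : ℝ) ^ (E.sigma0 - 1)) *
          xWeight E.sigma0 N l :=
        mul_le_mul_of_nonneg_right ((derivative_le k l (l + h) hk (by omega) (by omega)).trans
          (mul_le_mul_of_nonneg_left pow_le (by positivity)))
          (xWeight_nonneg _ _ _)
    _ = C * K ^ (E.sigma0 - 1) * (E.absIndicial k (l + h) *
          (xWeight E.sigma0 N l * ((l + h).descFactorial h : ℝ) ^ (E.sigma0 - 1))) := by ring
    _ ≤ C * K ^ (E.sigma0 - 1) * (E.absIndicial k (l + h) * xWeight E.sigma0 N (l + h)) := by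
        have := xWeight_mul_descFactorial_le hσ hN l h
        gcongr

theorem exists_pow_mul_descFactorial_mul_xWeight_le {p : ℕ × ℕ} (hp : p ∈ indexI E.m) :
    ∃ K : ℝ, 0 < K ∧ ∀ k N l h : ℕ, 1 ≤ k → 1 ≤ N → coeff h (E.c p) ≠ 0 →
      (k : ℝ) ^ p.1 * l.descFactorial p.2 * xWeight E.sigma0 N l ≤
        K * (E.absIndicial k (l + h) * xWeight E.sigma0 N (l + h)) := by
  suffices ∃ K : ℝ, ∀ k N l h : ℕ, 1 ≤ k → 1 ≤ N → coeff h (E.c p) ≠ 0 →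
      (k : ℝ) ^ p.1 * l.descFactorial p.2 * xWeight E.sigma0 N l ≤
        K * (E.absIndicial k (l + h) * xWeight E.sigma0 N (l + h)) by
    obtain ⟨K, hK⟩ := this
    refine ⟨max 1 K, by positivity, fun k N l h hk hN hc => (hK k N l h hk hN hc).trans ?_⟩
    exact mul_le_mul_of_nonneg_right (le_max_right _ _)
      (mul_nonneg (absIndicial_pos hk _).le (xWeight_nonneg _ _ _))
  by_cases hc0 : constantCoeff (E.c p) = 0
  · by_cases hc : E.c p = 0
    · exact ⟨0, fun k N l h _ _ hch => absurd (by rw [hc, map_zero]) hch⟩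
    · obtain ⟨K, hK⟩ := exists_pow_mul_descFactorial_mul_xWeight_le_of_mem_Lam1 ⟨hp, hc0, hc⟩
      exact ⟨K, fun k N l h hk hN hch => hK k N l h hk hN
        (not_lt.1 fun hlt => hch (coeff_eq_zero_of_lt_ordC hlt))⟩
  · obtain ⟨K, hK⟩ := exists_pow_mul_descFactorial_mul_xWeight_le_of_mem_Lam0 (.inr ⟨hp, hc0⟩)
    exact ⟨K, fun k N l h hk hN _ => hK k N l h hk hN⟩

theorem eventually_sum_coeff_c_le {p : ℕ × ℕ} (hp : p ∈ indexI E.m) {ε : ℝ} (hε : 0 < ε) :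
    ∀ᶠ R : ℝ in atTop, ∀ k N l : ℕ, 1 ≤ k → 1 ≤ N →
      ∑ l' ∈ Finset.range l, ‖coeff (l - l') (E.c p)‖ * ((k : ℝ) ^ p.1 * l'.descFactorial p.2) *
        (R ^ l' * xWeight E.sigma0 N l') ≤
      ε * (E.absIndicial k l * (R ^ l * xWeight E.sigma0 N l)) := by
  obtain ⟨K, hK, hle⟩ := exists_pow_mul_descFactorial_mul_xWeight_le hp
  filter_upwards [(E.c_conv p hp).eventually_sum_le (div_pos hε hK), eventually_gt_atTop 0]
    with R hsum hR k N l hk hN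
  set B := E.absIndicial k l * (R ^ l * xWeight E.sigma0 N l)
  have hB : 0 ≤ B := mul_nonneg (absIndicial_pos hk l).le
    (mul_nonneg (by positivity) (xWeight_nonneg _ _ _))
  have term_le : ∀ l' ∈ Finset.range l, ‖coeff (l - l') (E.c p)‖ *
      ((k : ℝ) ^ p.1 * l'.descFactorial p.2) * (R ^ l' * xWeight E.sigma0 N l') ≤
      K * B * (‖coeff (l - l') (E.c p)‖ * (R ^ (l - l'))⁻¹) := by
    intro l' hl'
    obtain ⟨h, rfl⟩ := Nat.exists_eq_add_of_le (Finset.mem_range.1 hl').le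
    rw [Nat.add_sub_cancel_left]
    by_cases hc : coeff h (E.c p) = 0
    · simp [hc]
    calc _ = ‖coeff h (E.c p)‖ * R ^ l' *
          ((k : ℝ) ^ p.1 * l'.descFactorial p.2 * xWeight E.sigma0 N l') := by ring
      _ ≤ ‖coeff h (E.c p)‖ * R ^ l' *
          (K * (E.absIndicial k (l' + h) * xWeight E.sigma0 N (l' + h))) :=
        mul_le_mul_of_nonneg_left (hle k N l' h hk hN hc) (by positivity)
      _ = _ := by
        simp only [B, pow_add]
        field_simp
  calc _ ≤ K * B * ∑ l' ∈ Finset.range l, ‖coeff (l - l') (E.c p)‖ * (R ^ (l - l'))⁻¹ := by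
        rw [Finset.mul_sum]
        exact Finset.sum_le_sum term_le
    _ = K * B * ∑ h ∈ Finset.range l, ‖coeff (h + 1) (E.c p)‖ * (R ^ (h + 1))⁻¹ := by
        rw [← Finset.sum_range_reflect]
        refine congrArg _ (Finset.sum_congr rfl fun h hh => ?_)
        rw [show l - (l - 1 - h) = h + 1 by have := Finset.mem_range.1 hh; omega]
    _ ≤ K * B * (ε / K) := mul_le_mul_of_nonneg_left (hsum l) (mul_nonneg hK.le hB)
    _ = ε * B := by field_simp

variable (E) in
theorem eventually_sum_lowerCoeff_le : ∀ᶠ R : ℝ in atTop, ∀ k N l : ℕ, 1 ≤ k → 1 ≤ N →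
    ∑ l' ∈ Finset.range l, ‖E.lowerCoeff k l l'‖ * (R ^ l' * xWeight E.sigma0 N l') ≤
      E.absIndicial k l / 2 * (R ^ l * xWeight E.sigma0 N l) := by
  have hε : (0 : ℝ) < 1 / (2 * ((indexI E.m).card + 1)) := by positivity
  filter_upwards [(indexI E.m).eventually_all.2 fun p hp => eventually_sum_coeff_c_le hp hε,
    eventually_gt_atTop 0] with R hsum hR k N l hk hN
  set B := E.absIndicial k l * (R ^ l * xWeight E.sigma0 N l)
  have hB : 0 ≤ B := mul_nonneg (absIndicial_pos hk l).le
    (mul_nonneg (by positivity) (xWeight_nonneg _ _ _))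
  have norm_lowerCoeff_le : ∀ l' ∈ Finset.range l, ‖E.lowerCoeff k l l'‖ ≤
      ∑ p ∈ indexI E.m, ‖coeff (l - l') (E.c p)‖ * ((k : ℝ) ^ p.1 * l'.descFactorial p.2) := by
    intro l' _
    refine (norm_sum_le _ _).trans (le_of_eq (Finset.sum_congr rfl fun p _ => ?_))
    rw [norm_mul, norm_mul, norm_pow, Complex.norm_natCast, Complex.norm_natCast]
  calc _ ≤ ∑ l' ∈ Finset.range l, (∑ p ∈ indexI E.m, ‖coeff (l - l') (E.c p)‖ *
          ((k : ℝ) ^ p.1 * l'.descFactorial p.2)) * (R ^ l' * xWeight E.sigma0 N l') :=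
        Finset.sum_le_sum fun l' hl' => mul_le_mul_of_nonneg_right (norm_lowerCoeff_le l' hl')
          (mul_nonneg (by positivity) (xWeight_nonneg _ _ _))
    _ = ∑ p ∈ indexI E.m, ∑ l' ∈ Finset.range l, ‖coeff (l - l') (E.c p)‖ *
          ((k : ℝ) ^ p.1 * l'.descFactorial p.2) * (R ^ l' * xWeight E.sigma0 N l') := by
        simp only [Finset.sum_mul]
        exact Finset.sum_comm
    _ ≤ ∑ _p ∈ indexI E.m, 1 / (2 * (((indexI E.m).card : ℝ) + 1)) * B :=
        Finset.sum_le_sum fun p hp => hsum p hp k N l hk hN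
    _ = (indexI E.m).card / ((indexI E.m).card + 1) * (B / 2) := by
        rw [Finset.sum_const, nsmul_eq_mul]
        field_simp
    _ ≤ 1 * (B / 2) := by
        gcongr
        rw [div_le_one (by positivity)]
        linarith
    _ = _ := by ring

theorem SignCond.eventually_majorized_of_recursion (hE : E.SignCond) : ∀ᶠ R : ℝ in atTop,
    ∀ k N : ℕ, 1 ≤ k → 1 ≤ N → ∀ F : ℝ, 0 ≤ F → ∀ w f : ℂ⟦X⟧,
    (∀ l, E.indicial k l * coeff l w =
      ∑ l' ∈ Finset.range l, E.lowerCoeff k l l' * coeff l' w + coeff l f) →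
    Majorized E.sigma0 R N (F * (k : ℝ) ^ E.m) f → Majorized E.sigma0 R N (2 * F) w := by
  filter_upwards [E.eventually_sum_lowerCoeff_le, eventually_gt_atTop 0]
    with R hsum hR k N hk hN F hF w f hw hf l
  induction l using Nat.strong_induction_on with
  | _ l ih =>
    have hA := absIndicial_pos (E := E) hk l
    refine le_of_mul_le_mul_left ?_ hA
    calc E.absIndicial k l * ‖coeff l w‖ = ‖E.indicial k l * coeff l w‖ := by
          rw [norm_mul, hE.indicial_eq, Complex.norm_real, Real.norm_of_nonneg hA.le]
      _ ≤ ∑ l' ∈ Finset.range l,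
            ‖E.lowerCoeff k l l'‖ * (2 * F * (R ^ l' * xWeight E.sigma0 N l')) +
          F * (k : ℝ) ^ E.m * (R ^ l * xWeight E.sigma0 N l) := by
          rw [hw]
          refine (norm_add_le _ _).trans (add_le_add ((norm_sum_le _ _).trans ?_) (hf l))
          refine Finset.sum_le_sum fun l' hl' => ?_
          rw [norm_mul]
          exact mul_le_mul_of_nonneg_left (ih l' (Finset.mem_range.1 hl')) (norm_nonneg _)
      _ = 2 * F * (∑ l' ∈ Finset.range l,
            ‖E.lowerCoeff k l l'‖ * (R ^ l' * xWeight E.sigma0 N l')) +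
          F * (k : ℝ) ^ E.m * (R ^ l * xWeight E.sigma0 N l) := by
          rw [Finset.mul_sum]
          congr 1
          exact Finset.sum_congr rfl fun _ _ => by ring
      _ ≤ 2 * F * (E.absIndicial k l / 2 * (R ^ l * xWeight E.sigma0 N l)) +
          F * E.absIndicial k l * (R ^ l * xWeight E.sigma0 N l) := by
          have := hsum k N l hk hN
          have := E.pow_le_absIndicial k l
          have := xWeight_nonneg E.sigma0 N l
          gcongr
      _ = _ := by ring

end Equation

/-! ### Weights and majorants in `(t, x)` -/

/-- The weight `A^κ (κ+1)!^τ (κ+1)^e` for the coefficient of `t^κ`. With `e = -2` the weights are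
closed under products up to a constant; the exponents `e ≠ -2` measure the loss of derivatives. -/
noncomputable def tWeight (A τ e : ℝ) (κ : ℕ) : ℝ :=
  A ^ κ * ((κ + 1).factorial : ℝ) ^ τ * ((κ : ℝ) + 1) ^ e

theorem tWeight_nonneg {A : ℝ} (hA : 0 ≤ A) (τ e : ℝ) (κ : ℕ) : 0 ≤ tWeight A τ e κ := by
  rw [tWeight]
  positivity

theorem factorial_succ_mul_factorial_succ_le (a b : ℕ) :
    (a + 1).factorial * (b + 1).factorial ≤ (a + b + 1).factorial := by
  have hb : (b + 1).factorial = (1 + 1).ascFactorial b := by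
    have := Nat.factorial_mul_ascFactorial 1 b
    rw [Nat.factorial_one, one_mul] at this
    rw [this, add_comm]
  rw [Nat.add_right_comm, ← Nat.factorial_mul_ascFactorial (a + 1) b, hb]
  exact Nat.mul_le_mul_left _ (Nat.ascFactorial_le b (by omega))

theorem add_one_rpow_le_of_le {e B : ℝ} (hB : 0 ≤ B) (he : -B ≤ e) {κ₁ κ₂ : ℕ} (h : κ₂ ≤ κ₁) :
    ((κ₁ : ℝ) + 1) ^ e ≤ 2 ^ B * (((κ₁ + κ₂ : ℕ) : ℝ) + 1) ^ e := by
  have hκ₂ : (κ₂ : ℝ) ≤ κ₁ := by exact_mod_cast h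
  have := κ₂.cast_nonneg (α := ℝ)
  push_cast
  rcases le_total 0 e with he0 | he0
  · exact (Real.rpow_le_rpow (by positivity) (by linarith) he0).trans
      (le_mul_of_one_le_left (by positivity) (Real.one_le_rpow (by norm_num) hB))
  · have two_rpow : 1 ≤ (2 : ℝ) ^ B * 2 ^ e := by
      rw [← Real.rpow_add (by norm_num)]
      exact Real.one_le_rpow (by norm_num) (by linarith)
    calc ((κ₁ : ℝ) + 1) ^ e ≤ 2 ^ B * 2 ^ e * ((κ₁ : ℝ) + 1) ^ e :=
          le_mul_of_one_le_left (by positivity) two_rpow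
      _ = 2 ^ B * (2 * ((κ₁ : ℝ) + 1)) ^ e := by
          rw [Real.mul_rpow (by norm_num) (by positivity), mul_assoc]
      _ ≤ 2 ^ B * ((κ₁ : ℝ) + κ₂ + 1) ^ e := by
          gcongr 2 ^ B * ?_
          exact Real.rpow_le_rpow_of_nonpos (by positivity) (by linarith) he0

theorem tWeight_mul_tWeight_le {A τ e B : ℝ} (hA : 0 ≤ A) (hτ : 0 ≤ τ) (hB : 0 ≤ B) (he : -B ≤ e)
    {κ₁ κ₂ : ℕ} (h : κ₂ ≤ κ₁) :
    tWeight A τ e κ₁ * tWeight A τ (-2) κ₂ ≤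
      2 ^ B * tWeight A τ e (κ₁ + κ₂) * ((κ₂ : ℝ) + 1) ^ (-2 : ℝ) := by
  have rpow_le := add_one_rpow_le_of_le hB he h
  have factorial_le : ((κ₁ + 1).factorial : ℝ) ^ τ * ((κ₂ + 1).factorial : ℝ) ^ τ ≤
      ((κ₁ + κ₂ + 1).factorial : ℝ) ^ τ := by
    rw [← Real.mul_rpow (by positivity) (by positivity)]
    refine Real.rpow_le_rpow (by positivity) ?_ hτ
    exact_mod_cast factorial_succ_mul_factorial_succ_le κ₁ κ₂
  rw [tWeight, tWeight, tWeight]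
  calc _ = A ^ (κ₁ + κ₂) * (((κ₁ + 1).factorial : ℝ) ^ τ * ((κ₂ + 1).factorial : ℝ) ^ τ) *
        ((κ₁ : ℝ) + 1) ^ e * ((κ₂ : ℝ) + 1) ^ (-2 : ℝ) := by
        rw [pow_add]
        ring
    _ ≤ A ^ (κ₁ + κ₂) * ((κ₁ + κ₂ + 1).factorial : ℝ) ^ τ *
        (2 ^ B * (((κ₁ + κ₂ : ℕ) : ℝ) + 1) ^ e) * ((κ₂ : ℝ) + 1) ^ (-2 : ℝ) := by gcongr
    _ = _ := by ring

/-- The constant in the convolution estimate `sum_tWeight_mul_tWeight_le` for the weights in `t`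
with exponents `e ≥ -B`. -/
noncomputable def convolutionConst (B : ℝ) : ℝ :=
  2 ^ B * (2 * ∑' n : ℕ, ((n : ℝ) + 1) ^ (-2 : ℝ))

theorem summable_add_one_rpow_neg_two : Summable fun n : ℕ => ((n : ℝ) + 1) ^ (-2 : ℝ) := by
  simpa using
    (summable_nat_add_iff 1).2 (Real.summable_nat_rpow.2 (by norm_num : (-2 : ℝ) < -1))

theorem one_le_convolutionConst {B : ℝ} (hB : 0 ≤ B) : 1 ≤ convolutionConst B := by
  have one_le_tsum : (1 : ℝ) ≤ ∑' n : ℕ, ((n : ℝ) + 1) ^ (-2 : ℝ) := by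
    simpa using summable_add_one_rpow_neg_two.le_tsum 0 fun _ _ => by positivity
  exact one_le_mul_of_one_le_of_one_le (Real.one_le_rpow (by norm_num) hB) (by linarith)

-- In a product the larger of the two indices carries the exponent `e`.
theorem sum_tWeight_mul_tWeight_le {A τ e B : ℝ} (hA : 0 ≤ A) (hτ : 0 ≤ τ) (hB : 0 ≤ B)
    (he : -B ≤ e) (κ : ℕ) :
    ∑ x ∈ antidiagonal κ, (if x.2 ≤ x.1 then tWeight A τ e x.1 * tWeight A τ (-2) x.2
      else tWeight A τ (-2) x.1 * tWeight A τ e x.2) ≤ convolutionConst B * tWeight A τ e κ := by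
  set f : ℕ → ℝ := fun n => ((n : ℝ) + 1) ^ (-2 : ℝ)
  have hf : ∀ n, 0 ≤ f n := fun n => by positivity
  have hc : 0 ≤ 2 ^ B * tWeight A τ e κ := mul_nonneg (by positivity) (tWeight_nonneg hA τ e κ)
  have term_le : ∀ x ∈ antidiagonal κ,
      (if x.2 ≤ x.1 then tWeight A τ e x.1 * tWeight A τ (-2) x.2
        else tWeight A τ (-2) x.1 * tWeight A τ e x.2) ≤
      2 ^ B * tWeight A τ e κ * (f x.1 + f x.2) := by
    intro x hx
    have hx : x.1 + x.2 = κ := mem_antidiagonal.1 hx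
    split_ifs with h
    · refine (tWeight_mul_tWeight_le hA hτ hB he h).trans ?_
      rw [hx]
      exact mul_le_mul_of_nonneg_left (le_add_of_nonneg_left (hf _)) hc
    · rw [mul_comm (tWeight A τ (-2) x.1)]
      refine (tWeight_mul_tWeight_le hA hτ hB he (not_le.1 h).le).trans ?_
      rw [add_comm x.2, hx]
      exact mul_le_mul_of_nonneg_left (le_add_of_nonneg_right (hf _)) hc
  have sum_eq : ∑ x ∈ antidiagonal κ, (f x.1 + f x.2) = 2 * ∑ n ∈ Finset.range (κ + 1), f n := by
    have reflect := Finset.sum_range_reflect f (κ + 1)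
    simp only [Nat.add_sub_cancel] at reflect
    rw [Finset.sum_add_distrib, Finset.Nat.sum_antidiagonal_eq_sum_range_succ_mk,
      Finset.Nat.sum_antidiagonal_eq_sum_range_succ_mk, reflect, two_mul]
  calc _ ≤ 2 ^ B * tWeight A τ e κ * (2 * ∑ n ∈ Finset.range (κ + 1), f n) := by
        rw [← sum_eq, Finset.mul_sum]
        exact Finset.sum_le_sum term_le
    _ ≤ 2 ^ B * tWeight A τ e κ * (2 * ∑' n, f n) := by
        gcongr
        exact summable_add_one_rpow_neg_two.sum_le_tsum _ fun n _ => hf n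
    _ = _ := by
        rw [convolutionConst]
        ring

theorem pow_mul_factorial_sub_le {n r : ℕ} (h : r ≤ n) :
    (n : ℝ) ^ r * ((n - r).factorial : ℝ) ≤ Real.exp 1 ^ r * (n.factorial : ℝ) := by
  have descFactorial_le : n ^ r * r.factorial ≤ n.descFactorial r * r ^ r := by
    rw [← Nat.descFactorial_self r, Nat.descFactorial_eq_prod_range,
      Nat.descFactorial_eq_prod_range, ← Finset.card_range r, ← Finset.prod_const,
      ← Finset.prod_const, Finset.card_range, ← Finset.prod_mul_distrib,
      ← Finset.prod_mul_distrib]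
    refine Finset.prod_le_prod' fun i hi => ?_
    obtain ⟨a, rfl⟩ := Nat.exists_eq_add_of_le (Finset.mem_range.1 hi).le
    obtain ⟨b, rfl⟩ := Nat.exists_eq_add_of_le h
    rw [Nat.add_sub_cancel_left, show i + a + b - i = a + b by omega]
    nlinarith [Nat.zero_le (i * b)]
  rify at descFactorial_le
  have pow_self_le : (r : ℝ) ^ r ≤ Real.exp 1 ^ r * r.factorial := by
    have := Real.pow_div_factorial_le_exp (r : ℝ) (by positivity) r
    rwa [div_le_iff₀ (by positivity), ← mul_one (r : ℝ), Real.exp_nat_mul, mul_one] at this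
  have pow_le : (n : ℝ) ^ r ≤ n.descFactorial r * Real.exp 1 ^ r := by
    refine le_of_mul_le_mul_right ?_ (by positivity : (0 : ℝ) < r.factorial)
    calc _ ≤ n.descFactorial r * (r : ℝ) ^ r := descFactorial_le
      _ ≤ n.descFactorial r * (Real.exp 1 ^ r * r.factorial) := by gcongr
      _ = _ := by ring
  calc _ ≤ n.descFactorial r * Real.exp 1 ^ r * ((n - r).factorial : ℝ) := by gcongr
    _ = Real.exp 1 ^ r * ((n - r).factorial * n.descFactorial r : ℕ) := by
        push_cast
        ring
    _ = _ := by rw [Nat.factorial_mul_descFactorial h]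

theorem add_one_rpow_neg_le {B : ℝ} (hB : 0 ≤ B) (κ r : ℕ) :
    ((κ : ℝ) + 1) ^ (-B) ≤ (2 ^ B) ^ r * (((κ + r : ℕ) : ℝ) + 1) ^ (-B) := by
  have add_le : ((κ + r : ℕ) : ℝ) + 1 ≤ 2 ^ r * ((κ : ℝ) + 1) := by
    have : κ + r + 1 ≤ 2 ^ r * (κ + 1) := by
      nlinarith [Nat.lt_two_pow_self (n := r), Nat.zero_le (r * κ)]
    exact_mod_cast this
  have two_rpow : ((2 : ℝ) ^ B) ^ r = ((2 : ℝ) ^ r) ^ B := Real.rpow_pow_comm (by norm_num) _ _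
  rw [Real.rpow_neg (by positivity), Real.rpow_neg (by positivity), two_rpow, ← div_eq_mul_inv,
    ← Real.div_rpow (by positivity) (by positivity), ← Real.inv_rpow (by positivity)]
  refine Real.rpow_le_rpow (by positivity) ?_ hB
  rwa [inv_le_comm₀ (by positivity) (by positivity), inv_div, div_le_iff₀' (by positivity)]

theorem factorial_rpow_mul_pow_rpow_le {τ : ℝ} (hτ : 0 ≤ τ) (κ r : ℕ) :
    ((κ + 1).factorial : ℝ) ^ τ * ((((κ + r : ℕ) : ℝ) + 1) ^ r) ^ τ ≤
      (Real.exp 1 ^ τ) ^ r * ((κ + r + 1).factorial : ℝ) ^ τ := by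
  have := pow_mul_factorial_sub_le (show r ≤ κ + r + 1 by omega)
  rw [show κ + r + 1 - r = κ + 1 by omega] at this
  rw [Real.rpow_pow_comm (Real.exp_pos 1).le, ← Real.mul_rpow (by positivity) (by positivity),
    ← Real.mul_rpow (by positivity) (by positivity)]
  refine Real.rpow_le_rpow (by positivity) ?_ hτ
  push_cast at this ⊢
  linarith

-- A shift by `r` in `t` makes up for `m + τ r` derivatives.
theorem tWeight_le_tWeight_add {A τ B : ℝ} (hA : 0 < A) (hτ : 0 ≤ τ) (hB : 0 ≤ B) (m r κ : ℕ) :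
    tWeight A τ (m + τ * r - B) κ ≤ (2 ^ B * Real.exp 1 ^ τ / A) ^ r *
      ((((κ + r : ℕ) : ℝ) + 1) ^ m * tWeight A τ (-B) (κ + r)) := by
  rw [tWeight, tWeight]
  set n : ℝ := ((κ + r : ℕ) : ℝ) + 1 with hn
  have hκ : (κ : ℝ) + 1 ≤ n := by
    rw [hn]
    exact_mod_cast (by omega : κ + 1 ≤ κ + r + 1)
  have rpow_le : ((κ : ℝ) + 1) ^ ((m : ℝ) + τ * r - B) ≤
      n ^ m * (n ^ r) ^ τ * ((2 ^ B) ^ r * n ^ (-B)) := by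
    have := add_one_rpow_neg_le hB κ r
    rw [sub_eq_add_neg, Real.rpow_add (by positivity), Real.rpow_add (by positivity),
      Real.rpow_natCast, mul_comm τ, Real.rpow_mul (by positivity), Real.rpow_natCast]
    gcongr
  calc _ ≤ A ^ κ * ((κ + 1).factorial : ℝ) ^ τ * (n ^ m * (n ^ r) ^ τ *
          ((2 ^ B) ^ r * n ^ (-B))) := by gcongr
    _ = A ^ κ * (((κ + 1).factorial : ℝ) ^ τ * (n ^ r) ^ τ) *
          (n ^ m * ((2 ^ B) ^ r * n ^ (-B))) := by ring
    _ ≤ A ^ κ * ((Real.exp 1 ^ τ) ^ r * ((κ + r + 1).factorial : ℝ) ^ τ) *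
          (n ^ m * ((2 ^ B) ^ r * n ^ (-B))) := by
        gcongr ?_ * ?_ * ?_
        exact factorial_rpow_mul_pow_rpow_le hτ κ r
    _ = _ := by
        rw [pow_add, div_pow, mul_pow]
        field_simp

theorem prod_pow_induction {ι M : Type*} [CommMonoid M] {P : ℕ → M → Prop}
    (mul : ∀ n₁ n₂ w₁ w₂, P n₁ w₁ → P n₂ w₂ → P (n₁ + n₂) (w₁ * w₂)) (s : Finset ι) {v : ι → M}
    {ν : ι → ℕ} (hP : ∀ i ∈ s, 0 < ν i → P 1 (v i)) (hν : 0 < ∑ i ∈ s, ν i) :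
    P (∑ i ∈ s, ν i) (∏ i ∈ s, v i ^ ν i) := by
  classical
  have pow : ∀ w, P 1 w → ∀ n, P (n + 1) (w ^ (n + 1)) := fun w hw n => by
    induction n with
    | zero => simpa using hw
    | succ n ih =>
      rw [pow_succ]
      exact mul _ _ _ _ ih hw
  induction s using Finset.induction_on with
  | empty => simp at hν
  | insert a s ha ih =>
    replace ih := ih fun i hi => hP i (Finset.mem_insert_of_mem hi)
    rw [Finset.sum_insert ha] at hν
    rw [Finset.sum_insert ha, Finset.prod_insert ha]
    rcases Nat.eq_zero_or_pos (ν a) with ha0 | ha0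
    · rw [ha0, zero_add] at hν
      rw [ha0, zero_add, pow_zero, one_mul]
      exact ih hν
    · have pow_a : P (ν a) (v a ^ ν a) := by
        simpa only [Nat.sub_add_cancel ha0] using
          pow _ (hP a (Finset.mem_insert_self a s) ha0) (ν a - 1)
      rcases Nat.eq_zero_or_pos (∑ i ∈ s, ν i) with hs0 | hs0
      · have prod_eq : ∏ i ∈ s, v i ^ ν i = 1 := Finset.prod_eq_one fun i hi => by
          rw [Finset.sum_eq_zero_iff.1 hs0 i hi, pow_zero]
        rwa [hs0, prod_eq, add_zero, mul_one]
      · exact mul _ _ _ _ pow_a (ih hs0)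

namespace Majorized

variable {σ R : ℝ} {N : ℕ}

theorem smul {b : ℝ} {f : ℂ⟦X⟧} (h : Majorized σ R N b f) (z : ℂ) :
    Majorized σ R N (‖z‖ * b) (z • f) := fun l => by
  rw [coeff_smul, norm_smul, mul_assoc]
  exact mul_le_mul_of_nonneg_left (h l) (norm_nonneg _)

theorem add {b b' : ℝ} {f g : ℂ⟦X⟧} (hf : Majorized σ R N b f) (hg : Majorized σ R N b' g) :
    Majorized σ R N (b + b') (f + g) := fun l => by
  rw [map_add, add_mul]
  exact (norm_add_le _ _).trans (add_le_add (hf l) (hg l))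

theorem sum {ι : Type*} (s : Finset ι) {b : ι → ℝ} {f : ι → ℂ⟦X⟧}
    (h : ∀ i ∈ s, Majorized σ R N (b i) (f i)) :
    Majorized σ R N (∑ i ∈ s, b i) (∑ i ∈ s, f i) := fun l => by
  rw [map_sum, Finset.sum_mul]
  exact (norm_sum_le _ _).trans (Finset.sum_le_sum fun i hi => h i hi l)

end Majorized

/-- For `κ < K` the coefficient of `t^κ` in `x^μ v` is majorized with index `L κ + N` and with the
weight `b R^{-μ} A^κ (κ+1)!^τ (κ+1)^e`. The truncation at `K` allows for induction on the order in
`t`. -/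
def TxMajorized (σ R A τ : ℝ) (L K N : ℕ) (b : ℝ) (μ : ℕ) (e : ℝ) (v : ℂ⟦X⟧⟦X⟧) : Prop :=
  ∀ κ < K, Majorized σ R (L * κ + N) (b * (R ^ μ)⁻¹ * tWeight A τ e κ) (X ^ μ * coeff κ v)

namespace TxMajorized

variable {σ R A τ B : ℝ} {L K : ℕ} (hσ : 1 ≤ σ) (hR : 0 < R) (hA : 0 ≤ A) (hτ : 0 ≤ τ)
  (hB : 0 ≤ B)
include hσ hR hA hτ hB

theorem mul {N₁ N₂ : ℕ} {b₁ b₂ e : ℝ} {μ : ℕ} {v₁ v₂ : ℂ⟦X⟧⟦X⟧} (he : -B ≤ e) (hb₁ : 0 ≤ b₁)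
    (hb₂ : 0 ≤ b₂)
    (h₁ : TxMajorized σ R A τ L K N₁ b₁ μ e v₁) (h₁' : TxMajorized σ R A τ L K N₁ b₁ 0 (-2) v₁)
    (h₂ : TxMajorized σ R A τ L K N₂ b₂ μ e v₂) (h₂' : TxMajorized σ R A τ L K N₂ b₂ 0 (-2) v₂) :
    TxMajorized σ R A τ L K (N₁ + N₂) (convolutionConst B * b₁ * b₂) μ e (v₁ * v₂) := by
  intro κ hκ
  have term_majorized : ∀ x ∈ antidiagonal κ, Majorized σ R (L * κ + (N₁ + N₂))
      (b₁ * b₂ * (R ^ μ)⁻¹ * (if x.2 ≤ x.1 then tWeight A τ e x.1 * tWeight A τ (-2) x.2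
        else tWeight A τ (-2) x.1 * tWeight A τ e x.2))
      (X ^ μ * (coeff x.1 v₁ * coeff x.2 v₂)) := by
    rintro ⟨κ₁, κ₂⟩ hx
    obtain rfl : κ₁ + κ₂ = κ := mem_antidiagonal.1 hx
    have hw : ∀ e κ, 0 ≤ tWeight A τ e κ := tWeight_nonneg hA τ
    have coeff₁ := h₁' κ₁ (by omega)
    have coeff₂ := h₂' κ₂ (by omega)
    rw [pow_zero, pow_zero, inv_one, one_mul, mul_one] at coeff₁ coeff₂
    rw [show L * (κ₁ + κ₂) + (N₁ + N₂) = (L * κ₁ + N₁) + (L * κ₂ + N₂) by ring]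
    split_ifs with h
    · rw [← mul_assoc (X ^ μ)]
      have := hw e κ₁
      exact ((h₁ κ₁ (by omega)).mul hR hσ (by positivity) (mul_nonneg hb₂ (hw _ _))
        coeff₂).mono_const hR (le_of_eq (by ring))
    · rw [mul_left_comm (X ^ μ)]
      have := hw e κ₂
      exact (coeff₁.mul hR hσ (mul_nonneg hb₁ (hw _ _)) (by positivity)
        (h₂ κ₂ (by omega))).mono_const hR (le_of_eq (by ring))
  rw [coeff_mul, Finset.mul_sum]
  refine (Majorized.sum _ term_majorized).mono_const hR ?_
  rw [← Finset.mul_sum]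
  exact (mul_le_mul_of_nonneg_left (sum_tWeight_mul_tWeight_le hA hτ hB he κ)
    (by positivity)).trans (le_of_eq (by ring))

theorem prod_pow {ι : Type*} (s : Finset ι) {v : ι → ℂ⟦X⟧⟦X⟧} {ν : ι → ℕ} {N : ℕ} {b e : ℝ} {μ : ℕ}
    (he : -B ≤ e) (hB2 : 2 ≤ B) (hb : 0 ≤ b)
    (h : ∀ i ∈ s, 0 < ν i →
      TxMajorized σ R A τ L K N b μ e (v i) ∧ TxMajorized σ R A τ L K N b 0 (-2) (v i))
    (hν : 0 < ∑ i ∈ s, ν i) :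
    TxMajorized σ R A τ L K ((∑ i ∈ s, ν i) * N) ((convolutionConst B * b) ^ (∑ i ∈ s, ν i)) μ e
      (∏ i ∈ s, v i ^ ν i) := by
  have hc := one_le_convolutionConst hB
  have hc0 : 0 < convolutionConst B := by linarith
  set c := convolutionConst B
  let P : ℕ → ℂ⟦X⟧⟦X⟧ → Prop := fun n w =>
    TxMajorized σ R A τ L K (n * N) ((c * b) ^ n / c) μ e w ∧
      TxMajorized σ R A τ L K (n * N) ((c * b) ^ n / c) 0 (-2) w
  have mul_P : ∀ n₁ n₂ w₁ w₂, P n₁ w₁ → P n₂ w₂ → P (n₁ + n₂) (w₁ * w₂) := by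
    rintro n₁ n₂ w₁ w₂ ⟨h₁, h₁'⟩ ⟨h₂, h₂'⟩
    have const_eq : (c * b) ^ (n₁ + n₂) / c = c * ((c * b) ^ n₁ / c) * ((c * b) ^ n₂ / c) := by
      rw [pow_add]
      field_simp
    simp only [P]
    rw [add_mul, const_eq]
    exact ⟨mul hσ hR hA hτ hB he (by positivity) (by positivity) h₁ h₁' h₂ h₂',
      mul hσ hR hA hτ hB (by linarith) (by positivity) (by positivity) h₁' h₁' h₂' h₂'⟩
  have prod_P : P (∑ i ∈ s, ν i) (∏ i ∈ s, v i ^ ν i) :=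
    prod_pow_induction mul_P s (fun i hi hνi => by
      simpa only [P, one_mul, pow_one, mul_div_cancel_left₀ _ hc0.ne'] using h i hi hνi) hν
  intro κ hκ
  have := tWeight_nonneg hA τ e κ
  refine (prod_P.1 κ hκ).mono_const hR ?_
  gcongr
  exact div_le_self (by positivity) hc

end TxMajorized

namespace Equation

variable (E : Equation)

/-! ### The index `s₀` -/

/-- The loss `j + max {α, μ + σ₀ (α - μ)}` of the operator `x^μ (t∂_t)^j ∂_x^α` with
`p = (j, α)`. -/
noncomputable def loss (p : ℕ × ℕ) (μ : ℕ) : ℝ :=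
  (p.1 : ℝ) + max (p.2 : ℝ) ((μ : ℝ) + E.sigma0 * ((p.2 : ℝ) - (μ : ℝ)))

/-- A common upper bound for the losses of all derivatives that occur in `G₂`. -/
noncomputable def maxLoss : ℝ := ∑ p : E.M, ((p.1.1 : ℝ) + E.sigma0 * (p.1.2 : ℝ))

theorem maxLoss_nonneg : 0 ≤ E.maxLoss := by
  have := E.one_le_sigma0
  exact Finset.sum_nonneg fun _ _ => by positivity

theorem loss_le_maxLoss (p : E.M) (μ : ℕ) : E.loss p.1 μ ≤ E.maxLoss := by
  have hσ := E.one_le_sigma0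
  have max_le_sigma0_mul : max (p.1.2 : ℝ) ((μ : ℝ) + E.sigma0 * ((p.1.2 : ℝ) - (μ : ℝ))) ≤
      E.sigma0 * p.1.2 := by
    have := p.1.2.cast_nonneg (α := ℝ)
    have := μ.cast_nonneg (α := ℝ)
    exact max_le (by nlinarith) (by nlinarith)
  calc E.loss p.1 μ ≤ (p.1.1 : ℝ) + E.sigma0 * p.1.2 := add_le_add_right max_le_sigma0_mul _
    _ ≤ E.maxLoss := Finset.single_le_sum
        (f := fun p : E.M => (p.1.1 : ℝ) + E.sigma0 * (p.1.2 : ℝ))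
        (fun _ _ => by positivity) (Finset.mem_univ p)

theorem bddAbove_s0 : BddAbove (insert 0 {r : ℝ | ∃ μ : ℕ, ∃ q ∈ E.J μ,
    r = (E.mIdx q.2 μ - (E.m : ℝ)) / ((q.1 : ℝ) + ((∑ p, q.2 p : ℕ) : ℝ) - 1)}) := by
  refine ⟨E.maxLoss, ?_⟩
  rintro r (rfl | ⟨μ, q, hq, rfl⟩)
  · exact E.maxLoss_nonneg
  · have two_le : (2 : ℝ) ≤ (q.1 : ℝ) + ((∑ p, q.2 p : ℕ) : ℝ) := by exact_mod_cast hq.1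
    have mIdx_le : E.mIdx q.2 μ ≤ E.maxLoss := by
      refine Real.sSup_le ?_ E.maxLoss_nonneg
      rintro _ ⟨p, _, rfl⟩
      exact E.loss_le_maxLoss p μ
    rw [div_le_iff₀ (by linarith)]
    nlinarith [E.maxLoss_nonneg, E.m.cast_nonneg (α := ℝ)]

theorem one_le_s0 : 1 ≤ E.s0 :=
  le_add_of_nonneg_right (le_csSup E.bddAbove_s0 (Set.mem_insert _ _))

theorem loss_le {i : ℕ} {ν : E.M → ℕ} {μ r : ℕ} (hr : 1 ≤ r) (hνr : i + ∑ p, ν p = r + 1)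
    (hg : coeff μ (E.g i ν) ≠ 0) {p : E.M} (hp : 0 < ν p) :
    E.loss p.1 μ ≤ E.m + (E.s0 - 1) * r := by
  have one_le_sum : 1 ≤ ∑ p, ν p :=
    le_trans hp (Finset.single_le_sum (f := ν) (fun _ _ => Nat.zero_le _) (Finset.mem_univ p))
  have mem_J : (i, ν) ∈ E.J μ := by
    refine ⟨show 2 ≤ i + ∑ p, ν p by omega, one_le_sum, ?_⟩
    rw [constantCoeff_iterate_derivative]
    exact mul_ne_zero (by exact_mod_cast μ.factorial_ne_zero) hg
  have loss_le_mIdx : E.loss p.1 μ ≤ E.mIdx ν μ :=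
    le_csSup ⟨E.maxLoss, by rintro _ ⟨p, _, rfl⟩; exact E.loss_le_maxLoss p μ⟩ ⟨p, hp, rfl⟩
  have div_le : (E.mIdx ν μ - (E.m : ℝ)) / ((i : ℝ) + ((∑ p, ν p : ℕ) : ℝ) - 1) ≤ E.s0 - 1 := by
    rw [s0, add_sub_cancel_left]
    exact le_csSup E.bddAbove_s0 (Set.mem_insert_of_mem _ ⟨μ, (i, ν), mem_J, rfl⟩)
  have denom_eq : (i : ℝ) + ((∑ p, ν p : ℕ) : ℝ) - 1 = r := by
    rw [← Nat.cast_add, hνr]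
    push_cast
    ring
  rw [denom_eq, div_le_iff₀ (by positivity)] at div_le
  linarith

theorem le_maxAlpha (p : E.M) : p.1.2 ≤ E.maxAlpha := Finset.le_sup (f := Prod.snd) p.2

/-! ### Majorants for the nonlinear terms -/

/-- The slope in `κ` of the index of the weights in `x` of the coefficient of `t^(κ+1)`: a term
with `i + |ν| = r + 1` gains `r` powers of `t`, and its at most `r + 1 ≤ 2 r` factors shift the
index by at most `1 + M` each. -/
def xIndexSlope : ℕ := 2 * (1 + E.maxAlpha)

/-- The number `B` such that the weights in `t` of a solution have exponent `-B`: differentiation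
turns the exponent `-B` into at most `-2`. -/
noncomputable def tExponent : ℝ := E.maxLoss + 2

theorem two_le_tExponent : 2 ≤ E.tExponent := le_add_of_nonneg_left E.maxLoss_nonneg

/-- The constant factor lost by the derivatives in `G₂`. -/
noncomputable def derivConst (R : ℝ) : ℝ :=
  R ^ E.maxAlpha * ((E.xIndexSlope : ℝ) + 1 + E.maxAlpha) ^ E.maxLoss

theorem one_le_xIndexSlope_add : (1 : ℝ) ≤ (E.xIndexSlope : ℝ) + 1 + E.maxAlpha := by
  have := E.xIndexSlope.cast_nonneg (α := ℝ)
  have := E.maxAlpha.cast_nonneg (α := ℝ)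
  linarith

theorem one_le_derivConst {R : ℝ} (hR : 1 ≤ R) : 1 ≤ E.derivConst R :=
  one_le_mul_of_one_le_of_one_le (one_le_pow₀ hR)
    (Real.one_le_rpow E.one_le_xIndexSlope_add E.maxLoss_nonneg)

/-- Majorants for the coefficients of `t, …, t^K` in `u`. -/
def SolMajorized (R A D : ℝ) (K : ℕ) (u : ℂ⟦X⟧⟦X⟧) : Prop :=
  ∀ κ < K, Majorized E.sigma0 R (E.xIndexSlope * κ + 1)
    (D * tWeight A (E.s0 - 1) (-E.tExponent) κ) (coeff (κ + 1) u)

theorem xIndex_rpow_le (κ : ℕ) (p : E.M) {ε : ℝ} (hε : 0 ≤ ε) (hεm : ε ≤ E.maxLoss) :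
    (((E.xIndexSlope * κ + 1 : ℕ) : ℝ) + p.1.2) ^ ε ≤
      ((E.xIndexSlope : ℝ) + 1 + E.maxAlpha) ^ E.maxLoss * ((κ : ℝ) + 1) ^ ε := by
  have hQ := E.one_le_xIndexSlope_add
  set Q : ℝ := (E.xIndexSlope : ℝ) + 1 + E.maxAlpha with hQ_def
  have index_le : ((E.xIndexSlope * κ + 1 : ℕ) : ℝ) + p.1.2 ≤ Q * ((κ : ℝ) + 1) := by
    rw [hQ_def]
    norm_cast
    nlinarith [E.le_maxAlpha p, Nat.zero_le (E.maxAlpha * κ)]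
  calc _ ≤ (Q * ((κ : ℝ) + 1)) ^ ε := Real.rpow_le_rpow (by positivity) index_le hε
    _ = Q ^ ε * ((κ : ℝ) + 1) ^ ε := Real.mul_rpow (by linarith) (by positivity)
    _ ≤ _ := by gcongr

theorem pow_mul_rpow_mul_tWeight_le {A τ : ℝ} (hA : 0 ≤ A) (j κ : ℕ) {ε e e' : ℝ}
    (he : (j : ℝ) + ε + e ≤ e') :
    ((κ + 1 : ℕ) : ℝ) ^ j * ((κ : ℝ) + 1) ^ ε * tWeight A τ e κ ≤ tWeight A τ e' κ := by
  have rpow_le : ((κ : ℝ) + 1) ^ j * ((κ : ℝ) + 1) ^ ε * ((κ : ℝ) + 1) ^ e ≤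
      ((κ : ℝ) + 1) ^ e' := by
    rw [← Real.rpow_natCast, ← Real.rpow_add (by positivity), ← Real.rpow_add (by positivity)]
    exact Real.rpow_le_rpow_of_exponent_le (by simp) he
  rw [tWeight, tWeight]
  push_cast
  calc _ = A ^ κ * ((κ + 1).factorial : ℝ) ^ τ *
        (((κ : ℝ) + 1) ^ j * ((κ : ℝ) + 1) ^ ε * ((κ : ℝ) + 1) ^ e) := by ring
    _ ≤ _ := by gcongr

section

variable {E} {R A D : ℝ} (hR : 1 ≤ R) {K : ℕ} {u : ℂ⟦X⟧⟦X⟧}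
include hR

theorem SolMajorized.shift_tDt_Dx (hA : 0 ≤ A) (hD : 0 ≤ D) (hu : E.SolMajorized R A D K u)
    (p : E.M) (μ : ℕ) {e : ℝ} (he : E.loss p.1 μ ≤ e + E.tExponent) :
    TxMajorized E.sigma0 R A (E.s0 - 1) E.xIndexSlope K (1 + E.maxAlpha) (D * E.derivConst R) μ e
      (shift (tDt^[p.1.1] (Dx^[p.1.2] u))) := by
  intro κ hκ
  have hσ := E.one_le_sigma0
  have hR0 : 0 < R := by linarith
  set ε : ℝ := max (p.1.2 : ℝ) ((μ : ℝ) + E.sigma0 * ((p.1.2 : ℝ) - (μ : ℝ)))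
  have hε : 0 ≤ ε := le_max_of_le_left (by positivity)
  have loss_eq : E.loss p.1 μ = p.1.1 + ε := rfl
  have hεm : ε ≤ E.maxLoss := by
    have := E.loss_le_maxLoss p μ
    have := p.1.1.cast_nonneg (α := ℝ)
    linarith
  have hαM := E.le_maxAlpha p
  have hw := tWeight_nonneg hA (E.s0 - 1) (-E.tExponent) κ
  have deriv_majorized := ((hu κ hκ).X_pow_mul_derivative hR0 hσ (by omega) (by positivity)
    μ p.1.2).smul (((κ + 1 : ℕ) : ℂ) ^ p.1.1)
  rw [norm_pow, Complex.norm_natCast] at deriv_majorized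
  rw [shift, coeff_mk, coeff_tDt_iterate, coeff_Dx_iterate, mul_smul_comm]
  refine (deriv_majorized.mono_index hR0 hσ (show E.xIndexSlope * κ + 1 + p.1.2 ≤
    E.xIndexSlope * κ + (1 + E.maxAlpha) by omega) (by positivity)).mono_const hR0 ?_
  have index_le := E.xIndex_rpow_le κ p hε hεm
  have weight_le := pow_mul_rpow_mul_tWeight_le (τ := E.s0 - 1) hA p.1.1 κ (ε := ε)
    (e := -E.tExponent) (e' := e) (by linarith)
  set Q : ℝ := ((E.xIndexSlope : ℝ) + 1 + E.maxAlpha) ^ E.maxLoss with hQ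
  calc _ ≤ ((κ + 1 : ℕ) : ℝ) ^ p.1.1 * (D * tWeight A (E.s0 - 1) (-E.tExponent) κ *
        R ^ E.maxAlpha * (Q * ((κ : ℝ) + 1) ^ ε) * (R ^ μ)⁻¹) := by gcongr
    _ = D * (R ^ E.maxAlpha * Q) * (R ^ μ)⁻¹ * (((κ + 1 : ℕ) : ℝ) ^ p.1.1 *
        ((κ : ℝ) + 1) ^ ε * tWeight A (E.s0 - 1) (-E.tExponent) κ) := by ring
    _ ≤ _ := by
        rw [hQ, derivConst]
        gcongr

end

/-- The constant lost by each factor of a product of derivatives of `u`. -/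
noncomputable def factorConst (R D : ℝ) : ℝ :=
  convolutionConst E.tExponent * (D * E.derivConst R)

theorem one_le_factorConst {R D : ℝ} (hR : 1 ≤ R) (hD : 1 ≤ D) : 1 ≤ E.factorConst R D :=
  one_le_mul_of_one_le_of_one_le
    (one_le_convolutionConst (by linarith [E.two_le_tExponent]))
    (one_le_mul_of_one_le_of_one_le hD (E.one_le_derivConst hR))

theorem majorized_X_pow_mul_coeff_one {σ R A τ e : ℝ} (hσ : 1 ≤ σ) (hR : 0 < R) (hA : 0 ≤ A)
    {N : ℕ} (hN : 1 ≤ N) {b : ℝ} (hb : 1 ≤ b) (μ κ : ℕ) :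
    Majorized σ R N (b * (R ^ μ)⁻¹ * tWeight A τ e κ) (X ^ μ * coeff κ (1 : ℂ⟦X⟧⟦X⟧)) := by
  rw [coeff_one]
  split_ifs with hκ
  · intro l
    rw [mul_one, coeff_X_pow]
    split_ifs with hl
    · subst hκ hl
      have tWeight_zero : tWeight A τ e 0 = 1 := by simp [tWeight]
      rw [tWeight_zero, norm_one, mul_one, mul_assoc, inv_mul_cancel_left₀ (by positivity)]
      exact one_le_mul_of_one_le_of_one_le hb (one_le_xWeight hσ hN l)
    · rw [norm_zero]
      have := xWeight_nonneg σ N l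
      have := tWeight_nonneg hA τ e κ
      positivity
  · rw [mul_zero]
    have := tWeight_nonneg hA τ e κ
    exact Majorized.zero hR (by positivity)

section

variable {E} {R A D : ℝ} (hR : 1 ≤ R) (hD : 1 ≤ D) {κ r : ℕ} {u : ℂ⟦X⟧⟦X⟧}
include hR hD

theorem SolMajorized.coeff_shiftProd (hA : 0 ≤ A) (hu : E.SolMajorized R A D (κ + r) u) {i : ℕ}
    {ν : E.M → ℕ} {μ : ℕ} (hr : 1 ≤ r) (hνr : i + ∑ p, ν p = r + 1)
    (hg : coeff μ (E.g i ν) ≠ 0) :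
    Majorized E.sigma0 R (E.xIndexSlope * (κ + r) + 1) (E.factorConst R D ^ (2 * r) *
      (R ^ μ)⁻¹ * tWeight A (E.s0 - 1) (E.m + (E.s0 - 1) * r - E.tExponent) κ)
      (X ^ μ * coeff κ (E.shiftProd u ν)) := by
  have hσ := E.one_le_sigma0
  have hR0 : 0 < R := by linarith
  have hτ : 0 ≤ E.s0 - 1 := by linarith [E.one_le_s0]
  have hB := E.two_le_tExponent
  have hT := E.one_le_factorConst hR hD
  have : 0 ≤ E.factorConst R D := by linarith
  rcases Nat.eq_zero_or_pos (∑ p, ν p) with hν | hν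
  · have shiftProd_eq : E.shiftProd u ν = 1 := Finset.prod_eq_one fun p hp => by
      rw [Finset.sum_eq_zero_iff.1 hν p hp, pow_zero]
    rw [shiftProd_eq]
    exact majorized_X_pow_mul_coeff_one hσ hR0 hA (by omega) (one_le_pow₀ hT) μ κ
  · have exponent_nonneg : 0 ≤ (E.m : ℝ) + (E.s0 - 1) * r := by positivity
    have derivConst_nonneg : 0 ≤ D * E.derivConst R := by
      have := E.one_le_derivConst hR
      positivity
    have prod_majorized := TxMajorized.prod_pow hσ hR0 hA hτ (by linarith : 0 ≤ E.tExponent)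
      Finset.univ (e := E.m + (E.s0 - 1) * r - E.tExponent) (by linarith) hB derivConst_nonneg
      (fun p _ hp => ⟨hu.shift_tDt_Dx hR hA (by linarith) p μ (by
          linarith [E.loss_le hr hνr hg hp]),
        hu.shift_tDt_Dx hR hA (by linarith) p 0 (by
          have := E.loss_le_maxLoss p 0
          rw [tExponent]
          linarith)⟩) hν κ (by omega)
    have hw := tWeight_nonneg hA (E.s0 - 1) (E.m + (E.s0 - 1) * r - E.tExponent) κ
    have index_le : E.xIndexSlope * κ + (∑ p, ν p) * (1 + E.maxAlpha) ≤
        E.xIndexSlope * (κ + r) + 1 := by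
      have : (∑ p, ν p) * (1 + E.maxAlpha) ≤ 2 * r * (1 + E.maxAlpha) :=
        Nat.mul_le_mul_right _ (by omega)
      rw [xIndexSlope]
      nlinarith
    refine (prod_majorized.mono_index hR0 hσ index_le (by positivity)).mono_const hR0 ?_
    rw [← factorConst]
    gcongr
    omega

end

/-- The ratio of the geometric progression in `i + |ν|` that dominates the terms of the nonlinear
part, up to the factor `1 / A`. -/
noncomputable def termConst (R D : ℝ) : ℝ :=
  E.factorConst R D ^ 2 * (2 ^ E.tExponent * Real.exp 1 ^ (E.s0 - 1))

theorem termConst_nonneg (R D : ℝ) : 0 ≤ E.termConst R D := by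
  rw [termConst]
  positivity

/-- The weight `A^κ (κ+1)!^(s₀-1) (κ+1)^(m-B)` for the right-hand side of the recursion; the
factor `(κ+1)^m` is the gain from inverting the principal part. -/
noncomputable def rhsWeight (A : ℝ) (κ : ℕ) : ℝ :=
  ((κ : ℝ) + 1) ^ E.m * tWeight A (E.s0 - 1) (-E.tExponent) κ

theorem rhsWeight_nonneg {A : ℝ} (hA : 0 ≤ A) (κ : ℕ) : 0 ≤ E.rhsWeight A κ :=
  mul_nonneg (by positivity) (tWeight_nonneg hA _ _ κ)

theorem exists_summable_g : ∃ ρ : ℝ, 0 < ρ ∧ ρ ≤ 1 ∧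
    Summable fun q : (ℕ × (E.M → ℕ)) × ℕ =>
      ‖coeff q.2 (E.g q.1.1 q.1.2)‖ * ρ ^ (q.1.1 + (∑ p, q.1.2 p) + q.2) := by
  obtain ⟨r, hr, hs⟩ := E.g_conv
  have hρ : 0 < min r 1 := lt_min hr one_pos
  refine ⟨min r 1, hρ, min_le_right _ _, ?_⟩
  refine Summable.of_nonneg_of_le (fun q => by positivity) (fun q => ?_)
    ((Equiv.prodAssoc ℕ (E.M → ℕ) ℕ).summable_iff.2 hs)
  exact mul_le_mul_of_nonneg_left (pow_le_pow_left₀ hρ.le (min_le_left _ _) _) (norm_nonneg _)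

theorem div_pow_le_mul_pow {H A ρ : ℝ} (hH : 0 ≤ H) (hA : 0 < A) (hρ : 0 < ρ) (hρ1 : ρ ≤ 1)
    (hHA : H ≤ A * ρ ^ 2) {r : ℕ} (hr : 1 ≤ r) :
    (H / A) ^ r ≤ H / (A * ρ ^ 2) * ρ ^ (r + 1) :=
  calc (H / A) ^ r = (H / (A * ρ ^ 2)) ^ r * ρ ^ (2 * r) := by
        rw [pow_mul, ← mul_pow]
        congr 1
        field_simp
    _ ≤ _ := mul_le_mul (pow_le_of_le_one (by positivity) (div_le_one_of_le₀ hHA (by positivity))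
          (by omega)) (pow_le_pow_of_le_one hρ.le hρ1 (by omega)) (by positivity) (by positivity)

section

variable {E} {R A D ρ : ℝ} (hR : 1 ≤ R) (hA : 0 < A) (hD : 1 ≤ D) (hρ : 0 < ρ) (hρ1 : ρ ≤ 1)
  (hRρ : 1 ≤ R * ρ) (hAρ : E.termConst R D ≤ A * ρ ^ 2) {κ : ℕ} {u : ℂ⟦X⟧⟦X⟧}
include hR hA hD hρ hρ1 hRρ hAρ

theorem SolMajorized.norm_coeff_shiftProd_le {r : ℕ} (hu : E.SolMajorized R A D (κ + r) u) {i : ℕ}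
    {ν : E.M → ℕ} {μ l : ℕ} (hr : 1 ≤ r) (hνr : i + ∑ p, ν p = r + 1)
    (hg : coeff μ (E.g i ν) ≠ 0) (hμ : μ ≤ l) :
    ‖coeff (l - μ) (coeff κ (E.shiftProd u ν))‖ ≤ ρ ^ (r + 1 + μ) *
      (E.termConst R D / (A * ρ ^ 2) * E.rhsWeight A (κ + r) *
        (R ^ l * xWeight E.sigma0 (E.xIndexSlope * (κ + r) + 1) l)) := by
  have hτ : 0 ≤ E.s0 - 1 := by linarith [E.one_le_s0]
  have hT := E.one_le_factorConst hR hD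
  have hY := E.rhsWeight_nonneg hA.le (κ + r)
  have hW := xWeight_nonneg E.sigma0 (E.xIndexSlope * (κ + r) + 1) l
  have hw := tWeight_nonneg hA.le (E.s0 - 1) (E.m + (E.s0 - 1) * r - E.tExponent) κ
  have weight_le := tWeight_le_tWeight_add hA hτ
    (by linarith [E.two_le_tExponent] : 0 ≤ E.tExponent) E.m r κ
  have inv_pow_le : (R ^ μ)⁻¹ ≤ ρ ^ μ := by
    rw [inv_le_iff_one_le_mul₀' (by positivity), ← mul_pow]
    exact one_le_pow₀ hRρ
  have const_le : E.factorConst R D ^ (2 * r) * (R ^ μ)⁻¹ *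
      tWeight A (E.s0 - 1) (E.m + (E.s0 - 1) * r - E.tExponent) κ ≤
      ρ ^ (r + 1 + μ) * (E.termConst R D / (A * ρ ^ 2) * E.rhsWeight A (κ + r)) := by
    calc _ ≤ E.factorConst R D ^ (2 * r) * ρ ^ μ *
          ((2 ^ E.tExponent * Real.exp 1 ^ (E.s0 - 1) / A) ^ r * E.rhsWeight A (κ + r)) := by
          rw [rhsWeight]
          gcongr
      _ = (E.termConst R D / A) ^ r * (ρ ^ μ * E.rhsWeight A (κ + r)) := by
          rw [termConst, mul_div_assoc, mul_pow _ (_ / A), pow_mul]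
          ring
      _ ≤ E.termConst R D / (A * ρ ^ 2) * ρ ^ (r + 1) * (ρ ^ μ * E.rhsWeight A (κ + r)) := by
          gcongr
          exact div_pow_le_mul_pow (E.termConst_nonneg R D) hA hρ hρ1 hAρ hr
      _ = _ := by
          rw [pow_add ρ (r + 1) μ]
          ring
  have coeff_le := hu.coeff_shiftProd hR hD hA.le hr hνr hg l
  rw [coeff_X_pow_mul', if_pos hμ] at coeff_le
  refine coeff_le.trans ?_
  rw [← mul_assoc (ρ ^ (r + 1 + μ))]
  gcongr

theorem SolMajorized.norm_coeff_term_le (hu0 : coeff 0 u = 0) (hu : E.SolMajorized R A D κ u)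
    (i : ℕ) (ν : E.M → ℕ) (l : ℕ) :
    ‖coeff l (coeff (κ + 1) (E.term u i ν))‖ ≤
      (∑ μ ∈ Finset.range (l + 1), ‖coeff μ (E.g i ν)‖ * ρ ^ (i + (∑ p, ν p) + μ)) *
        (E.termConst R D / (A * ρ ^ 2) * E.rhsWeight A κ *
          (R ^ l * xWeight E.sigma0 (E.xIndexSlope * κ + 1) l)) := by
  have bound_nonneg : 0 ≤ (∑ μ ∈ Finset.range (l + 1),
      ‖coeff μ (E.g i ν)‖ * ρ ^ (i + (∑ p, ν p) + μ)) *
        (E.termConst R D / (A * ρ ^ 2) * E.rhsWeight A κ *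
          (R ^ l * xWeight E.sigma0 (E.xIndexSlope * κ + 1) l)) := by
    have := xWeight_nonneg E.sigma0 (E.xIndexSlope * κ + 1) l
    have := E.rhsWeight_nonneg hA.le κ
    have := E.termConst_nonneg R D
    positivity
  rw [E.coeff_term hu0]
  split_ifs with hk
  swap
  · rwa [map_zero, norm_zero]
  by_cases hlow : i + ∑ p, ν p < 2
  · rwa [E.g_low i ν hlow, zero_mul, map_zero, norm_zero, ← E.g_low i ν hlow]
  obtain ⟨r, hνr⟩ : ∃ r, i + ∑ p, ν p = r + 1 := ⟨i + ∑ p, ν p - 1, by omega⟩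
  obtain ⟨κ, rfl⟩ : ∃ κ', κ = κ' + r := ⟨κ - r, by omega⟩
  rw [hνr, Nat.add_sub_add_right, Nat.add_sub_cancel, coeff_mul,
    Finset.Nat.sum_antidiagonal_eq_sum_range_succ_mk, Finset.sum_mul]
  refine (norm_sum_le _ _).trans (Finset.sum_le_sum fun μ hμ => ?_)
  rw [norm_mul, mul_assoc]
  by_cases hg : coeff μ (E.g i ν) = 0
  · rw [hg, norm_zero, zero_mul, zero_mul]
  · exact mul_le_mul_of_nonneg_left (hu.norm_coeff_shiftProd_le hR hA hD hρ hρ1 hRρ hAρ (by omega)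
      hνr hg (Finset.mem_range_succ_iff.1 hμ)) (norm_nonneg _)

theorem SolMajorized.coeff_nonlin (hu0 : coeff 0 u = 0) (hu : E.SolMajorized R A D κ u)
    (hs : Summable fun q : (ℕ × (E.M → ℕ)) × ℕ =>
      ‖coeff q.2 (E.g q.1.1 q.1.2)‖ * ρ ^ (q.1.1 + (∑ p, q.1.2 p) + q.2)) :
    Majorized E.sigma0 R (E.xIndexSlope * κ + 1)
      ((∑' q : (ℕ × (E.M → ℕ)) × ℕ,
        ‖coeff q.2 (E.g q.1.1 q.1.2)‖ * ρ ^ (q.1.1 + (∑ p, q.1.2 p) + q.2)) *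
        (E.termConst R D / (A * ρ ^ 2) * E.rhsWeight A κ)) (coeff (κ + 1) (E.nonlin u)) := by
  intro l
  have hfin := E.support_term_finite u hu0 (κ + 1)
  have hT := E.termConst_nonneg R D
  have hY := E.rhsWeight_nonneg hA.le κ
  have hW := xWeight_nonneg E.sigma0 (E.xIndexSlope * κ + 1) l
  have sum_le_tsum := hs.sum_le_tsum (hfin.toFinset ×ˢ Finset.range (l + 1))
    fun _ _ => by positivity
  rw [nonlin, coeff_mk, finsum_eq_sum _ hfin, map_sum]
  refine (norm_sum_le _ _).trans ((Finset.sum_le_sum fun q _ =>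
    hu.norm_coeff_term_le hR hA hD hρ hρ1 hRρ hAρ hu0 q.1 q.2 l).trans ?_)
  rw [← Finset.sum_mul, ← Finset.sum_product', mul_assoc (tsum _)]
  gcongr ?_ * _

end

theorem majorized_coeff_succ_C_mul_X {R A b : ℝ} (hR : 0 < R) (hA : 0 ≤ A) (hb : 0 ≤ b)
    (ha : Majorized E.sigma0 R 1 b E.a) (κ : ℕ) :
    Majorized E.sigma0 R (E.xIndexSlope * κ + 1) (b * E.rhsWeight A κ)
      (coeff (κ + 1) (C E.a * X)) := by
  rw [coeff_succ_mul_X, coeff_C]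
  split_ifs with hκ
  · subst hκ
    have rhsWeight_zero : E.rhsWeight A 0 = 1 := by simp [rhsWeight, tWeight]
    rwa [rhsWeight_zero, mul_one, mul_zero, zero_add]
  · exact Majorized.zero hR (mul_nonneg hb (E.rhsWeight_nonneg hA κ))

variable {E} {u : ℂ⟦X⟧⟦X⟧}

/-! ### The upper bound -/

theorem SignCond.exists_solMajorized (hE : E.SignCond) (hu : E.IsFormalSolution u) :
    ∃ R A D : ℝ, 1 ≤ R ∧ 1 ≤ A ∧ 1 ≤ D ∧ ∀ K, E.SolMajorized R A D K u := by
  obtain ⟨hu0, hrec⟩ := E.isFormalSolution_iff.1 hu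
  obtain ⟨ρ, hρ, hρ1, hs⟩ := E.exists_summable_g
  obtain ⟨b, hb, ha⟩ := E.a_conv.exists_eventually_majorized E.one_le_sigma0
  obtain ⟨R, hlin, ha, hR, hRρ⟩ := (hE.eventually_majorized_of_recursion.and (ha.and
    ((eventually_ge_atTop 1).and (eventually_ge_atTop ρ⁻¹)))).exists
  have hR0 : 0 < R := by linarith
  rw [inv_le_iff_one_le_mul₀ hρ] at hRρ
  set S := ∑' q : (ℕ × (E.M → ℕ)) × ℕ,
      ‖coeff q.2 (E.g q.1.1 q.1.2)‖ * ρ ^ (q.1.1 + (∑ p, q.1.2 p) + q.2)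
  have hS : 0 ≤ S := tsum_nonneg fun _ => by positivity
  set D := max 1 (4 * b)
  have hD : 1 ≤ D := le_max_left _ _
  have hbD : 4 * b ≤ D := le_max_right _ _
  have hT := E.termConst_nonneg R D
  obtain ⟨A, hA, hTA⟩ := ((eventually_ge_atTop 1).and
    (eventually_ge_atTop (E.termConst R D * (1 + 4 * S) / ρ ^ 2))).exists
  rw [div_le_iff₀ (by positivity)] at hTA
  have hA0 : 0 < A := by linarith
  have hTA1 : E.termConst R D ≤ A * ρ ^ 2 := by nlinarith
  have hTS : S * (E.termConst R D / (A * ρ ^ 2)) ≤ 1 / 4 := by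
    rw [mul_div_assoc', div_le_div_iff₀ (by positivity) (by norm_num)]
    nlinarith
  refine ⟨R, A, D, hR, hA, hD, fun K κ _ => ?_⟩
  induction κ using Nat.strong_induction_on generalizing K with
  | _ κ ih =>
    have hw := tWeight_nonneg hA0.le (E.s0 - 1) (-E.tExponent) κ
    have hY := E.rhsWeight_nonneg hA0.le κ
    have rhs_majorized := (E.majorized_coeff_succ_C_mul_X hR0 hA0.le hb ha κ).add
      (SolMajorized.coeff_nonlin hR hA0 hD hρ hρ1 hRρ hTA1 hu0
        (fun κ' hκ' => ih κ' hκ' κ hκ') hs)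
    rw [← map_add, ← rhs] at rhs_majorized
    refine (hlin (κ + 1) (E.xIndexSlope * κ + 1) (by omega) (by omega)
      (D * tWeight A (E.s0 - 1) (-E.tExponent) κ / 2) (by positivity) _ _
      (hrec (κ + 1) (by omega)) (rhs_majorized.mono_const hR0 ?_)).mono_const hR0 (by linarith)
    calc _ = (b + S * (E.termConst R D / (A * ρ ^ 2))) * E.rhsWeight A κ := by ring
      _ ≤ D / 2 * E.rhsWeight A κ := by
          gcongr
          linarith
      _ = _ := by
          rw [rhsWeight]
          push_cast
          ring

theorem isGevrey_of_norm_le {s σ C Γ : ℝ} (hΓ : 0 < Γ)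
    (h : ∀ k l, ‖coeff l (coeff k u)‖ ≤
      C * Γ ^ (k + l) * ((k.factorial : ℝ) ^ (s - 1) * (l.factorial : ℝ) ^ (σ - 1))) :
    IsGevrey s σ u := by
  have geom : Summable fun q : ℕ × ℕ => C * ((1 / 2 : ℝ) ^ q.1 * (1 / 2 : ℝ) ^ q.2) :=
    (summable_geometric_two.mul_of_nonneg summable_geometric_two (fun _ => by positivity)
      fun _ => by positivity).mul_left C
  refine ⟨(2 * Γ)⁻¹, by positivity,
    Summable.of_nonneg_of_le (fun q => by positivity) (fun q => ?_) geom⟩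
  calc _ ≤ C * Γ ^ (q.1 + q.2) * (2 * Γ)⁻¹ ^ (q.1 + q.2) := by
        gcongr
        exact (div_le_iff₀ (by positivity)).2 (h q.1 q.2)
    _ = _ := by
        rw [← pow_add, inv_pow, mul_pow, one_div, inv_pow]
        field_simp

theorem xWeight_le {σ : ℝ} (hσ : 0 ≤ σ) {N : ℕ} (hN : 1 ≤ N) (l : ℕ) :
    xWeight σ N l ≤ ((2 : ℝ) ^ σ) ^ (N + l) * (l.factorial : ℝ) ^ (σ - 1) := by
  have ascFactorial_le : N.ascFactorial l ≤ 2 ^ (N + l) * l.factorial := by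
    obtain ⟨n, rfl⟩ := Nat.exists_eq_add_of_le' hN
    rw [Nat.ascFactorial_eq_factorial_mul_choose, mul_comm]
    exact Nat.mul_le_mul_right _
      ((Nat.choose_le_two_pow _ _).trans (Nat.pow_le_pow_right (by norm_num) (by omega)))
  rify at ascFactorial_le
  rw [xWeight, Real.rpow_sub_one (by positivity), mul_div_assoc', Real.rpow_pow_comm (by norm_num),
    ← Real.mul_rpow (by positivity) (by positivity)]
  gcongr

theorem SolMajorized.isGevrey {R A D s σ : ℝ} (hR : 1 ≤ R) (hA : 1 ≤ A) (hD : 0 ≤ D)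
    (hs : E.s0 ≤ s) (hσ : E.sigma0 ≤ σ) (hu0 : coeff 0 u = 0)
    (h : ∀ K, E.SolMajorized R A D K u) : IsGevrey s σ u := by
  have hσ0 : 0 ≤ E.sigma0 := by linarith [E.one_le_sigma0]
  set P : ℝ := (2 : ℝ) ^ E.sigma0
  have hP : 1 ≤ P := Real.one_le_rpow (by norm_num) hσ0
  have tWeight_le : ∀ κ, tWeight A (E.s0 - 1) (-E.tExponent) κ ≤
      A ^ κ * ((κ + 1).factorial : ℝ) ^ (s - 1) := fun κ => by
    have rpow_le_one : ((κ : ℝ) + 1) ^ (-E.tExponent) ≤ 1 :=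
      Real.rpow_le_one_of_one_le_of_nonpos (by simp) (by linarith [E.two_le_tExponent])
    have : (1 : ℝ) ≤ (κ + 1).factorial := by exact_mod_cast (κ + 1).factorial_pos
    rw [tWeight]
    refine (mul_le_of_le_one_right (by positivity) rpow_le_one).trans ?_
    gcongr
  have xWeight_le : ∀ κ l, xWeight E.sigma0 (E.xIndexSlope * κ + 1) l ≤
      P ^ ((E.xIndexSlope + 1) * (κ + 1 + l)) * (l.factorial : ℝ) ^ (σ - 1) := fun κ l => by
    have : (1 : ℝ) ≤ l.factorial := by exact_mod_cast l.factorial_pos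
    refine (Equation.xWeight_le hσ0 (by omega) l).trans ?_
    gcongr
    nlinarith [Nat.zero_le (E.xIndexSlope * l)]
  refine isGevrey_of_norm_le (C := D) (Γ := A * R * P ^ (E.xIndexSlope + 1)) (by positivity)
    fun k l => ?_
  cases k with
  | zero =>
    rw [hu0, map_zero, norm_zero]
    positivity
  | succ κ =>
    calc _ ≤ _ := h (κ + 1) κ κ.lt_succ_self l
      _ ≤ D * (A ^ (κ + 1 + l) * ((κ + 1).factorial : ℝ) ^ (s - 1)) * (R ^ (κ + 1 + l) *
          (P ^ ((E.xIndexSlope + 1) * (κ + 1 + l)) * (l.factorial : ℝ) ^ (σ - 1))) := by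
          have := xWeight_nonneg E.sigma0 (E.xIndexSlope * κ + 1) l
          gcongr
          · refine (tWeight_le κ).trans ?_
            gcongr
            omega
          · omega
          · exact xWeight_le κ l
      _ = _ := by
          rw [mul_pow, mul_pow, ← pow_mul]
          ring

theorem SignCond.isGevrey (hE : E.SignCond) (hu : E.IsFormalSolution u) {s σ : ℝ}
    (hs : E.s0 ≤ s) (hσ : E.sigma0 ≤ σ) : IsGevrey s σ u := by
  obtain ⟨R, A, D, hR, hA, hD, h⟩ := hE.exists_solMajorized hu
  exact SolMajorized.isGevrey hR hA (by linarith) hs hσ hu.1 h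

end Equation

/-! ### Lower bounds from single terms of the recursion -/

/-- The absolute value of the coefficient of `t^k x^l`. -/
noncomputable def coeffNorm (u : ℂ⟦X⟧⟦X⟧) (k l : ℕ) : ℝ :=
  ‖coeff l (coeff k u)‖

theorem coeffNorm_nonneg (u : ℂ⟦X⟧⟦X⟧) (k l : ℕ) : 0 ≤ coeffNorm u k l := norm_nonneg _

theorem norm_le_norm_of_nonneg_of_le {z w : ℂ} (hz : 0 ≤ z) (h : z ≤ w) : ‖z‖ ≤ ‖w‖ := by
  rwa [← Complex.real_le_real, Complex.norm_of_nonneg' hz,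
    Complex.norm_of_nonneg' (hz.trans h)]

theorem coeff_ne_zero_of_derivative_iterate {f : ℂ⟦X⟧} {μ : ℕ}
    (h : constantCoeff ((derivative ℂ)^[μ] f) ≠ 0) : coeff μ f ≠ 0 := by
  rw [constantCoeff_iterate_derivative] at h
  exact right_ne_zero_of_mul h

namespace Equation

/-- The lower bound for `v k l = |u_{k,l}|` provided by a single term of the recursion: a term
with the derivative `p = (j, α)`, a further factor `x^μ` and a further factor of degree `r` in `t`
transfers mass from `(k, l)` to `(k + r, l - α + μ)`. -/
def StepBound (E : Equation) (v : ℕ → ℕ → ℝ) (c : ℝ) (p : ℕ × ℕ) (r μ : ℕ) : Prop :=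
  ∀ k l k' l' : ℕ, 1 ≤ k → p.2 ≤ l → k' = k + r → l' + p.2 = l + μ →
    c * ((k : ℝ) ^ p.1 * (l.descFactorial p.2 : ℝ)) * v k l ≤ E.absIndicial k' l' * v k' l'

variable {E : Equation}

theorem one_le_of_coeff_add_single_ne_zero {i μ : ℕ} {ν : E.M → ℕ} {p : E.M}
    (hg : coeff μ (E.g i (ν + Pi.single p 1)) ≠ 0) : 1 ≤ i + ∑ q, ν q := by
  classical
  by_contra hlt
  refine hg ?_
  have sum_eq : ∑ q, (ν + Pi.single p 1 : E.M → ℕ) q = ∑ q, ν q + 1 := by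
    simp only [Pi.add_apply, Finset.sum_add_distrib, Finset.sum_pi_single', Finset.mem_univ,
      if_true]
  rw [E.g_low _ _ (by omega), map_zero]

theorem term_add_single (u : ℂ⟦X⟧⟦X⟧) (i : ℕ) (ν : E.M → ℕ) (p : E.M) :
    E.term u i (ν + Pi.single p 1) = C (E.g i (ν + Pi.single p 1)) * X ^ i *
      (tDt^[p.1.1] (Dx^[p.1.2] u) * ∏ q : E.M, (tDt^[q.1.1] (Dx^[q.1.2] u)) ^ ν q) := by
  rw [term, mul_comm (tDt^[_] _)]
  simp_rw [Pi.add_apply, pow_add, Finset.prod_mul_distrib]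
  congr 2
  rw [Finset.prod_eq_single p (fun q _ hq => by rw [Pi.single_eq_of_ne hq, pow_zero])
    fun hp => absurd (Finset.mem_univ p) hp, Pi.single_eq_same, pow_one]

namespace SignCond

variable (hE : E.SignCond) {u : ℂ⟦X⟧⟦X⟧}
include hE

theorem g_mem_nonneg (i : ℕ) (ν : E.M → ℕ) : SeriesNonneg (E.g i ν) := by
  by_cases h2 : i + ∑ p, ν p < 2
  · rw [E.g_low i ν h2]
    exact fun l => (map_zero (coeff l)).ge
  · exact hE.g_nonneg i ν (not_lt.1 h2)

theorem mul_prod_le_coeff_term (hu : u ∈ nonnegSeries) (i : ℕ) (ν : E.M → ℕ) (p : E.M)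
    (k l μ : ℕ) :
    coeff μ (E.g i (ν + Pi.single p 1)) * (coeff l (coeff k (tDt^[p.1.1] (Dx^[p.1.2] u))) *
        ∏ q : E.M, coeff 0 (coeff 1 (tDt^[q.1.1] (Dx^[q.1.2] u))) ^ ν q) ≤
      coeff (μ + l) (coeff (i + (k + ∑ q, ν q)) (E.term u i (ν + Pi.single p 1))) := by
  have hg := hE.g_mem_nonneg i (ν + Pi.single p 1)
  have deriv_mem := fun q : E.M => tDt_Dx_mem_nonnegSeries hu q.1.1 q.1.2
  have prod_mem : ∏ q : E.M, (tDt^[q.1.1] (Dx^[q.1.2] u)) ^ ν q ∈ nonnegSeries :=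
    prod_mem fun q _ => pow_mem (deriv_mem q) _
  have le_factors := coeff_mul_coeff_le (deriv_mem p) prod_mem k (∑ q, ν q) l 0
  have le_term := coeff_mul_coeff_le (mul_mem (C_mem_coeffSubsemiring hg)
    (pow_mem X_mem_coeffSubsemiring i)) (mul_mem (deriv_mem p) prod_mem) i (k + ∑ q, ν q) μ l
  rw [coeff_C_mul_X_pow, if_pos rfl] at le_term
  rw [term_add_single]
  refine le_trans (mul_le_mul_of_nonneg_left (le_trans ?_ le_factors) (hg μ)) le_term
  exact mul_le_mul_of_nonneg_left (prod_coeff_one_pow_le Finset.univ deriv_mem ν) (deriv_mem p k l)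

variable (hu : E.IsFormalSolution u)
include hu

theorem coeff_term_le_coeff_nonlin (i : ℕ) (ν : E.M → ℕ) (k l : ℕ) :
    coeff l (coeff k (E.term u i ν)) ≤ coeff l (coeff k (E.nonlin u)) := by
  have hnn := hE.mem_nonnegSeries_of_isFormalSolution hu
  by_cases h0 : coeff k (E.term u i ν) = 0
  · rw [h0, map_zero]
    exact hE.nonlin_mem_nonnegSeries hu.1 hnn k l
  · rw [nonlin, coeff_mk, finsum_eq_sum _ (E.support_term_finite u hu.1 k), map_sum]
    have term_nonneg : ∀ q : ℕ × (E.M → ℕ), 0 ≤ coeff l (coeff k (E.term u q.1 q.2)) :=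
      fun q => mem_nonnegSeries.1 (hE.term_mem_nonnegSeries hnn q.1 q.2) k l
    exact Finset.single_le_sum (a := (i, ν)) (fun q _ => term_nonneg q) (by
      rwa [Set.Finite.mem_toFinset])

theorem norm_le_absIndicial_mul_coeffNorm {k l : ℕ} (hk : 1 ≤ k) {z : ℂ} (hz : 0 ≤ z)
    (h : z ≤ ∑ l' ∈ Finset.range l, E.lowerCoeff k l l' * coeff l' (coeff k u) +
      coeff l (coeff k (E.rhs u))) : ‖z‖ ≤ E.absIndicial k l * coeffNorm u k l := by
  rw [← (isFormalSolution_iff.1 hu).2 k hk l] at h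
  refine (norm_le_norm_of_nonneg_of_le hz h).trans_eq ?_
  rw [norm_mul, hE.indicial_eq, Complex.norm_real, Real.norm_of_nonneg (absIndicial_pos hk l).le,
    coeffNorm]

theorem norm_le_of_le_coeff_rhs {k l : ℕ} (hk : 1 ≤ k) {z : ℂ} (hz : 0 ≤ z)
    (h : z ≤ coeff l (coeff k (E.rhs u))) : ‖z‖ ≤ E.absIndicial k l * coeffNorm u k l :=
  hE.norm_le_absIndicial_mul_coeffNorm hu hk hz <| h.trans <| le_add_of_nonneg_left <|
    Finset.sum_nonneg fun _ hl' => mul_nonneg (hE.lowerCoeff_nonneg (Finset.mem_range.1 hl'))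
      (hE.mem_nonnegSeries_of_isFormalSolution hu _ _)

theorem stepBound_of_mem_Lam1 {p : ℕ × ℕ} (hp : p ∈ E.Lam1) :
    E.StepBound (coeffNorm u) ‖coeff (E.ordC p) (E.c p)‖ p 0 (p.2 + E.ordC p) := by
  rintro k l k l' hk - rfl hl'
  obtain rfl : l' = l + E.ordC p := by omega
  have hord := one_le_ordC hp
  have hnn := hE.mem_nonnegSeries_of_isFormalSolution hu
  have summand_nonneg : ∀ q ∈ indexI E.m,
      0 ≤ coeff (E.ordC p) (E.c q) * ((k : ℂ) ^ q.1 * (l.descFactorial q.2 : ℂ)) := fun q hq =>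
    mul_nonneg (hE.coeff_c_nonneg hq (by omega))
      (mul_nonneg (pow_nonneg (Nat.cast_nonneg _) _) (Nat.cast_nonneg _))
  have le_lowerCoeff : coeff (E.ordC p) (E.c p) * ((k : ℂ) ^ p.1 * (l.descFactorial p.2 : ℂ)) ≤
      E.lowerCoeff k (l + E.ordC p) l := by
    rw [lowerCoeff, Nat.add_sub_cancel_left]
    exact Finset.single_le_sum summand_nonneg hp.1
  have le_sum : E.lowerCoeff k (l + E.ordC p) l * coeff l (coeff k u) ≤
      ∑ l' ∈ Finset.range (l + E.ordC p),
        E.lowerCoeff k (l + E.ordC p) l' * coeff l' (coeff k u) :=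
    Finset.single_le_sum (f := fun l' => E.lowerCoeff k (l + E.ordC p) l' * coeff l' (coeff k u))
      (fun l' hl' => mul_nonneg (hE.lowerCoeff_nonneg (Finset.mem_range.1 hl')) (hnn _ _))
      (Finset.mem_range.2 (by omega))
  have norm_le := hE.norm_le_absIndicial_mul_coeffNorm hu (l := l + E.ordC p) hk
    (mul_nonneg (summand_nonneg p hp.1) (hnn k l)) <| le_add_of_le_of_nonneg
      ((mul_le_mul_of_nonneg_right le_lowerCoeff (hnn k l)).trans le_sum)
      (hE.rhs_mem_nonnegSeries hu.1 hnn _ _)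
  simpa only [norm_mul, norm_pow, Complex.norm_natCast, coeffNorm] using norm_le

theorem coeffNorm_one_pos {l : ℕ} (ha : coeff l E.a ≠ 0) : 0 < coeffNorm u 1 l := by
  have le_rhs : coeff l E.a ≤ coeff l (coeff 1 (E.rhs u)) := by
    rw [rhs, map_add, map_add, ← zero_add 1, coeff_succ_mul_X, coeff_zero_C]
    exact le_add_of_nonneg_right
      (hE.nonlin_mem_nonnegSeries hu.1 (hE.mem_nonnegSeries_of_isFormalSolution hu) _ _)
  exact pos_of_mul_pos_right ((norm_pos_iff.2 ha).trans_le
    (hE.norm_le_of_le_coeff_rhs hu le_rfl (hE.a_nonneg l) le_rhs)) (absIndicial_pos le_rfl l).le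

theorem exists_stepBound_of_coeff_g_ne_zero (ha : ∀ μ ≤ E.maxAlpha, coeff μ E.a ≠ 0) {i : ℕ}
    {ν : E.M → ℕ} {p : E.M} {μ : ℕ} (hg : coeff μ (E.g i (ν + Pi.single p 1)) ≠ 0) :
    ∃ γ : ℝ, 0 < γ ∧ E.StepBound (coeffNorm u) γ p.1 (i + ∑ q, ν q) μ := by
  have hnn := hE.mem_nonnegSeries_of_isFormalSolution hu
  set π : ℂ := ∏ q : E.M, coeff 0 (coeff 1 (tDt^[q.1.1] (Dx^[q.1.2] u))) ^ ν q
  have π_nonneg : 0 ≤ π :=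
    Finset.prod_nonneg fun q _ => pow_nonneg (tDt_Dx_mem_nonnegSeries hnn _ _ 1 0) _
  have π_ne_zero : π ≠ 0 := by
    refine Finset.prod_ne_zero_iff.2 fun q _ => pow_ne_zero _ ?_
    rw [coeff_tDt_Dx, Nat.cast_one, one_pow, one_mul, zero_add]
    exact mul_ne_zero (Nat.cast_ne_zero.2 (Nat.descFactorial_pos.2 le_rfl).ne')
      (norm_pos_iff.1 (hE.coeffNorm_one_pos hu (ha _ (E.le_maxAlpha q))))
  refine ⟨‖coeff μ (E.g i (ν + Pi.single p 1)) * π‖, norm_pos_iff.2 (mul_ne_zero hg π_ne_zero),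
    ?_⟩
  rintro k l _ l' - hl rfl hl'
  obtain ⟨l, rfl⟩ := Nat.exists_eq_add_of_le' hl
  obtain rfl : l' = μ + l := by omega
  have hr := one_le_of_coeff_add_single_ne_zero hg
  have aX_mem : C E.a * X ∈ nonnegSeries :=
    mul_mem (C_mem_coeffSubsemiring hE.a_nonneg) X_mem_coeffSubsemiring
  have le_term := hE.mul_prod_le_coeff_term hnn i ν p k l μ
  rw [← add_assoc i, add_comm i, add_assoc] at le_term
  have norm_le := hE.norm_le_of_le_coeff_rhs hu (k := k + (i + ∑ q, ν q)) (l := μ + l) (by omega)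
    (mul_nonneg (hE.g_mem_nonneg _ _ μ)
      (mul_nonneg (tDt_Dx_mem_nonnegSeries hnn p.1.1 p.1.2 k l) π_nonneg))
    (by
      rw [rhs, map_add, map_add]
      exact le_add_of_nonneg_of_le (aX_mem _ _)
        (le_term.trans (hE.coeff_term_le_coeff_nonlin hu i _ _ _)))
  refine le_of_eq_of_le ?_ norm_le
  simp only [coeff_tDt_Dx, norm_mul, norm_pow, Complex.norm_natCast, coeffNorm]
  ring

end SignCond

end Equation

/-! ### Growth of `|u_{k,l}|` near the axis `k = 0` -/

theorem eventually_le_mul (c : ℝ) {ε : ℝ} (hε : 0 < ε) : ∀ᶠ T : ℕ in atTop, c ≤ ε * T :=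
  (tendsto_natCast_atTop_atTop.const_mul_atTop hε).eventually_ge_atTop c

theorem eventually_le_mul_log (c : ℝ) {ε : ℝ} (hε : 0 < ε) :
    ∀ᶠ T : ℕ in atTop, c ≤ ε * Real.log T :=
  ((Real.tendsto_log_atTop.comp tendsto_natCast_atTop_atTop).const_mul_atTop hε).eventually_ge_atTop
    c

theorem eventually_le_rpow (c : ℝ) {ε : ℝ} (hε : 0 < ε) :
    ∀ᶠ T : ℕ in atTop, c ≤ (T : ℝ) ^ ε :=
  ((tendsto_rpow_atTop hε).comp tendsto_natCast_atTop_atTop).eventually_ge_atTop c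

theorem eventually_mul_rpow_le (c : ℝ) {θ ε : ℝ} (hθ : θ < 1) (hε : 0 < ε) :
    ∀ᶠ T : ℕ in atTop, c * (T : ℝ) ^ θ ≤ ε * T := by
  filter_upwards [eventually_le_rpow (c / ε) (sub_pos.2 hθ), eventually_ge_atTop 1] with T hT hT1
  have hT0 : (0 : ℝ) < T := by exact_mod_cast hT1
  rw [Real.rpow_sub hT0, Real.rpow_one, div_le_iff₀ hε] at hT
  calc c * (T : ℝ) ^ θ ≤ T / (T : ℝ) ^ θ * ε * (T : ℝ) ^ θ := by gcongr
    _ = ε * T := by field_simp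

theorem exp_mul_trans {q₁ q₂ x y z : ℝ} (h₁ : Real.exp q₁ * x ≤ y) (h₂ : Real.exp q₂ * y ≤ z) :
    Real.exp (q₁ + q₂) * x ≤ z := by
  rw [add_comm, Real.exp_add, mul_assoc]
  exact (mul_le_mul_of_nonneg_left h₁ (Real.exp_pos _).le).trans h₂

theorem exp_mul_log {x : ℝ} (hx : 0 < x) (y : ℝ) : Real.exp (y * Real.log x) = x ^ y := by
  rw [mul_comm, Real.exp_mul, Real.exp_log hx]

theorem exists_nat_mul_mem_Icc {h : ℕ} (hh : 1 ≤ h) {z : ℝ} (hz : 0 ≤ z) :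
    ∃ n : ℕ, (n : ℝ) * h ∈ Set.Icc z (z + h) := by
  have hh0 : (0 : ℝ) < h := by exact_mod_cast hh
  refine ⟨⌈z / h⌉₊, (div_le_iff₀ hh0).1 (Nat.le_ceil _), ?_⟩
  rw [← le_div_iff₀ hh0, add_div, div_self hh0.ne']
  exact (Nat.ceil_lt_add_one (by positivity)).le

/-- `v` takes values of size `exp (ρ l log l)`, up to an arbitrarily small change of the exponent,
at points `(k, l)` with `k = o(l)`; here `l` is close to the prescribed number `T`. -/
def AxisGrowth (v : ℕ → ℕ → ℝ) (ρ : ℝ) : Prop :=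
  ∀ ε : ℝ, 0 < ε → ∀ᶠ T : ℕ in atTop, ∃ k l : ℕ, 1 ≤ k ∧ (k : ℝ) ≤ ε * T ∧ (T : ℝ) ≤ l ∧
    (l : ℝ) ≤ (1 + ε) * T ∧ Real.exp ((ρ - ε) * (T * Real.log T)) ≤ v k l

theorem AxisGrowth.of_eventually {v : ℕ → ℕ → ℝ} {ρ K : ℝ}
    (h : ∀ᶠ η : ℝ in 𝓝[>] 0, ∀ᶠ T : ℕ in atTop, ∃ k l : ℕ, 1 ≤ k ∧ (k : ℝ) ≤ η * T ∧ (T : ℝ) ≤ l ∧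
      (l : ℝ) ≤ (1 + η) * T ∧ Real.exp ((ρ - η * K) * (T * Real.log T)) ≤ v k l) :
    AxisGrowth v ρ := by
  intro ε hε
  have η_le : ∀ᶠ η : ℝ in 𝓝[>] 0, η ≤ ε := eventually_nhdsWithin_of_eventually_nhds (ge_mem_nhds hε)
  have ηK_le : ∀ᶠ η : ℝ in 𝓝[>] 0, η * K ≤ ε :=
    eventually_nhdsWithin_of_eventually_nhds <|
      (continuous_id.mul continuous_const).tendsto' 0 0 (zero_mul K) |>.eventually_le_const hε
  obtain ⟨η, hη, hηε, hηK⟩ := (h.and (η_le.and ηK_le)).exists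
  filter_upwards [hη] with T ⟨k, l, hk, hkT, hTl, hlT, hv⟩
  have := Real.log_natCast_nonneg T
  exact ⟨k, l, hk, hkT.trans (by gcongr), hTl, hlT.trans (by gcongr), le_trans (by gcongr) hv⟩

theorem AxisGrowth.of_forall_lt {v : ℕ → ℕ → ℝ} {ρ : ℝ} (hρ : 0 < ρ)
    (h : ∀ ρ' < ρ, 0 < ρ' → AxisGrowth v ρ') : AxisGrowth v ρ := by
  refine of_eventually (K := 2) ?_
  filter_upwards [Ioo_mem_nhdsGT hρ] with η hη
  convert h (ρ - η) (by linarith [hη.1]) (by linarith [hη.2]) η hη.1 using 12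
  ring

namespace Equation

variable {E : Equation} {v : ℕ → ℕ → ℝ} {p : ℕ × ℕ} {r μ : ℕ} {c : ℝ}

theorem StepBound.exp_mul_le (hS : E.StepBound v c p r μ) (hv : ∀ k l, 0 ≤ v k l) (hc : 0 < c)
    {n k : ℕ} {L : ℕ → ℕ} (hk : 1 ≤ k)
    (hL : ∀ t < n, p.2 ≤ L t ∧ L (t + 1) + p.2 = L t + μ) {q B x y : ℝ} (hx : 0 ≤ x) (hxk : x ≤ k)
    (hy : 0 ≤ y) (hyL : ∀ t < n, y ≤ L t)
    (hB : ∀ t < n, E.absIndicial (k + (t + 1) * r) (L (t + 1)) ≤ B)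
    (hq : Real.exp q * (B * ((p.2 : ℝ) + 1) ^ p.2) ≤ c * (x ^ p.1 * y ^ p.2)) :
    Real.exp (n * q) * v k (L 0) ≤ v (k + n * r) (L n) := by
  have step : ∀ t < n, Real.exp q * v (k + t * r) (L t) ≤ v (k + (t + 1) * r) (L (t + 1)) := by
    intro t ht
    obtain ⟨hpL, hLt⟩ := hL t ht
    have y_pow_le : y ^ p.2 ≤ ((p.2 : ℝ) + 1) ^ p.2 * (L t).descFactorial p.2 :=
      (pow_le_pow_left₀ hy (hyL t ht) _).trans (by exact_mod_cast pow_le_mul_descFactorial hpL)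
    have x_le : x ≤ (k + t * r : ℕ) := hxk.trans (by exact_mod_cast Nat.le_add_right _ _)
    have factor_le : Real.exp q * B ≤
        c * (((k + t * r : ℕ) : ℝ) ^ p.1 * (L t).descFactorial p.2) := by
      refine le_of_mul_le_mul_right ?_ (by positivity : 0 < ((p.2 : ℝ) + 1) ^ p.2)
      calc Real.exp q * B * ((p.2 : ℝ) + 1) ^ p.2
          ≤ c * (x ^ p.1 * y ^ p.2) := by rwa [mul_assoc]
        _ ≤ c * (((k + t * r : ℕ) : ℝ) ^ p.1 *
              (((p.2 : ℝ) + 1) ^ p.2 * (L t).descFactorial p.2)) := by gcongr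
        _ = _ := by ring
    refine le_of_mul_le_mul_left ?_
      (E.absIndicial_pos (k := k + (t + 1) * r) (by omega) (L (t + 1)))
    calc E.absIndicial (k + (t + 1) * r) (L (t + 1)) * (Real.exp q * v (k + t * r) (L t))
        ≤ B * (Real.exp q * v (k + t * r) (L t)) := by
          have := hv (k + t * r) (L t)
          gcongr
          exact hB t ht
      _ = Real.exp q * B * v (k + t * r) (L t) := by ring
      _ ≤ c * (((k + t * r : ℕ) : ℝ) ^ p.1 * (L t).descFactorial p.2) * v (k + t * r) (L t) :=
          mul_le_mul_of_nonneg_right factor_le (hv _ _)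
      _ ≤ _ := hS _ _ _ _ (by omega) hpL (by ring) hLt
  have := geom_le (u := fun t => v (k + t * r) (L t)) (Real.exp_pos q).le n step
  rwa [← Real.exp_nat_mul, zero_mul, add_zero] at this

theorem StepBound.eventually_crude (hS : E.StepBound v c p r μ) (hv : ∀ k l, 0 ≤ v k l)
    (hc : 0 < c) {b : ℝ} (hb : 0 ≤ b) :
    ∀ᶠ T : ℕ in atTop, ∀ (n k : ℕ) (L : ℕ → ℕ), 1 ≤ k →
      (∀ t < n, 1 ≤ L t ∧ p.2 ≤ L t ∧ L (t + 1) + p.2 = L t + μ) →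
      (∀ t < n, ((k + (t + 1) * r : ℕ) : ℝ) + L (t + 1) ≤ b * T) →
      Real.exp (n * (-(E.m + 1) * Real.log T)) * v k (L 0) ≤ v (k + n * r) (L n) := by
  filter_upwards [eventually_ge_atTop 1,
    eventually_le_mul (E.indicialConst * b ^ E.m * ((p.2 : ℝ) + 1) ^ p.2 / c) one_pos]
    with T hT hTc n k L hk hL hLT
  have hT0 : (0 : ℝ) < T := by exact_mod_cast hT
  have hI := zero_le_one.trans E.one_le_indicialConst
  have hbm : 0 ≤ b ^ E.m := pow_nonneg hb _
  have absIndicial_le : ∀ t < n, E.absIndicial (k + (t + 1) * r) (L (t + 1)) ≤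
      E.indicialConst * (b * T) ^ E.m := fun t ht =>
    (absIndicial_le_pow (by omega) _).trans <| by
      gcongr
      exact hLT t ht
  refine hS.exp_mul_le hv hc hk (fun t ht => (hL t ht).2) zero_le_one (by exact_mod_cast hk)
    zero_le_one (fun t ht => by exact_mod_cast (hL t ht).1) absIndicial_le ?_
  rw [one_mul, div_le_iff₀ hc] at hTc
  have exp_eq : Real.exp (-(E.m + 1) * Real.log T) = ((T : ℝ) ^ E.m * T)⁻¹ := by
    rw [neg_mul, Real.exp_neg, ← pow_succ, ← Real.rpow_natCast, ← exp_mul_log hT0]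
    push_cast
    rfl
  rw [exp_eq, inv_mul_le_iff₀ (by positivity), one_pow, one_pow, mul_one, mul_one, mul_pow]
  calc E.indicialConst * (b ^ E.m * (T : ℝ) ^ E.m) * ((p.2 : ℝ) + 1) ^ p.2
      = (T : ℝ) ^ E.m * (E.indicialConst * b ^ E.m * ((p.2 : ℝ) + 1) ^ p.2) := by ring
    _ ≤ (T : ℝ) ^ E.m * (T * c) := by gcongr
    _ = _ := by ring

theorem StepBound.eventually_ascent {h : ℕ} (hS : E.StepBound v c p 0 (p.2 + h))
    (hv : ∀ k l, 0 ≤ v k l) (hc : 0 < c) {b η θ y : ℝ} (hb : 1 ≤ b) (hη : 0 < η)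
    (hslope : ∀ q ∈ E.Lam0, θ * q.1 + q.2 ≤ θ * p.1 + p.2 - y) :
    ∀ᶠ T : ℕ in atTop, ∀ n k l : ℕ, (T : ℝ) ^ θ ≤ k → (k : ℝ) ≤ b * (T : ℝ) ^ θ → η * T ≤ l →
      ((l + n * h : ℕ) : ℝ) ≤ b * T →
      Real.exp (n * ((y - η) * Real.log T)) * v k l ≤ v k (l + n * h) := by
  filter_upwards [eventually_ge_atTop 1, eventually_le_mul (p.2 : ℝ) hη, eventually_le_rpow
    (E.indicialConst * b ^ E.m * ((p.2 : ℝ) + 1) ^ p.2 / (c * η ^ p.2)) hη]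
    with T hT hpT hTη n k l hθk hkθ hηl hlT
  have hT1 : (1 : ℝ) ≤ T := by exact_mod_cast hT
  have hT0 : (0 : ℝ) < T := by linarith
  have hk : 1 ≤ k := by exact_mod_cast (Real.rpow_pos_of_pos hT0 θ).trans_le hθk
  have hpl : p.2 ≤ l := by exact_mod_cast hpT.trans hηl
  have absIndicial_le : ∀ t < n, E.absIndicial (k + (t + 1) * 0) (l + (t + 1) * h) ≤
      E.indicialConst * (b ^ E.m * (T : ℝ) ^ (θ * p.1 + p.2 - y)) := by
    intro t ht
    refine absIndicial_le_rpow hb hT1 hslope (by simpa using hkθ) (le_trans ?_ hlT)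
    have : (t + 1) * h ≤ n * h := Nat.mul_le_mul_right _ ht
    exact_mod_cast Nat.add_le_add_left this l
  have factor_le : Real.exp ((y - η) * Real.log T) * (E.indicialConst *
      (b ^ E.m * (T : ℝ) ^ (θ * p.1 + p.2 - y)) * ((p.2 : ℝ) + 1) ^ p.2) ≤
      c * (((T : ℝ) ^ θ) ^ p.1 * (η * T) ^ p.2) := by
    have rpow_split : ((T : ℝ) ^ θ) ^ p.1 * (T : ℝ) ^ p.2 =
        (T : ℝ) ^ (y - η) * (T : ℝ) ^ (θ * p.1 + p.2 - y) * (T : ℝ) ^ η := by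
      rw [← Real.rpow_add hT0, ← Real.rpow_add hT0, ← Real.rpow_natCast, ← Real.rpow_natCast,
        ← Real.rpow_mul hT0.le, ← Real.rpow_add hT0]
      ring_nf
    rw [div_le_iff₀ (by positivity)] at hTη
    calc _ = (T : ℝ) ^ (y - η) * (T : ℝ) ^ (θ * p.1 + p.2 - y) *
          (E.indicialConst * b ^ E.m * ((p.2 : ℝ) + 1) ^ p.2) := by rw [exp_mul_log hT0]; ring
      _ ≤ (T : ℝ) ^ (y - η) * (T : ℝ) ^ (θ * p.1 + p.2 - y) *
          ((T : ℝ) ^ η * (c * η ^ p.2)) := by gcongr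
      _ = ((T : ℝ) ^ θ) ^ p.1 * (T : ℝ) ^ p.2 * (c * η ^ p.2) := by rw [rpow_split]; ring
      _ = _ := by rw [mul_pow]; ring
  simpa using hS.exp_mul_le hv hc hk (L := fun t => l + t * h)
    (fun t _ => ⟨hpl.trans (Nat.le_add_right _ _), by ring⟩) (by positivity) hθk
    (by positivity) (fun t _ => hηl.trans (by exact_mod_cast Nat.le_add_right _ _))
    absIndicial_le factor_le

/-- `p₀.2` linear steps restore the exponent of `x` that the nonlinear step consumes, so that
the pair of moves can be repeated indefinitely. -/
theorem StepBound.eventually_block {h : ℕ} (hS : E.StepBound v c p 0 (p.2 + h)) {γ : ℝ}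
    {p₀ : ℕ × ℕ} (hN : E.StepBound v γ p₀ r μ) (hv : ∀ k l, 0 ≤ v k l) (hc : 0 < c) (hγ : 0 < γ)
    (hh : 1 ≤ h) (hp : p.2 ≤ E.m) :
    ∀ᶠ T : ℕ in atTop, ∀ k l : ℕ, 1 ≤ k → E.m ≤ l → k + l ≤ T →
      Real.exp (-((p₀.2 + 1) * (E.m + 1) * Real.log T)) * v k l ≤
        v (k + r) (l + (p₀.2 * (h - 1) + μ)) := by
  have hb : (0 : ℝ) ≤ (1 + p₀.2 * h + r + μ : ℕ) := Nat.cast_nonneg _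
  filter_upwards [hS.eventually_crude hv hc hb, hN.eventually_crude hv hγ hb,
    eventually_ge_atTop 1] with T linear nonlinear hT k l hk hl hkl
  have hm := E.m_pos
  have scale_le : ∀ x ≤ T + p₀.2 * h + r + μ, (x : ℝ) ≤ (1 + p₀.2 * h + r + μ : ℕ) * T := by
    intro x hx
    exact_mod_cast hx.trans (by linarith [Nat.mul_le_mul_left (p₀.2 * h + r + μ) hT])
  have hlinear := linear p₀.2 k (fun t => l + t * h) hk
    (fun t _ => ⟨by omega, by omega, by ring⟩) fun t ht => by
      have : (t + 1) * h ≤ p₀.2 * h := Nat.mul_le_mul_right _ ht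
      exact_mod_cast scale_le _ (by omega : k + (t + 1) * 0 + (l + (t + 1) * h) ≤ _)
  have hp₀h : p₀.2 ≤ p₀.2 * h := Nat.le_mul_of_pos_right _ hh
  have hδ : l + (p₀.2 * (h - 1) + μ) = l + p₀.2 * h - p₀.2 + μ := by
    rw [Nat.mul_sub_one]
    omega
  have hnonlinear := nonlinear 1 k (fun t => if t = 0 then l + p₀.2 * h else
      l + (p₀.2 * (h - 1) + μ)) hk
    (fun t ht => by
      obtain rfl : t = 0 := by omega
      simp only [if_true, one_ne_zero, if_false, zero_add]
      omega)
    fun t ht => by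
      obtain rfl : t = 0 := by omega
      simp only [zero_add, one_ne_zero, if_false]
      exact_mod_cast scale_le _ (by omega)
  simp only [zero_mul, add_zero, mul_zero, if_true, one_ne_zero, if_false, one_mul]
    at hlinear hnonlinear
  convert exp_mul_trans hlinear hnonlinear using 2
  push_cast
  ring_nf

theorem StepBound.eventually_blocks {h : ℕ} (hS : E.StepBound v c p 0 (p.2 + h)) {γ : ℝ}
    {p₀ : ℕ × ℕ} (hN : E.StepBound v γ p₀ r μ) (hv : ∀ k l, 0 ≤ v k l) (hc : 0 < c) (hγ : 0 < γ)
    (hh : 1 ≤ h) (hp : p.2 ≤ E.m) :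
    ∀ᶠ T : ℕ in atTop, ∀ n k l : ℕ, 1 ≤ k → E.m ≤ l →
      k + n * r + (l + n * (p₀.2 * (h - 1) + μ)) ≤ T →
      Real.exp (-(n * ((p₀.2 + 1) * (E.m + 1) * Real.log T))) * v k l ≤
        v (k + n * r) (l + n * (p₀.2 * (h - 1) + μ)) := by
  filter_upwards [hS.eventually_block hN hv hc hγ hh hp] with T block n k l hk hl hT
  set δ := p₀.2 * (h - 1) + μ
  have := geom_le (u := fun t => v (k + t * r) (l + t * δ))
    (Real.exp_pos (-((p₀.2 + 1) * (E.m + 1) * Real.log T))).le n fun t ht => by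
      have ht_r : t * r ≤ n * r := Nat.mul_le_mul_right _ ht.le
      have ht_δ : t * δ ≤ n * δ := Nat.mul_le_mul_right _ ht.le
      convert block (k + t * r) (l + t * δ) (by omega) (by omega) (by omega) using 2 <;> ring
  rwa [zero_mul, zero_mul, add_zero, add_zero, ← Real.exp_nat_mul, mul_neg] at this

theorem StepBound.exists_near_axis {h : ℕ} (hS : E.StepBound v c p 0 (p.2 + h)) {γ : ℝ}
    {p₀ : ℕ × ℕ} (hN : E.StepBound v γ p₀ r μ) (hv : ∀ k l, 0 ≤ v k l) (hc : 0 < c) (hγ : 0 < γ)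
    (hh : 1 ≤ h) (hp : p.2 ≤ E.m) (hr : 1 ≤ r) (hv₀ : 0 < v 1 E.m) {θ : ℝ} (hθ0 : 0 ≤ θ)
    (hθ1 : θ < 1) :
    ∃ b : ℝ, 1 ≤ b ∧ ∀ η : ℝ, 0 < η → ∀ᶠ T : ℕ in atTop, ∃ k l : ℕ, (T : ℝ) ^ θ ≤ k ∧
      (k : ℝ) ≤ b * (T : ℝ) ^ θ ∧ E.m ≤ l ∧ (l : ℝ) ≤ η * T ∧
      Real.exp (-(η * (T * Real.log T))) ≤ v k l := by
  set δ := p₀.2 * (h - 1) + μ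
  set a : ℝ := (p₀.2 + 1) * (E.m + 1)
  refine ⟨1 + 2 * r, by simp, fun η hη => ?_⟩
  filter_upwards [hS.eventually_blocks hN hv hc hγ hh hp, eventually_ge_atTop 1,
    eventually_mul_rpow_le (1 + 2 * r + E.m + 2 * δ) hθ1 (lt_min one_pos hη),
    eventually_mul_rpow_le (2 * a) hθ1 (half_pos hη),
    eventually_le_mul (-Real.log (v 1 E.m)) (half_pos hη), eventually_le_mul_log 1 one_pos]
    with T blocks hT hsize hcost hv₀T hlog
  have hX : 1 ≤ (T : ℝ) ^ θ := Real.one_le_rpow (by exact_mod_cast hT) hθ0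
  set X := (T : ℝ) ^ θ
  set n := ⌈X⌉₊
  have X_le : X ≤ n := Nat.le_ceil _
  have n_le : (n : ℝ) ≤ 2 * X := by
    linarith [Nat.ceil_lt_add_one (by linarith : 0 ≤ X)]
  have hr' : (1 : ℝ) ≤ r := by exact_mod_cast hr
  have k_le : (1 + n * r : ℝ) ≤ (1 + 2 * r) * X := by nlinarith
  have l_le : (E.m + n * δ : ℝ) ≤ (E.m + 2 * δ) * X := by
    nlinarith [(Nat.cast_nonneg δ : (0 : ℝ) ≤ δ), (Nat.cast_nonneg E.m : (0 : ℝ) ≤ E.m)]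
  have kl_le : 1 + n * r + (E.m + n * δ) ≤ T := by
    have : min 1 η * T ≤ 1 * T := by gcongr; exact min_le_left _ _
    rify
    linarith
  refine ⟨1 + n * r, E.m + n * δ, ?_, by exact_mod_cast k_le, by omega, ?_, ?_⟩
  · push_cast
    nlinarith
  · have : min 1 η * T ≤ η * T := by gcongr; exact min_le_right _ _
    push_cast
    nlinarith
  · refine le_trans ?_ (blocks n 1 E.m le_rfl le_rfl kl_le)
    clear_value n
    rw [← Real.exp_log hv₀, ← Real.exp_add, Real.exp_le_exp]
    have blocks_cost : n * (a * Real.log T) ≤ η / 2 * T * Real.log T := by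
      have : n * a ≤ η / 2 * T := le_trans (by gcongr) ((mul_right_comm 2 a X).symm.trans_le hcost)
      rw [← mul_assoc]
      gcongr
    have start_cost : -Real.log (v 1 E.m) ≤ η / 2 * T * Real.log T :=
      hv₀T.trans (le_mul_of_one_le_right (by positivity) (by linarith))
    linarith

theorem le_mul_of_sub_mul_le {h T y η n : ℝ} (hh : 1 ≤ h) (hT : 0 ≤ T) (hη : 0 ≤ η) (hηy : η ≤ y)
    (hn : (1 - 3 * η) * T ≤ n * h) : (y / h - η * (1 + 3 * y)) * T ≤ n * (y - η) := by
  have loss_le : η * (1 + 3 * y) * T / h ≤ η * (1 + 3 * y) * T :=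
    div_le_self (by have := hη.trans hηy; positivity) hh
  calc (y / h - η * (1 + 3 * y)) * T
      ≤ y / h * T - η * (1 + 3 * y) * T / h := by linarith
    _ = (y - η * (1 + 3 * y)) * T / h := by ring
    _ ≤ (1 - 3 * η) * (y - η) * T / h := by
        gcongr
        nlinarith
    _ = (1 - 3 * η) * T / h * (y - η) := by ring
    _ ≤ n * (y - η) :=
        mul_le_mul_of_nonneg_right ((div_le_iff₀ (by linarith)).2 hn) (by linarith)

theorem StepBound.axisGrowth {h : ℕ} (hS : E.StepBound v c p 0 (p.2 + h)) {γ : ℝ}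
    {p₀ : ℕ × ℕ} (hN : E.StepBound v γ p₀ r μ) (hv : ∀ k l, 0 ≤ v k l) (hc : 0 < c) (hγ : 0 < γ)
    (hh : 1 ≤ h) (hp : p.2 ≤ E.m) (hr : 1 ≤ r) (hv₀ : 0 < v 1 E.m) {θ y : ℝ} (hθ0 : 0 ≤ θ)
    (hθ1 : θ < 1) (hy : 0 < y) (hslope : ∀ q ∈ E.Lam0, θ * q.1 + q.2 ≤ θ * p.1 + p.2 - y) :
    AxisGrowth v (y / h) := by
  obtain ⟨b, hb, near_axis⟩ := hS.exists_near_axis hN hv hc hγ hh hp hr hv₀ hθ0 hθ1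
  refine AxisGrowth.of_eventually (K := 1 + 2 * (E.m + 1) + (1 + 3 * y)) ?_
  filter_upwards [Ioo_mem_nhdsGT (by norm_num : (0 : ℝ) < 1 / 4), Ioo_mem_nhdsGT hy]
    with η ⟨hη, hη4⟩ ⟨_, hηy⟩
  filter_upwards [near_axis η hη, eventually_ge_atTop 1,
    hS.eventually_crude hv hc zero_le_one,
    hS.eventually_ascent hv hc (b := 2 + b) (by linarith) hη hslope,
    eventually_mul_rpow_le b hθ1 hη, eventually_le_mul (h : ℝ) hη]
    with T ⟨k, l₀, hXk, hkX, hml₀, hl₀T, hv_l₀⟩ hT crude ascent hbX hhT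
  have hT0 : (0 : ℝ) < T := by exact_mod_cast hT
  have := Real.log_natCast_nonneg T
  have hX := Real.rpow_pos_of_pos hT0 θ
  have hk : 1 ≤ k := by exact_mod_cast hX.trans_le hXk
  have hm := E.m_pos
  have hηT : η * T ≤ 1 / 4 * T := by gcongr
  obtain ⟨n₁, hn₁T, hTn₁⟩ := exists_nat_mul_mem_Icc hh (by positivity : 0 ≤ η * T)
  set l₁ := l₀ + n₁ * h
  have l₁_eq : (l₁ : ℝ) = l₀ + n₁ * h := by push_cast [l₁]; rfl
  have ηT_le_l₁ : η * T ≤ l₁ := by linarith [(Nat.cast_nonneg l₀ : (0 : ℝ) ≤ l₀)]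
  obtain ⟨n₂, hn₂T, hTn₂⟩ := exists_nat_mul_mem_Icc hh (by linarith : 0 ≤ (T : ℝ) - l₁)
  have l₂_eq : ((l₁ + n₂ * h : ℕ) : ℝ) = l₁ + n₂ * h := by push_cast; rfl
  have hcrude : Real.exp (n₁ * (-(E.m + 1) * Real.log T)) * v k l₀ ≤ v k l₁ := by
    simpa using crude n₁ k (fun t => l₀ + t * h) hk
      (fun t _ => ⟨by omega, by omega, by ring⟩) fun t ht => by
        have : (t + 1) * h ≤ n₁ * h := Nat.mul_le_mul_right _ ht
        have : ((l₀ + (t + 1) * h : ℕ) : ℝ) ≤ l₁ := by exact_mod_cast (by omega)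
        simp only [mul_zero, add_zero]
        linarith
  have hascent := ascent n₂ k l₁ hXk (hkX.trans (by gcongr; linarith)) ηT_le_l₁ (by
    rw [l₂_eq]
    nlinarith)
  refine ⟨k, l₁ + n₂ * h, hk, hkX.trans hbX, by linarith, by linarith, ?_⟩
  refine le_trans ?_ ((mul_le_mul_of_nonneg_left hv_l₀ (Real.exp_pos _).le).trans
    (exp_mul_trans hcrude hascent))
  rw [← Real.exp_add, Real.exp_le_exp]
  suffices (y / h - η * (1 + 2 * (E.m + 1) + (1 + 3 * y))) * T ≤
      n₁ * -(E.m + 1) + n₂ * (y - η) - η * T by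
    calc _ = (y / h - η * (1 + 2 * (E.m + 1) + (1 + 3 * y))) * T * Real.log T := by ring
      _ ≤ (n₁ * -(E.m + 1) + n₂ * (y - η) - η * T) * Real.log T := by gcongr
      _ = _ := by ring
  have hh1 : (1 : ℝ) ≤ h := by exact_mod_cast hh
  have n₁_le : (n₁ : ℝ) * (E.m + 1) ≤ 2 * (η * T) * (E.m + 1) := by
    gcongr
    nlinarith [(Nat.cast_nonneg n₁ : (0 : ℝ) ≤ n₁)]
  have gain := le_mul_of_sub_mul_le hh1 hT0.le hη.le hηy.le
    (by linarith : (1 - 3 * η) * T ≤ n₂ * h)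
  linarith

end Equation

/-! ### Comparison with the Gevrey class -/

/-- The growth of a double sequence permitted by the Gevrey class `G{t, x}_{(s, σ)}`, in the
logarithmic form in which it is compared with `AxisGrowth`. -/
def GevreyBound (s σ : ℝ) (v : ℕ → ℕ → ℝ) : Prop :=
  ∃ C : ℝ, 0 ≤ C ∧ ∀ k l : ℕ, v k l ≤ Real.exp (C * ((k : ℝ) + l + 1) +
    (s - 1) * (k * Real.log k) + (σ - 1) * (l * Real.log l))

theorem factorial_rpow_le_exp (n : ℕ) {e : ℝ} (he : 0 ≤ e) :
    (n.factorial : ℝ) ^ e ≤ Real.exp (e * (n * Real.log n)) := by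
  have factorial_le : (n.factorial : ℝ) ≤ Real.exp (n * Real.log n) := by
    rcases Nat.eq_zero_or_pos n with rfl | hn
    · simp
    · rw [Real.exp_nat_mul, Real.exp_log (by exact_mod_cast hn)]
      exact_mod_cast Nat.factorial_le_pow n
  rw [mul_comm, Real.exp_mul]
  exact Real.rpow_le_rpow (by positivity) factorial_le he

theorem IsGevrey.gevreyBound {u : ℂ⟦X⟧⟦X⟧} {s σ : ℝ} (hs : 1 ≤ s) (hσ : 1 ≤ σ)
    (h : IsGevrey s σ u) : GevreyBound s σ (coeffNorm u) := by
  obtain ⟨r, hr, hsum⟩ := h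
  set f : ℕ × ℕ → ℝ := fun q => ‖coeff q.2 (coeff q.1 u)‖ /
      ((q.1.factorial : ℝ) ^ (s - 1) * (q.2.factorial : ℝ) ^ (σ - 1)) * r ^ (q.1 + q.2) with hf
  have f_nonneg : ∀ q, 0 ≤ f q := fun q => by positivity
  set S := ∑' q, f q + 1
  have hS : 0 < S := add_pos_of_nonneg_of_pos (tsum_nonneg f_nonneg) one_pos
  refine ⟨|Real.log S| + |Real.log r|, by positivity, fun k l => ?_⟩
  have f_le : f (k, l) ≤ S := (hsum.le_tsum (k, l) fun q _ => f_nonneg q).trans (by simp [S])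
  have norm_le : coeffNorm u k l ≤ S * (r ^ (k + l))⁻¹ *
      ((k.factorial : ℝ) ^ (s - 1) * (l.factorial : ℝ) ^ (σ - 1)) := by
    simp only [hf] at f_le
    rw [div_mul_eq_mul_div, div_le_iff₀ (by positivity), ← le_div_iff₀ (by positivity)] at f_le
    refine f_le.trans (le_of_eq ?_)
    field_simp
  have geometric_le : S * (r ^ (k + l))⁻¹ ≤
      Real.exp ((|Real.log S| + |Real.log r|) * ((k : ℝ) + l + 1)) := by
    have exp_eq : S * (r ^ (k + l))⁻¹ = Real.exp (Real.log S - (k + l : ℕ) * Real.log r) := by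
      rw [Real.exp_sub, Real.exp_log hS, Real.exp_nat_mul, Real.exp_log hr, div_eq_mul_inv]
    rw [exp_eq, Real.exp_le_exp, Nat.cast_add]
    have : (0 : ℝ) ≤ (k : ℝ) + l := by positivity
    nlinarith [le_abs_self (Real.log S), neg_abs_le (Real.log r), abs_nonneg (Real.log S),
      abs_nonneg (Real.log r)]
  rw [add_assoc, Real.exp_add, Real.exp_add]
  exact norm_le.trans (mul_le_mul geometric_le (mul_le_mul (factorial_rpow_le_exp k (by linarith))
    (factorial_rpow_le_exp l (by linarith)) (by positivity) (by positivity)) (by positivity)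
    (by positivity))

theorem eventually_mul_log_le {a δ : ℝ} (ha : 0 ≤ a) (hδ : 0 < δ) :
    ∀ᶠ T : ℕ in atTop, ∀ k : ℕ, (k : ℝ) ≤ a * T →
      k * Real.log k ≤ (a + δ) * (T * Real.log T) := by
  filter_upwards [eventually_le_mul_log (a * Real.log (a + 1)) hδ, eventually_ge_atTop 1]
    with T hlog hT k hk
  have hT1 : (1 : ℝ) ≤ T := by exact_mod_cast hT
  rcases Nat.eq_zero_or_pos k with rfl | hk0
  · have := Real.log_natCast_nonneg T
    simp only [Nat.cast_zero, zero_mul]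
    positivity
  have log_le : Real.log k ≤ Real.log (a + 1) + Real.log T := by
    rw [← Real.log_mul (by positivity) (by positivity)]
    exact Real.log_le_log (by exact_mod_cast hk0) (by linarith)
  calc k * Real.log k ≤ a * T * (Real.log (a + 1) + Real.log T) :=
        mul_le_mul hk log_le (Real.log_natCast_nonneg k) (by positivity)
    _ = T * (a * Real.log (a + 1)) + a * (T * Real.log T) := by ring
    _ ≤ T * (δ * Real.log T) + a * (T * Real.log T) := by gcongr
    _ = (a + δ) * (T * Real.log T) := by ring

theorem GevreyBound.eventually_le {s σ : ℝ} {v : ℕ → ℕ → ℝ} (h : GevreyBound s σ v) (hs : 1 ≤ s)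
    (hσ : 1 ≤ σ) {a b ε : ℝ} (ha : 0 ≤ a) (hb : 0 ≤ b) (hε : 0 < ε) :
    ∀ᶠ T : ℕ in atTop, ∀ k l : ℕ, (k : ℝ) ≤ a * T → (l : ℝ) ≤ b * T →
      v k l ≤ Real.exp (((s - 1) * a + (σ - 1) * b + ε) * (T * Real.log T)) := by
  obtain ⟨C, hC, hv⟩ := h
  have hsσ : 0 < s + σ - 1 := by linarith
  set δ := ε / (s + σ - 1)
  have hδ : 0 < δ := div_pos hε hsσ
  have δ_mul : ε = δ * (s + σ - 1) := (div_mul_cancel₀ ε hsσ.ne').symm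
  filter_upwards [eventually_mul_log_le ha hδ, eventually_mul_log_le hb hδ,
    eventually_le_mul_log (C * (a + b + 1)) hδ, eventually_ge_atTop 1]
    with T k_log_le l_log_le hlog hT k l hk hl
  have hT1 : (1 : ℝ) ≤ T := by exact_mod_cast hT
  refine (hv k l).trans (Real.exp_le_exp.2 ?_)
  have linear_le : C * ((k : ℝ) + l + 1) ≤ δ * (T * Real.log T) := by
    calc C * ((k : ℝ) + l + 1) ≤ C * (a * T + b * T + T) := by gcongr
      _ = T * (C * (a + b + 1)) := by ring
      _ ≤ T * (δ * Real.log T) := by gcongr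
      _ = _ := by ring
  have k_le := mul_le_mul_of_nonneg_left (k_log_le k hk) (by linarith : 0 ≤ s - 1)
  have l_le := mul_le_mul_of_nonneg_left (l_log_le l hl) (by linarith : 0 ≤ σ - 1)
  rw [δ_mul]
  linarith

theorem le_of_eventually_le_add_mul {x y K : ℝ} (h : ∀ᶠ ε : ℝ in 𝓝[>] 0, x ≤ y + ε * K) :
    x ≤ y := by
  have : Tendsto (fun ε : ℝ => y + ε * K) (𝓝[>] 0) (𝓝 y) := by
    refine tendsto_nhdsWithin_of_tendsto_nhds (Continuous.tendsto' (by fun_prop) 0 y ?_)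
    simp
  exact ge_of_tendsto this h

theorem AxisGrowth.le_sub_one {v : ℕ → ℕ → ℝ} {ρ s σ : ℝ} (h : AxisGrowth v ρ) (hs : 1 ≤ s)
    (hσ : 1 ≤ σ) (hv : GevreyBound s σ v) : ρ ≤ σ - 1 := by
  refine le_of_eventually_le_add_mul (K := (s - 1) + (σ - 1) + 2) ?_
  filter_upwards [self_mem_nhdsWithin] with ε (hε : 0 < ε)
  obtain ⟨T, ⟨k, l, -, hkT, -, hlT, lower⟩, upper, hlog, hT⟩ :=
    ((h ε hε).and ((hv.eventually_le hs hσ hε.le (by positivity : 0 ≤ 1 + ε) hε).and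
      ((eventually_le_mul_log 1 one_pos).and (eventually_ge_atTop 1)))).exists
  have hTlog : 0 < T * Real.log T := mul_pos (by exact_mod_cast hT) (by linarith)
  have := le_of_mul_le_mul_right (Real.exp_le_exp.1 (lower.trans (upper k l hkT hlT))) hTlog
  linarith

theorem AxisGrowth.eventually_scaled {v : ℕ → ℕ → ℝ} {ρ : ℝ} (h : AxisGrowth v ρ) (hρ : 0 ≤ ρ)
    {a ε : ℝ} (ha : 0 < a) (hε : 0 < ε) :
    ∀ᶠ n : ℕ in atTop, ∃ k l : ℕ, 1 ≤ k ∧ (k : ℝ) ≤ ε * n ∧ a * n ≤ l ∧ (l : ℝ) ≤ (a + ε) * n ∧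
      Real.exp ((ρ * a - ε) * (n * Real.log n)) ≤ v k l := by
  set δ := ε / (2 * (a + 2))
  have hδ : 0 < δ := by positivity
  have δ_mul : δ * (a + 2) = ε / 2 := by simp only [δ]; field_simp
  have ceil_tendsto : Tendsto (fun n : ℕ => ⌈a * (n : ℝ)⌉₊) atTop atTop :=
    tendsto_nat_ceil_atTop.comp (tendsto_natCast_atTop_atTop.const_mul_atTop ha)
  filter_upwards [ceil_tendsto.eventually (h δ hδ), eventually_le_mul 1 ha,
    eventually_le_mul 1 (half_pos hε), eventually_le_mul 1 one_pos,
    eventually_mul_log_le (by positivity : 0 ≤ a + 1) one_pos,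
    eventually_le_mul_log (ρ * (a * -Real.log a)) (half_pos hε)]
    with n ⟨k, l, hk, hkT, hTl, hlT, hv⟩ han hεn hn mul_log_le hlog
  set T := ⌈a * (n : ℝ)⌉₊
  have le_T : a * n ≤ T := Nat.le_ceil _
  have T_le : (T : ℝ) ≤ a * n + 1 := (Nat.ceil_lt_add_one (by positivity)).le
  have δT_le : δ * T ≤ ε / 2 * n := by
    calc δ * T ≤ δ * ((a + 2) * n) := by gcongr; linarith
      _ = ε / 2 * n := by rw [← δ_mul]; ring
  refine ⟨k, l, hk, by linarith, by linarith, by linarith, le_trans (Real.exp_le_exp.2 ?_) hv⟩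
  have T_log_ge : a * (n * Real.log n) + n * (a * Real.log a) ≤ T * Real.log T := by
    calc _ = a * n * Real.log (a * n) := by
          rw [Real.log_mul ha.ne' (by linarith)]
          ring
      _ ≤ T * Real.log T := by gcongr; exact Real.log_nonneg han
  have main_ge := mul_le_mul_of_nonneg_left T_log_ge hρ
  have error_le : δ * (T * Real.log T) ≤ ε / 2 * (n * Real.log n) := by
    calc δ * (T * Real.log T) ≤ δ * ((a + 1 + 1) * (n * Real.log n)) := by
          refine mul_le_mul_of_nonneg_left ?_ hδ.le
          exact mul_log_le T (by linarith)
      _ = ε / 2 * (n * Real.log n) := by rw [← δ_mul]; ring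
  have constant_le := mul_le_mul_of_nonneg_left hlog n.cast_nonneg
  linarith

namespace Equation

variable {E : Equation} {v : ℕ → ℕ → ℝ} {j μ b r : ℕ} {γ : ℝ}

theorem exp_mul_log_mul_le {N ε γ I c D : ℝ} {j α m : ℕ} (hN : 0 < N) (hε : 0 < ε) (hγ : 0 < γ)
    (h : I * c ^ m * D / (γ * ε ^ (j + α)) ≤ N ^ ε) :
    Real.exp ((j + α - m - ε) * Real.log N) * (I * (c * N) ^ m * D) ≤
      γ * ((ε * N) ^ j * (ε * N) ^ α) := by
  have rpow_split : N ^ (j + α) = N ^ (j + α - m - ε : ℝ) * N ^ m * N ^ ε := by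
    rw [← Real.rpow_natCast, ← Real.rpow_natCast, ← Real.rpow_add hN, ← Real.rpow_add hN]
    congr 1
    push_cast
    ring
  rw [div_le_iff₀ (by positivity)] at h
  calc Real.exp ((j + α - m - ε) * Real.log N) * (I * (c * N) ^ m * D)
      = N ^ (j + α - m - ε : ℝ) * N ^ m * (I * c ^ m * D) := by
        rw [exp_mul_log hN, mul_pow]
        ring
    _ ≤ N ^ (j + α - m - ε : ℝ) * N ^ m * (N ^ ε * (γ * ε ^ (j + α))) := by gcongr
    _ = N ^ (j + α) * (γ * ε ^ (j + α)) := by rw [rpow_split]; ring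
    _ = γ * ((ε * N) ^ j * (ε * N) ^ α) := by rw [← pow_add, mul_pow]; ring

theorem StepBound.eventually_fine_descent (hS : E.StepBound v γ (j, μ + b) r μ)
    (hv : ∀ k l, 0 ≤ v k l) (hγ : 0 < γ) {c ε : ℝ} (hc : 0 ≤ c) (hε : 0 < ε) :
    ∀ᶠ N : ℕ in atTop, ∀ n k l : ℕ, ε * N ≤ k → n * b + ε * N ≤ l →
      ((k + n * r + l : ℕ) : ℝ) ≤ c * N →
      Real.exp (n * ((j + (μ + b) - E.m - ε) * Real.log N)) * v k l ≤
        v (k + n * r) (l - n * b) := by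
  have : 0 ≤ E.indicialConst := zero_le_one.trans E.one_le_indicialConst
  have : 0 ≤ c ^ E.m := pow_nonneg hc _
  filter_upwards [eventually_ge_atTop 1, eventually_le_mul 1 hε,
    eventually_le_mul (μ + b : ℝ) hε, eventually_le_rpow
      (E.indicialConst * c ^ E.m * (((μ + b : ℕ) : ℝ) + 1) ^ (μ + b) / (γ * ε ^ (j + (μ + b)))) hε]
    with N hN hεN hαN hNε n k l hk hl hkl
  have hN0 : (0 : ℝ) < N := by exact_mod_cast hN
  have εN_le : ∀ t ≤ n, t * b ≤ l ∧ ε * N ≤ ((l - t * b : ℕ) : ℝ) := by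
    intro t ht
    have htn : (t : ℝ) * b ≤ n * b := by gcongr
    have htl : t * b ≤ l := by rify; linarith
    refine ⟨htl, ?_⟩
    push_cast [htl]
    linarith
  have absIndicial_le : ∀ t < n, E.absIndicial (k + (t + 1) * r) (l - (t + 1) * b) ≤
      E.indicialConst * (c * N) ^ E.m := by
    intro t ht
    have hk1 : 1 ≤ k := by exact_mod_cast hεN.trans hk
    have htr : (t + 1) * r ≤ n * r := Nat.mul_le_mul_right _ ht
    refine (absIndicial_le_pow (by omega) _).trans ?_
    gcongr
    exact le_trans (by exact_mod_cast (by omega)) hkl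
  simpa using hS.exp_mul_le hv hγ (L := fun t => l - t * b) (by exact_mod_cast hεN.trans hk)
    (fun t ht => by
      have hle : μ + b ≤ l - t * b := by
        exact_mod_cast (by push_cast; exact hαN : ((μ + b : ℕ) : ℝ) ≤ ε * N).trans (εN_le t ht.le).2
      have : (t + 1) * b = t * b + b := by ring
      exact ⟨hle, by omega⟩)
    (by positivity) hk (by positivity) (fun t ht => (εN_le t ht.le).2) absIndicial_le
    (by exact_mod_cast exp_mul_log_mul_le hN0 hε hγ hNε)

theorem sub_mul_add_le {x y ε A M : ℝ} (hx : 0 ≤ x) (hM : 0 ≤ M) (hε : 0 ≤ ε)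
    (h : x ≤ 2 * ε * (x + y)) :
    (A - ε * (2 * |A| + 1 + 2 * M)) * (x + y) ≤ x * -M + y * (A - ε) := by
  have loss := mul_le_mul_of_nonneg_left h (by positivity : 0 ≤ |A| + M)
  have hA_loss : x * A ≤ x * |A| := by gcongr; exact le_abs_self A
  have : 0 ≤ x * ε := by positivity
  linarith

theorem StepBound.eventually_descent (hS : E.StepBound v γ (j, μ + b) r μ)
    (hv : ∀ k l, 0 ≤ v k l) (hγ : 0 < γ) (hr : 1 ≤ r) {ε : ℝ} (hε : 0 < ε) (hε1 : ε ≤ 1) {A : ℝ}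
    (hA : A = j + (μ + b) - E.m) :
    ∀ᶠ n : ℕ in atTop, ∀ k l : ℕ, 1 ≤ k → (k : ℝ) ≤ n → (b + ε) * n ≤ l → (l : ℝ) ≤ (b + 2) * n →
      Real.exp ((A - ε * (2 * |A| + 1 + 2 * (E.m + 1))) * (n * Real.log n)) * v k l ≤
        v (k + n * r) (l - n * b) := by
  have hc : (0 : ℝ) ≤ r + b + 3 := by positivity
  filter_upwards [hS.eventually_crude hv hγ hc, hS.eventually_fine_descent hv hγ hc hε,
    eventually_le_mul (1 + (μ + b) : ℝ) hε] with n crude fine hn k l hk hkn hl hln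
  have hlog := Real.log_natCast_nonneg n
  set n₁ := ⌈ε * (n : ℝ)⌉₊
  have n₁_ge : ε * n ≤ n₁ := Nat.le_ceil _
  have n₁_lt : (n₁ : ℝ) < ε * n + 1 := Nat.ceil_lt_add_one (by positivity)
  have n₁_le : n₁ ≤ n := Nat.ceil_le.2 (mul_le_of_le_one_left n.cast_nonneg hε1)
  clear_value n₁
  obtain ⟨n₂, rfl⟩ := Nat.exists_eq_add_of_le n₁_le
  have hnb : ((n₁ + n₂) * b : ℕ) + ε * (n₁ + n₂ : ℕ) ≤ (l : ℝ) := by push_cast at hl ⊢; linarith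
  have size_le : ((k + (n₁ + n₂) * r + l : ℕ) : ℝ) ≤ (r + b + 3) * (n₁ + n₂ : ℕ) := by
    push_cast at hkn hln ⊢
    linarith
  have hl₁ : n₁ * b + n₂ * b + (1 + (μ + b)) ≤ l := by
    rify
    push_cast at hl hn
    linarith
  have descent₁ : Real.exp (n₁ * (-(E.m + 1) * Real.log (n₁ + n₂ : ℕ))) * v k l ≤
      v (k + n₁ * r) (l - n₁ * b) := by
    have tb_le : ∀ t < n₁, t * b + b ≤ n₁ * b := fun t ht => by
      rw [← Nat.succ_mul]
      exact Nat.mul_le_mul_right _ ht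
    simpa using crude n₁ k (fun t => l - t * b) hk
      (fun t ht => by
        have := tb_le t ht
        rw [add_mul, one_mul]
        omega)
      fun t ht => by
        have : (t + 1) * r ≤ (n₁ + n₂) * r := Nat.mul_le_mul_right _ (by omega)
        exact le_trans (by exact_mod_cast (by omega)) size_le
  have descent₂ := fine n₂ (k + n₁ * r) (l - n₁ * b)
    (n₁_ge.trans (by exact_mod_cast (Nat.le_mul_of_pos_right _ hr).trans (Nat.le_add_left _ _)))
    (by rw [Nat.cast_sub (by omega)]; push_cast at hnb ⊢; linarith)
    (le_trans (by exact_mod_cast (by rw [add_mul]; omega)) size_le)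
  rw [show k + (n₁ + n₂) * r = k + n₁ * r + n₂ * r by ring,
    show l - (n₁ + n₂) * b = l - n₁ * b - n₂ * b by rw [add_mul, Nat.sub_add_eq]]
  refine le_trans ?_ (exp_mul_trans descent₁ descent₂)
  refine mul_le_mul_of_nonneg_right (Real.exp_le_exp.2 ?_) (hv _ _)
  have n₁_le_mul : (n₁ : ℝ) ≤ 2 * ε * (n₁ + n₂) := by push_cast at n₁_lt hn; linarith
  have := mul_le_mul_of_nonneg_right
    (sub_mul_add_le (A := A) (M := E.m + 1) n₁.cast_nonneg (by positivity) hε.le n₁_le_mul) hlog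
  rw [← hA]
  push_cast at this ⊢
  linarith

theorem StepBound.exponent_le_of_gevreyBound (hS : E.StepBound v γ (j, μ + b) r μ)
    (hv : ∀ k l, 0 ≤ v k l) (hγ : 0 < γ) (hr : 1 ≤ r) {ρ s σ : ℝ} (hρ : 0 ≤ ρ)
    (hgrowth : AxisGrowth v ρ) (hs : 1 ≤ s) (hσ : 1 ≤ σ) (hbound : GevreyBound s σ v) :
    (j + (μ + b) - E.m : ℝ) + ρ * b ≤ (s - 1) * r := by
  obtain ⟨A, hA⟩ : ∃ A : ℝ, A = j + (μ + b) - E.m := ⟨_, rfl⟩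
  rw [← hA]
  refine le_of_eventually_le_add_mul
    (K := 2 * |A| + 1 + 2 * (E.m + 1) + 2 - ρ + (s - 1) + 2 * (σ - 1)) ?_
  filter_upwards [Ioo_mem_nhdsGT one_pos] with ε ⟨hε, hε1⟩
  obtain ⟨n, ⟨k, l, hk, hkn, hnl, hln, lower⟩, descent, upper, hlog, hn⟩ :=
    ((hgrowth.eventually_scaled hρ (by positivity : 0 < b + ε) hε).and
    ((hS.eventually_descent hv hγ hr hε hε1.le hA).and
    ((hbound.eventually_le hs hσ (by positivity : 0 ≤ r + ε) (by positivity : 0 ≤ 2 * ε) hε).and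
    ((eventually_le_mul_log 1 one_pos).and (eventually_ge_atTop 1))))).exists
  have hn0 : (0 : ℝ) < n := by exact_mod_cast hn
  have hεn : ε * n ≤ 1 * n := by gcongr
  have hnb : n * b ≤ l := by
    rify
    nlinarith
  have hend := upper (k + n * r) (l - n * b) (by push_cast; linarith)
    (by push_cast [hnb]; linarith)
  have hdescent := descent k l hk (by linarith) hnl (by linarith)
  have hchain : Real.exp ((A - ε * (2 * |A| + 1 + 2 * (E.m + 1))) * (n * Real.log n)) *
      Real.exp ((ρ * (b + ε) - ε) * (n * Real.log n)) ≤ _ :=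
    (mul_le_mul_of_nonneg_left lower (Real.exp_pos _).le).trans (hdescent.trans hend)
  rw [← Real.exp_add, Real.exp_le_exp, ← add_mul] at hchain
  have := le_of_mul_le_mul_right hchain (mul_pos hn0 (by linarith))
  linarith

end Equation

/-! ### The lower bounds for `σ` and `s` -/

namespace Equation

variable {E : Equation}

theorem exists_coeff_g_add_single_ne_zero
    (h : ∃ (i : ℕ) (ν : E.M → ℕ), 1 ≤ ∑ p, ν p ∧ E.g i ν ≠ 0) :
    ∃ (i : ℕ) (ν : E.M → ℕ) (p : E.M) (μ : ℕ), coeff μ (E.g i (ν + Pi.single p 1)) ≠ 0 := by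
  obtain ⟨i, ν, hν, hg⟩ := h
  obtain ⟨p, -, hp⟩ := Finset.exists_ne_zero_of_sum_ne_zero (by omega : ∑ p, ν p ≠ 0)
  obtain ⟨μ, hμ⟩ := exists_coeff_ne_zero_iff_ne_zero.2 hg
  have single_le : Pi.single p 1 ≤ ν := update_le_iff.2
    ⟨Nat.one_le_iff_ne_zero.2 hp, fun q _ => Nat.zero_le (ν q)⟩
  exact ⟨i, ν - Pi.single p 1, p, μ, by rwa [tsub_add_cancel_of_le single_le]⟩

theorem exists_coeff_g_ne_zero_of_L_eq {μ n : ℕ} {p : E.M} (h : E.L μ p = n) :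
    ∃ (i : ℕ) (ν : E.M → ℕ), i + ∑ q, ν q = n ∧ coeff μ (E.g i (ν + Pi.single p 1)) ≠ 0 := by
  by_contra! hzero
  have n_lt : ((n + 1 : ℕ) : ℕ∞) ≤ E.L μ p := by
    refine le_iInf₂ fun i ν => le_iInf fun hne => Nat.cast_le.2 ?_
    have le_val : E.L μ p ≤ (i + ∑ q, ν q : ℕ) := iInf₂_le_of_le i ν (iInf_le _ hne)
    rw [h, Nat.cast_le] at le_val
    refine lt_of_le_of_ne le_val fun heq => ?_
    exact coeff_ne_zero_of_derivative_iterate (right_ne_zero_of_mul hne) (hzero i ν heq.symm)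
  rw [h, Nat.cast_le] at n_lt
  omega

namespace SignCond

variable (hE : E.SignCond) {u : ℂ⟦X⟧⟦X⟧} (hu : E.IsFormalSolution u)
  (ham : coeff E.m E.a ≠ 0) (ha : ∀ μ ≤ E.maxAlpha, coeff μ E.a ≠ 0)
  (hdep : ∃ (i : ℕ) (ν : E.M → ℕ), 1 ≤ ∑ p, ν p ∧ E.g i ν ≠ 0)
include hE hu ham ha hdep

theorem axisGrowth_dist_div_ordC {p : ℕ × ℕ} (hp : p ∈ E.Lam1) (hd : 0 < E.dist p) :
    AxisGrowth (coeffNorm u) (E.dist p / E.ordC p) := by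
  obtain ⟨i, ν, p₀, μ, hg⟩ := exists_coeff_g_add_single_ne_zero hdep
  obtain ⟨γ, hγ, hN⟩ := hE.exists_stepBound_of_coeff_g_ne_zero hu ha hg
  have hord : (0 : ℝ) < E.ordC p := by exact_mod_cast one_le_ordC hp
  refine AxisGrowth.of_forall_lt (by positivity) fun ρ hρ hρ0 => ?_
  obtain ⟨θ, hθ0, hθ1, hslope⟩ :=
    exists_supporting_slope hp.1 (mul_pos hρ0 hord) ((lt_div_iff₀ hord).1 hρ)
  have hpm : p.2 ≤ E.m := le_of_add_le_right (mem_indexI.1 hp.1).2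
  have := (hE.stepBound_of_mem_Lam1 hu hp).axisGrowth hN (coeffNorm_nonneg u)
    (norm_pos_iff.2 (coeff_ordC_ne_zero hp)) hγ (one_le_ordC hp) hpm
    (one_le_of_coeff_add_single_ne_zero hg) (hE.coeffNorm_one_pos hu ham) hθ0 hθ1
    (mul_pos hρ0 hord) hslope
  rwa [mul_div_cancel_right₀ _ hord.ne'] at this

theorem axisGrowth_sigma0_sub_one (hσ0 : 1 < E.sigma0) :
    AxisGrowth (coeffNorm u) (E.sigma0 - 1) := by
  have sigma0_mem : E.sigma0 ∈ insert 1
      ((fun p => ((E.ordC p : ℝ) + E.dist p) / (E.ordC p : ℝ)) '' E.Lam1) :=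
    (Set.insert_nonempty _ _).csSup_mem ((E.finite_Lam1.image _).insert 1)
  obtain h | ⟨p, hp, h⟩ := sigma0_mem
  · exact absurd h hσ0.ne'
  have hord : (0 : ℝ) < E.ordC p := by exact_mod_cast one_le_ordC hp
  have sigma0_eq : E.sigma0 - 1 = E.dist p / E.ordC p := by
    rw [← h]
    field_simp
    ring
  have hd : 0 < E.dist p / E.ordC p := sigma0_eq ▸ sub_pos.2 hσ0
  rw [sigma0_eq]
  exact hE.axisGrowth_dist_div_ordC hu ham ha hdep hp ((div_pos_iff_of_pos_right hord).1 hd)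

theorem sigma0_le (hσ0 : 1 < E.sigma0) {s σ : ℝ} (hs : 1 ≤ s) (hσ : 1 ≤ σ) (h : IsGevrey s σ u) :
    E.sigma0 ≤ σ := by
  have := (hE.axisGrowth_sigma0_sub_one hu ham ha hdep hσ0).le_sub_one hs hσ (h.gevreyBound hs hσ)
  linarith

theorem s1_le (hσ0 : 1 < E.sigma0) {s σ : ℝ} (hs : 1 ≤ s) (hσ : 1 ≤ σ) (h : IsGevrey s σ u) :
    E.s1 ≤ s := by
  rw [s1, ← le_sub_iff_add_le']
  refine csSup_le (Set.insert_nonempty _ _) ?_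
  rintro _ (rfl | ⟨μ, -, ⟨⟨j, α⟩, hp⟩, hμ, rfl⟩)
  · exact sub_nonneg.2 hs
  split_ifs with hL
  · exact sub_nonneg.2 hs
  obtain ⟨n, hn⟩ := ENat.ne_top_iff_exists.1 hL
  obtain ⟨i, ν, rfl, hg⟩ := exists_coeff_g_ne_zero_of_L_eq hn.symm
  have hr := one_le_of_coeff_add_single_ne_zero hg
  obtain ⟨γ, hγ, hN⟩ := hE.exists_stepBound_of_coeff_g_ne_zero hu ha hg
  obtain ⟨b, rfl⟩ := Nat.exists_eq_add_of_le hμ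
  have := hN.exponent_le_of_gevreyBound (coeffNorm_nonneg u) hγ hr (by linarith)
    (hE.axisGrowth_sigma0_sub_one hu ham ha hdep hσ0) hs hσ (h.gevreyBound hs hσ)
  rw [← hn, ENat.toNat_natCast, div_le_iff₀ (by exact_mod_cast hr)]
  push_cast at this ⊢
  linarith

end SignCond

end Equation

end TotChar

theorem theorem6p3 (E : TotChar.Equation)
    (h_s : E.s0 = E.s1)
    -- degenerate cases in which the equivalence fails are excluded
    (h_one : E.sigma0 = 1 → E.s0 = 1)
    (h_dep : 1 < E.sigma0 → ∃ (i : ℕ) (ν : E.M → ℕ), 1 ≤ ∑ p, ν p ∧ E.g i ν ≠ 0)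
    -- positivity of `a`
    (h_am : 0 < PowerSeries.constantCoeff ((PowerSeries.derivative ℂ)^[E.m] E.a))
    (h_aμ : ∀ μ ≤ E.maxAlpha,
      0 < PowerSeries.constantCoeff ((PowerSeries.derivative ℂ)^[μ] E.a))
    (h_a : TotChar.SeriesNonneg E.a)
    -- `c_{j,α}(0) ≤ 0`
    (h_c0 : ∀ p ∈ TotChar.indexI E.m, PowerSeries.constantCoeff (E.c p) ≤ 0)
    -- `c_{j,α}(x) - c_{j,α}(0) ≫ 0`
    (h_c : ∀ p ∈ TotChar.indexI E.m,
      TotChar.SeriesNonneg (E.c p - PowerSeries.C (PowerSeries.constantCoeff (E.c p))))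
    -- `g_{i,ν}(x) ≫ 0`
    (h_g : ∀ (i : ℕ) (ν : E.M → ℕ), 2 ≤ i + ∑ p, ν p → TotChar.SeriesNonneg (E.g i ν)) :
    (∃! u : ℂ⟦X⟧⟦X⟧, E.IsFormalSolution u) ∧
      ∀ u : ℂ⟦X⟧⟦X⟧, E.IsFormalSolution u →
        ∀ s σ : ℝ, 1 ≤ s → 1 ≤ σ →
          (TotChar.IsGevrey s σ u ↔ E.s0 ≤ s ∧ E.sigma0 ≤ σ) := by
  have hE : E.SignCond := ⟨h_a, h_c0, h_c, h_g⟩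
  have ham : PowerSeries.coeff E.m E.a ≠ 0 :=
    TotChar.coeff_ne_zero_of_derivative_iterate h_am.ne'
  have ha : ∀ μ ≤ E.maxAlpha, PowerSeries.coeff μ E.a ≠ 0 := fun μ hμ =>
    TotChar.coeff_ne_zero_of_derivative_iterate (h_aμ μ hμ).ne'
  refine ⟨TotChar.Equation.existsUnique_isFormalSolution hE.indicial_ne_zero,
    fun u hu s σ hs hσ => ⟨fun h => ?_, fun h => hE.isGevrey hu h.1 h.2⟩⟩
  rcases E.one_le_sigma0.eq_or_lt with hσ0 | hσ0
  · exact ⟨(h_one hσ0.symm).trans_le hs, hσ0.symm.trans_le hσ⟩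
  · exact ⟨h_s.trans_le (hE.s1_le hu ham ha (h_dep hσ0) hσ0 hs hσ h),
      hE.sigma0_le hu ham ha (h_dep hσ0) hσ0 hs hσ h⟩
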